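/- **Setting.** Let $A,C,p,s>0$. Identify $\mathbb R^3$ with $\mathrm{su}(2)$, with scalar product $\langle x,y\rangle=-2\,\mathrm{Tr}(xy)$, and put $k=\tfrac12\,\mathrm{diag}(i,-i)$. For a $C^2$ curve $\Phi=\begin{pmatrix}\alpha&\beta\\ \gamma&\delta\end{pmatrix}$ in $\mathrm{SU}(2)$, defined on a non-empty open interval $J$, let $\omega=\Phi'\Phi^{-1}$, $r=\Phi k\Phi^{-1}$, $u=\langle r,k\rangle$. The toy top (moments of inertia $C$ about the symmetry axis and $A$ about perpendicular axes through the centre of mass, distance $s$ from tip to centre of mass, mass $p/s$, gravitational acceleration $1$) has the Lagrangian $L=T-V$ with $$T=\tfrac12A\langle\omega,\omega\rangle+\tfrac12(C-A)\langle\omega,r\rangle^2+\tfrac12ps\langle[r,k],\omega\rangle^2,\qquad V=p\langle r,k\rangle .$$ With $m=\partial L/\partial\omega$ and $\langle DL(\Phi,\omega),\eta\rangle=\frac{d}{d\epsilon}L(e^{\epsilon\eta}\Phi,\omega)|_{\epsilon=0}$, a motion is a solution of $m'=[\omega,m]+DL(\Phi,\omega)$; its first integrals are $h=T+V$, $l=\langle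 m,k\rangle$, $n=\langle m,r\rangle$. Its dynamical constants are the real numbers $-1\le e_1\le e_2\le1\le e_3$ with $$\tfrac1p(1-x^2)\bigl(h-\tfrac{n^2}{2C}-px\bigr)-\tfrac1{2Ap}(l-nx)^2=(x-e_1)(x-e_2)(x-e_3)\quad\text{for all }x;$$ they exist for every motion. Put $e_4=\sqrt{1+A/(ps)}$, $R(u)=(u-e_1)(u-e_2)(u-e_3)(u^2-e_4^2)$, and consider the curve $w^2=R(u)$. For values $w_{+1},w_{-1}$ of $w$ over $u=1,-1$ (that is, $w_{\pm1}^2=R(\pm1)$), consider on it the differentials $$\eta_\alpha=\tfrac1{2(u+1)}\Bigl(w+\tfrac{u^2-e_4^2}{1-e_4^2}w_{-1}\Bigr)\tfrac{du}w,\qquad \eta_\beta=\tfrac1{2(u-1)}\Bigl(w-\tfrac{u^2-e_4^2}{1-e_4^2}w_{+1}\Bigr)\tfrac{du}w,$$ $$\eta_\gamma=\tfrac1{2(u-1)}\Bigl(w+\tfrac{u^2-e_4^2}{1-e_4^2}w_{+1}\Bigr)\tfrac{du}w,\qquad \eta_\delta=\tfrac1{2(u+1)}\Bigl(w-\tfrac{u^2-e_4^2}{1-e_4^2}w_{-1}\Bigr)\tfrac{du}w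 .$$ **Proposition.** (1) *Spherical top ($A=C$).* Let $-1\le e_1\le e_2\le1\le e_3$. The map $$(h,l,n)\mapsto (w_{+1},w_{-1}),\qquad w_{\pm1}=\sqrt{\tfrac s2}\,(1-e_4^2)\,\tfrac1A\,(l\mp n),$$ is a bijection from the triples $(h,l,n)$ with dynamical constants $e_1,e_2,e_3$ onto the pairs of values of $w$ over $u=\pm1$. For each such triple, a $C^2$ curve $\Phi:J\to\mathrm{SU}(2)$ is a motion with first integrals $h,l,n$ and non-constant $u$ if and only if the path $u(t)$, $t\in J$, lifts to a continuous path $(u(t),w(t))$ on the curve $w^2=R(u)$ along which $$t=-i\sqrt{\tfrac s2}\int(u^2-e_4^2)\frac{du}w,\qquad \log\alpha=\int\eta_\alpha,\quad\log\beta=\int\eta_\beta,\quad\log\gamma=\int\eta_\gamma,\quad\log\delta=\int\eta_\delta,$$ each logarithm being considered on the time intervals on which the respective entry of $\Phi$ does not vanish (integrals are meant up to additive constants). (2) Let $-1\le e_1<e_2\le1\le e_3$, $e_2<e_3$ and $e_3\ne e_4$, so that $w^2=R(u)$, compactified by one point $\infty$, is a smooth hyperelliptic curve of genus $2$, and let $w_{\pm1}$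 be any values of $w$ over $u=\pm1$. Then $\eta_\alpha,\eta_\beta,\eta_\gamma,\eta_\delta$ are meromorphic differentials on it (so that their integrals are Abelian integrals of the third kind), each with exactly two singularities: a simple pole with residue $-1$ at $\infty$, and a simple pole with residue $1$ at $(u,w)=(-1,w_{-1})$ for $\eta_\alpha$, at $(1,-w_{+1})$ for $\eta_\beta$, at $(1,w_{+1})$ for $\eta_\gamma$, and at $(-1,-w_{-1})$ for $\eta_\delta$. (3) *General top.* Let $\tau=\bigl(\tfrac1C-\tfrac1A\bigr)n$. The motions of the top with moments of inertia $A,C$ and with first integrals $h+\tfrac{n^2}{2C},\,l,\,n$ are exactly the curves $$\Phi(t)\begin{pmatrix}e^{\frac i2\tau t}&0\\0&e^{-\frac i2\tau t}\end{pmatrix},$$ where $\Phi$ is a motion of the spherical top, with both moments of inertia equal to $A$ (and the same $p$, $s$), with first integrals $h+\tfrac{n^2}{2A},\,l,\,n$. The dynamical constants of these two triples are the same. That is, the solution differs from the one for the spherical top only by a uniform rotation with rate $\tau$ about the symmetry axis. -/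

import Mathlib

open scoped Matrix

noncomputable section

namespace ToyTop

/-! ### Kinematics on `SU(2)` -/

/-- Complex `2 × 2` matrices. -/
abbrev Mat := Matrix (Fin 2) (Fin 2) ℂ

/-- The scalar product `⟨x, y⟩ = -2 Tr (x y)` (real on skew Hermitian matrices). -/
def ip (x y : Mat) : ℝ := (-2 * (x * y).trace).re

/-- The upward unit vector `k = e₃` in `su(2)`. -/
def k : Mat := !![Complex.I / 2, 0; 0, -Complex.I / 2]

/-- The unit vector `r = Φ k Φ⁻¹` along the symmetry axis. -/
def axis (Φ : Mat) : Mat := Φ * k * Φ⁻¹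

/-- `u = ⟨r, k⟩`. -/
def height (Φ : Mat) : ℝ := ip (axis Φ) k

/-- Entrywise derivative of a matrix valued curve. -/
def mderiv (Φ : ℝ → Mat) (t : ℝ) : Mat :=
  Matrix.of fun i j => deriv (fun x => Φ x i j) t

/-- Angular velocity in the fixed frame, `ω = Φ' Φ⁻¹`. -/
def angVel (Φ : ℝ → Mat) (t : ℝ) : Mat := mderiv Φ t * (Φ t)⁻¹

/-! ### Dynamics

`C` and `A` are the moments of inertia for the symmetry axis and for a perpendicular axis through
the centre of mass, `s` is the distance from the tip to the centre of mass, and `p` is the mass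
times `s`; the gravitational acceleration is `1`. Tangent vectors are trivialized on the right,
as pairs `(Φ, ω)`. -/

/-- Kinetic energy. -/
def kinetic (A C p s : ℝ) (Φ ω : Mat) : ℝ :=
  1 / 2 * A * ip ω ω + 1 / 2 * (C - A) * ip ω (axis Φ) ^ 2
    + 1 / 2 * (p * s) * ip ⁅axis Φ, k⁆ ω ^ 2

/-- Potential energy. -/
def potential (p : ℝ) (Φ : Mat) : ℝ := p * ip (axis Φ) k

/-- The Lagrangian `L = T - V`. -/
def lagrangian (A C p s : ℝ) (Φ ω : Mat) : ℝ := kinetic A C p s Φ ω - potential p Φ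

/-- The momentum `m = ∂L/∂ω`; see `hasDerivAt_lagrangian_right`. -/
def momentum (A C p s : ℝ) (Φ ω : Mat) : Mat :=
  A • ω + ((C - A) * ip ω (axis Φ)) • axis Φ + (p * s * ip ⁅axis Φ, k⁆ ω) • ⁅axis Φ, k⁆

/-- The derivative `DL` of the Lagrangian with respect to its first argument, that is,
`⟨DL(Φ, ω), η⟩ = d/dε L(exp (ε η) Φ, ω)` at `ε = 0`; see `hasDerivAt_lagrangian_left`. -/
def DL (A C p s : ℝ) (Φ ω : Mat) : Mat :=
  ((C - A) * ip ω (axis Φ)) • ⁅axis Φ, ω⁆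
    + (p * s * ip ⁅axis Φ, k⁆ ω) • ⁅axis Φ, ⁅k, ω⁆⁆ - p • ⁅axis Φ, k⁆

section

attribute [local instance] Matrix.linftyOpNormedRing Matrix.linftyOpNormedAlgebra

theorem ip_add_left (x y z : Mat) : ip (x + y) z = ip x z + ip y z := by
  simp [ip, add_mul, Matrix.trace_add]; ring

theorem ip_smul_left (a : ℝ) (x z : Mat) : ip (a • x) z = a * ip x z := by
  simp [ip, Matrix.trace_smul]; ring

theorem ip_comm (x y : Mat) : ip x y = ip y x := by
  simp only [ip, Matrix.trace_mul_comm x y]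

theorem ip_add_right (x y z : Mat) : ip x (y + z) = ip x y + ip x z := by
  rw [ip_comm, ip_add_left, ip_comm y, ip_comm z]

theorem ip_smul_right (a : ℝ) (x z : Mat) : ip x (a • z) = a * ip x z := by
  rw [ip_comm, ip_smul_left, ip_comm]

theorem ip_bracket (x y z : Mat) : ip ⁅x, y⁆ z = ip x ⁅y, z⁆ := by
  simp only [ip, Ring.lie_def, sub_mul, mul_sub, Matrix.trace_sub]
  rw [Matrix.trace_mul_cycle y x z, Matrix.trace_mul_comm (z * y) x]
  simp only [mul_assoc]

theorem hasDerivAt_lagrangian_right (A C p s : ℝ) (Φ ω η : Mat) :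
    HasDerivAt (fun ε : ℝ => lagrangian A C p s Φ (ω + ε • η))
      (ip (momentum A C p s Φ ω) η) 0 := by
  have hid (b c : ℝ) : HasDerivAt (fun ε : ℝ => b + ε * c) c 0 := by
    simpa using ((hasDerivAt_id (0 : ℝ)).mul_const c).const_add b
  have h1 := ((hid (ip ω ω) (ip ω η)).add
    ((hasDerivAt_id (0 : ℝ)).mul (hid (ip η ω) (ip η η)))).const_mul (1 / 2 * A)
  have h2 := ((hid (ip ω (axis Φ)) (ip η (axis Φ))).pow 2).const_mul (1 / 2 * (C - A))
  have h3 := ((hid (ip ⁅axis Φ, k⁆ ω) (ip ⁅axis Φ, k⁆ η)).pow 2).const_mul (1 / 2 * (p * s))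
  have h := ((h1.add h2).add h3).sub_const (potential p Φ)
  refine (h.congr_deriv ?_).congr_of_eventuallyEq (Filter.Eventually.of_forall fun ε => ?_)
  · simp only [momentum, ip_add_left, ip_smul_left]
    rw [ip_comm (axis Φ) η, ip_comm η ω]
    simp
    ring
  · simp only [lagrangian, kinetic, ip_add_left, ip_smul_left, ip_add_right, ip_smul_right,
      Pi.add_apply, Pi.mul_apply, Pi.pow_apply, id]
    ring

theorem hasDerivAt_axis (Φ η : Mat) :
    HasDerivAt (fun ε : ℝ => axis (NormedSpace.exp (ε • η) * Φ)) ⁅η, axis Φ⁆ 0 := by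
  have h1 : HasDerivAt (fun ε : ℝ => NormedSpace.exp (ε • η)) η 0 := by
    have h := hasDerivAt_exp_smul_const (𝕂 := ℝ) η (0 : ℝ)
    simp only [zero_smul, NormedSpace.exp_zero, one_mul] at h
    exact h
  have h2 : HasDerivAt (fun ε : ℝ => NormedSpace.exp (ε • (-η))) (-η) 0 := by
    have h := hasDerivAt_exp_smul_const (𝕂 := ℝ) (-η) (0 : ℝ)
    simp only [zero_smul, NormedSpace.exp_zero, one_mul] at h
    exact h
  have h := (h1.mul_const (axis Φ)).mul h2
  refine (h.congr_deriv ?_).congr_of_eventuallyEq (Filter.Eventually.of_forall fun ε => ?_)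
  · simp [Ring.lie_def, sub_eq_add_neg]
  · simp only [axis, Matrix.mul_inv_rev, smul_neg, Matrix.exp_neg, mul_assoc, Pi.mul_apply]

theorem hasDerivAt_ip (y : Mat) {f : ℝ → Mat} {f' : Mat} (hf : HasDerivAt f f' 0) :
    HasDerivAt (fun ε => ip (f ε) y) (ip f' y) 0 := by
  let L : Mat →ₗ[ℝ] ℝ :=
    { toFun := fun x => ip x y
      map_add' := fun a b => ip_add_left a b y
      map_smul' := fun a b => ip_smul_left a b y }
  exact (LinearMap.toContinuousLinearMap L).hasFDerivAt.comp_hasDerivAt 0 hf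

theorem hasDerivAt_lagrangian_left (A C p s : ℝ) (Φ ω η : Mat) :
    HasDerivAt (fun ε : ℝ => lagrangian A C p s (NormedSpace.exp (ε • η) * Φ) ω)
      (ip (DL A C p s Φ ω) η) 0 := by
  have h0 := hasDerivAt_axis Φ η
  have e0 : axis (NormedSpace.exp ((0 : ℝ) • η) * Φ) = axis Φ := by simp
  have h2 := ((hasDerivAt_ip ω h0).pow 2).const_mul (1 / 2 * (C - A))
  have h3 := ((hasDerivAt_ip ⁅k, ω⁆ h0).pow 2).const_mul (1 / 2 * (p * s))
  have h4 := (hasDerivAt_ip k h0).const_mul p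
  have h := ((h2.const_add (1 / 2 * A * ip ω ω)).add h3).sub h4
  refine (h.congr_deriv ?_).congr_of_eventuallyEq (Filter.Eventually.of_forall fun ε => ?_)
  · have b1 : ip ⁅η, axis Φ⁆ ω = ip ⁅axis Φ, ω⁆ η := by rw [ip_bracket, ip_comm]
    have b2 : ip ⁅η, axis Φ⁆ ⁅k, ω⁆ = ip ⁅axis Φ, ⁅k, ω⁆⁆ η := by rw [ip_bracket, ip_comm]
    have b3 : ip ⁅η, axis Φ⁆ k = ip ⁅axis Φ, k⁆ η := by rw [ip_bracket, ip_comm]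
    have b4 : DL A C p s Φ ω = ((C - A) * ip ω (axis Φ)) • ⁅axis Φ, ω⁆
      + (p * s * ip ⁅axis Φ, k⁆ ω) • ⁅axis Φ, ⁅k, ω⁆⁆ + (-p) • ⁅axis Φ, k⁆ := by
      simp [DL, sub_eq_add_neg]
    rw [b4]
    simp only [ip_add_left, ip_smul_left, e0, b1, b2, b3]
    rw [ip_bracket (axis Φ) k ω, ip_comm ω (axis Φ)]
    simp
    ring
  · simp only [lagrangian, kinetic, potential, ip_bracket _ k ω, Pi.add_apply, Pi.sub_apply,
      Pi.pow_apply]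
    rw [ip_comm ω (axis _)]

end

/-- `Φ` restricts to a `C²` curve in `SU(2)` on `J`. -/
structure IsCurve (J : Set ℝ) (Φ : ℝ → Mat) : Prop where
  mem : ∀ t ∈ J, Φ t ∈ Matrix.specialUnitaryGroup (Fin 2) ℂ
  smooth : ∀ i j, ContDiffOn ℝ 2 (fun t => Φ t i j) J

/-- `Φ` is a motion of the toy top on `J`: a `C²` curve in `SU(2)` which satisfies the equations
of motion `m' = [ω, m] + DL(Φ, ω)`, `Φ' = ω Φ` (the second one being the definition of `ω`),
with total energy `h`, vertical momentum `l = ⟨m, k⟩` and axial momentum `n = ⟨m, r⟩`. -/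
structure IsMotion (A C p s : ℝ) (J : Set ℝ) (h l n : ℝ) (Φ : ℝ → Mat) : Prop where
  curve : IsCurve J Φ
  eqn : ∀ t ∈ J, mderiv (fun x => momentum A C p s (Φ x) (angVel Φ x)) t
    = ⁅angVel Φ t, momentum A C p s (Φ t) (angVel Φ t)⁆ + DL A C p s (Φ t) (angVel Φ t)
  energy : ∀ t ∈ J, kinetic A C p s (Φ t) (angVel Φ t) + potential p (Φ t) = h
  vertical : ∀ t ∈ J, ip (momentum A C p s (Φ t) (angVel Φ t)) k = l
  axial : ∀ t ∈ J, ip (momentum A C p s (Φ t) (angVel Φ t)) (axis (Φ t)) = n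

/-- `e₁`, `e₂`, `e₃` are the dynamical constants belonging to `h`, `l`, `n`: the zeroes of the
cubic polynomial on the right hand side of the reduced equation of motion, suitably ordered. -/
structure IsDynConst (A C p h l n e₁ e₂ e₃ : ℝ) : Prop where
  neg_one_le : -1 ≤ e₁
  le₁₂ : e₁ ≤ e₂
  le_one : e₂ ≤ 1
  one_le : 1 ≤ e₃
  factor : ∀ x : ℝ, 1 / p * (1 - x ^ 2) * (h - 1 / (2 * C) * n ^ 2 - p * x)
      - 1 / (2 * A * p) * (l - n * x) ^ 2 = (x - e₁) * (x - e₂) * (x - e₃)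

/-- `e₄ = √(1 + A / (p s))`. -/
def e₄ (A p s : ℝ) : ℝ := Real.sqrt (1 + A / (p * s))

/-! ### The hyperelliptic curve and its differentials -/

/-- `R(u) = (u - e₁)(u - e₂)(u - e₃)(u² - e₄²)`. -/
def R (e₁ e₂ e₃ e₄ : ℝ) (x : ℂ) : ℂ := (x - e₁) * (x - e₂) * (x - e₃) * (x ^ 2 - e₄ ^ 2)

/-- The places of the compactified curve `w² = F(u)`, `F` of odd degree: the affine points and
a single point at infinity. -/
inductive Place (F : ℂ → ℂ) : Type
  | affine (u w : ℂ) (hw : w ^ 2 = F u) : Place F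
  | infinity : Place F

/-- `z ↦ (U z, W z)` is a local parametrization of the curve `w² = F(u)` around a place, with
`z = 0` corresponding to the place. Around an affine point it is a holomorphic immersion
into `ℂ²` with image in the curve; around infinity, a branch point of `u`, the function `u`
has a pole of order two. -/
def IsLocalParam {F : ℂ → ℂ} : Place F → (ℂ → ℂ) → (ℂ → ℂ) → Prop
  | .affine u w _, U, W => AnalyticAt ℂ U 0 ∧ AnalyticAt ℂ W 0 ∧ U 0 = u ∧ W 0 = w ∧
      (deriv U 0 ≠ 0 ∨ deriv W 0 ≠ 0) ∧ ∀ᶠ z in nhds 0, W z ^ 2 = F (U z)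
  | .infinity, U, W => MeromorphicAt U 0 ∧ MeromorphicAt W 0 ∧ meromorphicOrderAt U 0 = -2 ∧
      ∀ᶠ z in nhdsWithin 0 {0}ᶜ, W z ^ 2 = F (U z)

/-- A function `f` of `(u, w)` stands for the differential `f(u, w) du`; this is its coefficient
in a local parameter `z`. -/
def pullback (f : ℂ → ℂ → ℂ) (U W : ℂ → ℂ) (z : ℂ) : ℂ := f (U z) (W z) * deriv U z

/-- The differential `f(u, w) du` has no singularity at `P`. -/
def IsRegularAt {F : ℂ → ℂ} (f : ℂ → ℂ → ℂ) (P : Place F) : Prop :=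
  (∃ U W, IsLocalParam P U W) ∧ ∀ U W, IsLocalParam P U W →
    MeromorphicAt (pullback f U W) 0 ∧ 0 ≤ meromorphicOrderAt (pullback f U W) 0

/-- The differential `f(u, w) du` has a simple pole with residue `ρ` at `P`. -/
def HasSimplePoleAt {F : ℂ → ℂ} (f : ℂ → ℂ → ℂ) (P : Place F) (ρ : ℂ) : Prop :=
  (∃ U W, IsLocalParam P U W) ∧ ∀ U W, IsLocalParam P U W →
    MeromorphicAt (pullback f U W) 0 ∧ meromorphicOrderAt (pullback f U W) 0 = -1 ∧
    Filter.Tendsto (fun z => z * pullback f U W z) (nhdsWithin 0 {0}ᶜ) (nhds ρ)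

/-- `f(u, w) du` is a meromorphic differential on the compactified curve, of the third kind, with
exactly two singularities: simple poles with residue `1` at `P` and `-1` at `Q`. -/
structure IsThirdKind {F : ℂ → ℂ} (f : ℂ → ℂ → ℂ) (P Q : Place F) : Prop where
  ne : P ≠ Q
  pole_one : HasSimplePoleAt f P 1
  pole_neg_one : HasSimplePoleAt f Q (-1)
  regular : ∀ X : Place F, X ≠ P → X ≠ Q → IsRegularAt f X

/-- The differential `dt = -i √(s/2) (u² - e₄²) du / w`. -/
def timeDiff (s e₄ : ℝ) (u w : ℂ) : ℂ :=
  -Complex.I * Real.sqrt (s / 2) * (u ^ 2 - e₄ ^ 2) / w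

/-- The differential `1/(2(u - ε)) (w + (u² - e₄²)/(1 - e₄²) c) du / w`. -/
def logDiff (e₄ : ℝ) (ε c u w : ℂ) : ℂ :=
  1 / (2 * (u - ε)) * (w + (u ^ 2 - e₄ ^ 2) / (1 - e₄ ^ 2) * c) / w

/-- `d log α`, where `wm` is the chosen value of `w` over `u = -1`. -/
def dlogα (e₄ : ℝ) (wm : ℂ) : ℂ → ℂ → ℂ := logDiff e₄ (-1) wm

/-- `d log β`, where `wp` is the chosen value of `w` over `u = 1`. -/
def dlogβ (e₄ : ℝ) (wp : ℂ) : ℂ → ℂ → ℂ := logDiff e₄ 1 (-wp)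

/-- `d log γ`, where `wp` is the chosen value of `w` over `u = 1`. -/
def dlogγ (e₄ : ℝ) (wp : ℂ) : ℂ → ℂ → ℂ := logDiff e₄ 1 wp

/-- `d log δ`, where `wm` is the chosen value of `w` over `u = -1`. -/
def dlogδ (e₄ : ℝ) (wm : ℂ) : ℂ → ℂ → ℂ := logDiff e₄ (-1) (-wm)

/-- `y = ∫ f(u, w) du` along the path `t ↦ (u t, w t)`, `t ∈ J`. -/
def IsIntegral (J : Set ℝ) (f : ℂ → ℂ → ℂ) (u : ℝ → ℝ) (w y : ℝ → ℂ) : Prop :=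
  ∀ a ∈ J, ∀ b ∈ J,
    IntervalIntegrable (fun t => f (u t) (w t) * deriv u t) MeasureTheory.volume a b ∧
    y b - y a = ∫ t in a..b, f (u t) (w t) * deriv u t

/-- `log y = ∫ f(u, w) du` along the path `t ↦ (u t, w t)`, on every time interval in `J` on
which `y` has no zero (so that a continuous logarithm of `y` exists). -/
def IsLogIntegral (J : Set ℝ) (f : ℂ → ℂ → ℂ) (u : ℝ → ℝ) (w y : ℝ → ℂ) : Prop :=
  ∀ a ∈ J, ∀ b ∈ J, (∀ t ∈ Set.uIcc a b, y t ≠ 0) →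
    IntervalIntegrable (fun t => f (u t) (w t) * deriv u t) MeasureTheory.volume a b ∧
    y b = y a * Complex.exp (∫ t in a..b, f (u t) (w t) * deriv u t)

/-- The value `√(s/2) (1 - e₄²) x / A` of `w` over `u = ±1`, for `x = l ∓ n`. -/
def wConst (A p s x : ℝ) : ℂ :=
  Real.sqrt (s / 2) * (1 - (e₄ A p s : ℂ) ^ 2) * (1 / (A : ℂ)) * x

/-- The curve `Φ` is given by the hyperelliptic integrals on the curve `w² = R(u)`: the path of
`u = ⟨r, k⟩` lifts to a continuous path on the curve along which time is the integral of
`timeDiff` and the logarithms of the entries of `Φ` are the integrals of their logarithmic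
differentials, formed with the values `wp`, `wm` of `w` over `u = 1`, `u = -1`. -/
def GivenByIntegrals (s e₁ e₂ e₃ e₄ : ℝ) (wp wm : ℂ) (J : Set ℝ) (Φ : ℝ → Mat) : Prop :=
  ∃ w : ℝ → ℂ, ContinuousOn w J ∧ (∀ t ∈ J, w t ^ 2 = R e₁ e₂ e₃ e₄ (height (Φ t))) ∧
    IsIntegral J (timeDiff s e₄) (fun t => height (Φ t)) w (fun t => (t : ℂ)) ∧
    IsLogIntegral J (dlogα e₄ wm) (fun t => height (Φ t)) w (fun t => Φ t 0 0) ∧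
    IsLogIntegral J (dlogβ e₄ wp) (fun t => height (Φ t)) w (fun t => Φ t 0 1) ∧
    IsLogIntegral J (dlogγ e₄ wp) (fun t => height (Φ t)) w (fun t => Φ t 1 0) ∧
    IsLogIntegral J (dlogδ e₄ wm) (fun t => height (Φ t)) w (fun t => Φ t 1 1)

/-- Uniform rotation with rate `τ` about the symmetry axis. -/
def spin (τ t : ℝ) : Mat :=
  !![Complex.exp (Complex.I / 2 * τ * t), 0; 0, Complex.exp (-(Complex.I / 2) * τ * t)]

end ToyTop

end

/-!
Identify `su(2)` with `ℝ³`, so that the commutator becomes the cross product, and let `r` be the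
axis and `ω` the angular velocity of a curve in `SU(2)`. Everything rests on three facts.

* The entries of `Φ` satisfy `α' δ = u'/4 + (i/4)⟨ω, k + r⟩` and `β' γ = u'/4 - (i/4)⟨ω, k - r⟩`,
  while `α δ = (u + 1)/2` and `β γ = (u - 1)/2` (`IsCurve.deriv_mul_star`, `IsCurve.normSq_eq`). For
  the spherical top, `⟨ω, k⟩ = l/A` and `⟨ω, r⟩ = n/A`, so the logarithmic derivatives of the entries
  are functions of `u` and `u'`, and conversely they determine `l` and `n`.
* The energy gives `f(u) = (s/2)(e₄² - u²) u'²` with the cubic polynomial `f` of the dynamical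
  constants (`reduced_equation`), so `w = -i √(s/2) (u² - e₄²) u'` is a square root of `R(u)`, the
  lift `liftVal` of the path. Substituting it turns the differentials on the curve into `dt` and into
  the logarithmic derivatives just described, wherever `u' ≠ 0`.
* The exceptional times with `u' = 0` form a null set. For a motion with non-constant `u` this holds
  because `u' = u'' = 0` would force a double zero of `f`, and then `u` is constant by Grönwall's
  inequality (`IsMotion.ae_heightDeriv_ne_zero`). For a curve given by integrals, the time integral
  itself shows that `u' ≠ 0` almost everywhere. In that case the conservation laws extend by
  continuity from a set of full measure, and the equation of motion follows from them, since where
  `u' ≠ 0` the vectors `k`, `r`, `ω` span `ℝ³` (`IsCurve.equation_of_integrals`).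

For the general top, multiplication by the spin adds a multiple of `r` to `ω` in such a way that the
momentum does not change (`IsMotion.mul_spin`). The dynamical constants exist because `f` is
nonpositive at `± 1` and nonnegative at `u(t)`. The choices of `w` over `u = ± 1` amount to the values
of `l ∓ n` because the values of `f` at `± 1` are `-(l ∓ n)²/(2Ap)`.

The singularities are found by computing the limits of `z` times the differential in a local
parameter `z`. At a branch point `w` is a local parameter, and `du` and `u - ε` are expressed by `w`
using `2 w dw = R'(u) du`. At infinity the term with `du / w` is regular and `du / (2(u - ε))` has
residue `-1`, since `u` has a double pole.
-/

namespace ToyTop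

/-! ### The Lie algebra `su(2)` as Euclidean space with the cross product -/

/-- The identification of `ℝ³` with `su(2)` that turns the dot product into `ip` and the cross
product into the commutator; `k` is the image of the third basis vector. -/
noncomputable def su (v : Fin 3 → ℝ) : Mat :=
  !![Complex.I * v 2 / 2, (Complex.I * v 0 - v 1) / 2;
    (Complex.I * v 0 + v 1) / 2, -(Complex.I * v 2) / 2]

/-- The third basis vector of `ℝ³`, representing `k`. -/
def kvec : Fin 3 → ℝ := ![0, 0, 1]

theorem su_kvec : su kvec = k := by
  ext i j; fin_cases i <;> fin_cases j <;> simp [su, k, kvec]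

theorem su_add (v w : Fin 3 → ℝ) : su (v + w) = su v + su w := by
  ext i j; fin_cases i <;> fin_cases j <;> simp [su] <;> ring

theorem su_sub (v w : Fin 3 → ℝ) : su (v - w) = su v - su w := by
  ext i j; fin_cases i <;> fin_cases j <;> simp [su] <;> ring

theorem su_smul (a : ℝ) (v : Fin 3 → ℝ) : su (a • v) = a • su v := by
  ext i j; fin_cases i <;> fin_cases j <;> simp [su] <;> ring

theorem su_bracket (v w : Fin 3 → ℝ) : ⁅su v, su w⁆ = su (v ⨯₃ w) := by
  ext i j
  fin_cases i <;> fin_cases j <;>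
    simp [su, Ring.lie_def, cross_apply] <;> ring_nf <;>
    simp <;> ring

theorem ip_su (v w : Fin 3 → ℝ) : ip (su v) (su w) = v ⬝ᵥ w := by
  simp [ip, su, Matrix.trace_fin_two, Matrix.vec3_dotProduct]
  ring

theorem su_injective : Function.Injective su := by
  intro v w h
  have h0 := congrArg Complex.im (congrFun (congrFun h 0) 1)
  have h1 := congrArg Complex.re (congrFun (congrFun h 0) 1)
  have h2 := congrArg Complex.im (congrFun (congrFun h 0) 0)
  simp [su] at h0 h1 h2
  ext i; fin_cases i <;> simp <;> linarith

theorem su_inj {v w : Fin 3 → ℝ} : su v = su w ↔ v = w := su_injective.eq_iff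

/-! ### Kinematics in coordinates -/

/-- Coordinates of the axis `Φ k Φ⁻¹` in terms of the first row `(a, b)` of `Φ`. -/
noncomputable def axisVec (a b : ℂ) : Fin 3 → ℝ :=
  ![-2 * (a * b).re, -2 * (a * b).im, Complex.normSq a - Complex.normSq b]

/-- Coordinates of the angular velocity `Φ' Φ⁻¹` in terms of the first row `(a, b)` of `Φ` and
its derivative `(a', b')`. -/
noncomputable def angVec (a b a' b' : ℂ) : Fin 3 → ℝ :=
  ![2 * (b' * a - a' * b).im, -2 * (b' * a - a' * b).re,
    2 * (a' * star a + b' * star b).im]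

theorem eq_of_mem_su_two {Φ : Mat} (h : Φ ∈ Matrix.specialUnitaryGroup (Fin 2) ℂ) :
    Φ = !![Φ 0 0, Φ 0 1; -star (Φ 0 1), star (Φ 0 0)] ∧
      Complex.normSq (Φ 0 0) + Complex.normSq (Φ 0 1) = 1 := by
  obtain ⟨hu, hd⟩ := Matrix.mem_specialUnitaryGroup_iff.1 h
  have h1 := Matrix.mem_unitaryGroup_iff.1 hu
  have h2 : star Φ = Φ.adjugate := by
    have h3 : Φ * Φ.adjugate = 1 := by rw [Matrix.mul_adjugate, hd, one_smul]
    have h4 := Matrix.mem_unitaryGroup_iff'.1 hu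
    calc star Φ = star Φ * (Φ * Φ.adjugate) := by rw [h3, mul_one]
      _ = Φ.adjugate := by rw [← mul_assoc, h4, one_mul]
  rw [Matrix.adjugate_fin_two] at h2
  have e00 : star (Φ 0 0) = Φ 1 1 := congrFun (congrFun h2 0) 0
  have e10 : star (Φ 0 1) = -Φ 1 0 := congrFun (congrFun h2 1) 0
  refine ⟨?_, ?_⟩
  · rw [e00, e10, neg_neg]; exact Matrix.eta_fin_two Φ
  · have h5 := congrFun (congrFun h1 0) 0
    simp only [Matrix.mul_apply, Fin.sum_univ_two, Matrix.star_apply, Matrix.one_apply_eq,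
      RCLike.star_def, Complex.mul_conj] at h5
    exact_mod_cast h5

theorem inv_su_two {a b : ℂ} (h : Complex.normSq a + Complex.normSq b = 1) :
    (!![a, b; -star b, star a] : Mat)⁻¹ = !![star a, -b; star b, a] := by
  apply Matrix.inv_eq_right_inv
  have h' : a * star a + b * star b = 1 := by
    simp only [RCLike.star_def, Complex.mul_conj]
    exact_mod_cast h
  ext i j
  simp only [RCLike.star_def] at h'
  fin_cases i <;> fin_cases j <;> simp
  · linear_combination h'
  · ring
  · ring
  · linear_combination h'

theorem axis_su_two {a b : ℂ} (h : Complex.normSq a + Complex.normSq b = 1) :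
    axis !![a, b; -star b, star a] = su (axisVec a b) := by
  rw [axis, inv_su_two h]
  ext i j
  fin_cases i <;> fin_cases j <;>
    simp [k, su, axisVec, Matrix.mul_apply, Fin.sum_univ_two, Complex.ext_iff,
      Complex.normSq_apply] <;> constructor <;> ring

theorem axisVec_dotProduct_self {a b : ℂ} (h : Complex.normSq a + Complex.normSq b = 1) :
    axisVec a b ⬝ᵥ axisVec a b = 1 := by
  simp [axisVec, Complex.normSq_apply] at h ⊢
  linear_combination (a.re*a.re+a.im*a.im+(b.re*b.re+b.im*b.im)+1)*h


/-- The path of the symmetry axis, in coordinates. -/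
noncomputable def axisPath (Φ : ℝ → Mat) (t : ℝ) : Fin 3 → ℝ := axisVec (Φ t 0 0) (Φ t 0 1)

/-- The path of the angular velocity, in coordinates. -/
noncomputable def angPath (Φ : ℝ → Mat) (t : ℝ) : Fin 3 → ℝ :=
  angVec (Φ t 0 0) (Φ t 0 1) (deriv (fun x => Φ x 0 0) t) (deriv (fun x => Φ x 0 1) t)

section Curve

variable {J : Set ℝ} {Φ : ℝ → Mat} {t : ℝ}

theorem IsCurve.axis_eq (hΦ : IsCurve J Φ) (ht : t ∈ J) : axis (Φ t) = su (axisPath Φ t) := by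
  obtain ⟨h1, h2⟩ := eq_of_mem_su_two (hΦ.mem t ht)
  rw [h1, axis_su_two h2]
  rfl

theorem IsCurve.axisPath_dotProduct_self (hΦ : IsCurve J Φ) (ht : t ∈ J) :
    axisPath Φ t ⬝ᵥ axisPath Φ t = 1 :=
  axisVec_dotProduct_self (eq_of_mem_su_two (hΦ.mem t ht)).2

theorem IsCurve.height_eq (hΦ : IsCurve J Φ) (ht : t ∈ J) : height (Φ t) = axisPath Φ t 2 := by
  rw [height, hΦ.axis_eq ht, ← su_kvec, ip_su, Matrix.vec3_dotProduct]
  simp [kvec]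

theorem IsCurve.hasDerivAt_entry (hJ : IsOpen J) (hΦ : IsCurve J Φ) (ht : t ∈ J) (i j : Fin 2) :
    HasDerivAt (fun x => Φ x i j) (deriv (fun x => Φ x i j) t) t :=
  (((hΦ.smooth i j).contDiffAt (hJ.mem_nhds ht)).differentiableAt (by norm_num)).hasDerivAt

theorem IsCurve.mderiv_eq (hJ : IsOpen J) (hΦ : IsCurve J Φ) (ht : t ∈ J) :
    mderiv Φ t = !![deriv (fun x => Φ x 0 0) t, deriv (fun x => Φ x 0 1) t;
      -star (deriv (fun x => Φ x 0 1) t), star (deriv (fun x => Φ x 0 0) t)] := by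
  have e (i j : Fin 2) : (fun x => Φ x i j) =ᶠ[nhds t] fun x =>
      (!![Φ x 0 0, Φ x 0 1; -star (Φ x 0 1), star (Φ x 0 0)] : Mat) i j := by
    filter_upwards [hJ.mem_nhds ht] with x hx
    exact congrFun (congrFun (eq_of_mem_su_two (hΦ.mem x hx)).1 i) j
  ext i j
  fin_cases i <;> fin_cases j
  · rfl
  · rfl
  · exact (e 1 0).deriv_eq.trans (hΦ.hasDerivAt_entry hJ ht 0 1).star.neg.deriv
  · exact (e 1 1).deriv_eq.trans (hΦ.hasDerivAt_entry hJ ht 0 0).star.deriv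

theorem hasDerivAt_re {f : ℝ → ℂ} {f' : ℂ} (h : HasDerivAt f f' t) :
    HasDerivAt (fun x => (f x).re) f'.re t :=
  Complex.reCLM.hasFDerivAt.comp_hasDerivAt t h

theorem hasDerivAt_im {f : ℝ → ℂ} {f' : ℂ} (h : HasDerivAt f f' t) :
    HasDerivAt (fun x => (f x).im) f'.im t :=
  Complex.imCLM.hasFDerivAt.comp_hasDerivAt t h

theorem hasDerivAt_normSq {f : ℝ → ℂ} {f' : ℂ} (h : HasDerivAt f f' t) :
    HasDerivAt (fun x => Complex.normSq (f x)) (2 * ((f t).re * f'.re + (f t).im * f'.im)) t := by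
  simp only [Complex.normSq_apply]
  refine (((hasDerivAt_re h).mul (hasDerivAt_re h)).add
    ((hasDerivAt_im h).mul (hasDerivAt_im h))).congr_deriv ?_
  ring

theorem IsCurve.angVel_eq (hJ : IsOpen J) (hΦ : IsCurve J Φ) (ht : t ∈ J) :
    angVel Φ t = su (angPath Φ t) := by
  obtain ⟨h1, h2⟩ := eq_of_mem_su_two (hΦ.mem t ht)
  -- the first row stays on the unit sphere, so `Φ' Φ⁻¹` is traceless and skew Hermitian
  have h3 : (Φ t 0 0).re * (deriv (fun x => Φ x 0 0) t).re
      + (Φ t 0 0).im * (deriv (fun x => Φ x 0 0) t).im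
      + ((Φ t 0 1).re * (deriv (fun x => Φ x 0 1) t).re
      + (Φ t 0 1).im * (deriv (fun x => Φ x 0 1) t).im) = 0 := by
    have d := (hasDerivAt_normSq (hΦ.hasDerivAt_entry hJ ht 0 0)).add
      (hasDerivAt_normSq (hΦ.hasDerivAt_entry hJ ht 0 1))
    have e : (fun x => Complex.normSq (Φ x 0 0) + Complex.normSq (Φ x 0 1)) =ᶠ[nhds t]
        fun _ => (1 : ℝ) := by
      filter_upwards [hJ.mem_nhds ht] with x hx
      exact (eq_of_mem_su_two (hΦ.mem x hx)).2
    have := d.unique ((hasDerivAt_const t (1 : ℝ)).congr_of_eventuallyEq e)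
    linarith
  rw [angVel, hΦ.mderiv_eq hJ ht, h1, inv_su_two h2]
  simp only [angPath]
  generalize deriv (fun x => Φ x 0 0) t = a' at *
  generalize deriv (fun x => Φ x 0 1) t = b' at *
  generalize Φ t 0 0 = a at *
  generalize Φ t 0 1 = b at *
  ext i j
  fin_cases i <;> fin_cases j <;> simp [su, angVec, Complex.ext_iff]
  · linear_combination h3
  · constructor <;> ring
  · constructor <;> ring
  · constructor
    · linear_combination h3
    · ring

/-- The equation `Φ' = ω Φ` for the first row of `Φ`. -/
theorem IsCurve.deriv_row (hJ : IsOpen J) (hΦ : IsCurve J Φ) (ht : t ∈ J) :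
    deriv (fun x => Φ x 0 0) t = Complex.I * angPath Φ t 2 / 2 * Φ t 0 0
        - (Complex.I * angPath Φ t 0 - angPath Φ t 1) / 2 * star (Φ t 0 1) ∧
    deriv (fun x => Φ x 0 1) t = Complex.I * angPath Φ t 2 / 2 * Φ t 0 1
        + (Complex.I * angPath Φ t 0 - angPath Φ t 1) / 2 * star (Φ t 0 0) := by
  obtain ⟨h1, h2⟩ := eq_of_mem_su_two (hΦ.mem t ht)
  have hu : Φ t * star (Φ t) = 1 :=
    Matrix.mem_unitaryGroup_iff.1 (Matrix.mem_specialUnitaryGroup_iff.1 (hΦ.mem t ht)).1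
  have hm : mderiv Φ t = su (angPath Φ t) * Φ t := by
    rw [← hΦ.angVel_eq hJ ht, angVel, Matrix.inv_eq_right_inv hu, mul_assoc,
      mul_eq_one_comm.1 hu, mul_one]
  have h10 : Φ t 1 0 = -star (Φ t 0 1) := congrFun (congrFun h1 1) 0
  have h11 : Φ t 1 1 = star (Φ t 0 0) := congrFun (congrFun h1 1) 1
  have e0 := congrFun (congrFun hm 0) 0
  have e1 := congrFun (congrFun hm 0) 1
  simp only [mderiv, Matrix.of_apply, Matrix.mul_apply, Fin.sum_univ_two, h10, h11] at e0 e1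
  refine ⟨e0.trans ?_, e1.trans ?_⟩ <;> simp [su]
  ring

theorem IsCurve.hasDerivAt_axisPath (hJ : IsOpen J) (hΦ : IsCurve J Φ) (ht : t ∈ J) :
    HasDerivAt (axisPath Φ) (angPath Φ t ⨯₃ axisPath Φ t) t := by
  have ha := hΦ.hasDerivAt_entry hJ ht 0 0
  have hb := hΦ.hasDerivAt_entry hJ ht 0 1
  obtain ⟨d0, d1⟩ := hΦ.deriv_row hJ ht
  rw [d0] at ha
  rw [d1] at hb
  have hab := ha.mul hb
  rw [hasDerivAt_pi]
  intro i
  fin_cases i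
  · refine ((hasDerivAt_re hab).const_mul (-2)).congr_deriv ?_
    simp [cross_apply, axisPath, axisVec, Complex.normSq_apply]
    ring
  · refine ((hasDerivAt_im hab).const_mul (-2)).congr_deriv ?_
    simp [cross_apply, axisPath, axisVec, Complex.normSq_apply]
    ring
  · refine ((hasDerivAt_normSq ha).sub (hasDerivAt_normSq hb)).congr_deriv ?_
    simp [cross_apply, axisPath, axisVec]
    ring

/-- `α' δ = u'/4 + (i/4) ⟨ω, k + r⟩`, and similarly for the other entries of `Φ`. Dividing by
`α δ = (u + 1)/2` or `β γ = (u - 1)/2` gives the logarithmic derivatives of the entries. -/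
theorem IsCurve.deriv_mul_star (hJ : IsOpen J) (hΦ : IsCurve J Φ) (ht : t ∈ J) :
    deriv (fun x => Φ x 0 0) t * star (Φ t 0 0) =
      ((angPath Φ t ⨯₃ axisPath Φ t) 2
        + Complex.I * (angPath Φ t 2 + angPath Φ t ⬝ᵥ axisPath Φ t : ℝ)) / 4 ∧
    deriv (fun x => Φ x 0 1) t * star (Φ t 0 1) =
      (-(angPath Φ t ⨯₃ axisPath Φ t) 2
        + Complex.I * (angPath Φ t 2 - angPath Φ t ⬝ᵥ axisPath Φ t : ℝ)) / 4 := by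
  obtain ⟨h1, h2⟩ := eq_of_mem_su_two (hΦ.mem t ht)
  obtain ⟨d0, d1⟩ := hΦ.deriv_row hJ ht
  rw [d0, d1]
  generalize angPath Φ t = o
  simp only [axisPath, Complex.normSq_apply] at h2 ⊢
  generalize Φ t 0 0 = a at *
  generalize Φ t 0 1 = b at *
  constructor <;> rw [Complex.ext_iff] <;>
    simp only [Matrix.vec3_dotProduct] <;>
    simp [axisVec, cross_apply, Complex.normSq_apply] <;> constructor
  · ring
  · linear_combination (o 2 / 4) * h2
  · ring
  · linear_combination (o 2 / 4) * h2

theorem IsCurve.normSq_eq (hΦ : IsCurve J Φ) (ht : t ∈ J) :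
    Complex.normSq (Φ t 0 0) = (1 + axisPath Φ t 2) / 2 ∧
    Complex.normSq (Φ t 0 1) = (1 - axisPath Φ t 2) / 2 := by
  have h2 := (eq_of_mem_su_two (hΦ.mem t ht)).2
  simp only [axisPath, axisVec, Matrix.cons_val]
  constructor <;> linarith

theorem IsCurve.contDiffOn_axisPath (hΦ : IsCurve J Φ) : ContDiffOn ℝ 2 (axisPath Φ) J := by
  have ha := hΦ.smooth 0 0
  have hb := hΦ.smooth 0 1
  have re {f : ℝ → ℂ} (hf : ContDiffOn ℝ 2 f J) : ContDiffOn ℝ 2 (fun x => (f x).re) J :=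
    Complex.reCLM.contDiff.comp_contDiffOn hf
  have im {f : ℝ → ℂ} (hf : ContDiffOn ℝ 2 f J) : ContDiffOn ℝ 2 (fun x => (f x).im) J :=
    Complex.imCLM.contDiff.comp_contDiffOn hf
  rw [contDiffOn_pi]
  intro i
  fin_cases i
  · exact contDiffOn_const.mul (re (ha.mul hb))
  · exact contDiffOn_const.mul (im (ha.mul hb))
  · simp only [axisPath, axisVec, Complex.normSq_apply]
    exact (((re ha).mul (re ha)).add ((im ha).mul (im ha))).sub
      (((re hb).mul (re hb)).add ((im hb).mul (im hb)))

theorem IsCurve.contDiffOn_angPath (hJ : IsOpen J) (hΦ : IsCurve J Φ) :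
    ContDiffOn ℝ 1 (angPath Φ) J := by
  have ha := (hΦ.smooth 0 0).of_le (show (1 : WithTop ℕ∞) ≤ 2 by norm_num)
  have hb := (hΦ.smooth 0 1).of_le (show (1 : WithTop ℕ∞) ≤ 2 by norm_num)
  have da := (hΦ.smooth 0 0).deriv_of_isOpen hJ (show (1 : WithTop ℕ∞) + 1 ≤ 2 by norm_num)
  have db := (hΦ.smooth 0 1).deriv_of_isOpen hJ (show (1 : WithTop ℕ∞) + 1 ≤ 2 by norm_num)
  have re {f : ℝ → ℂ} (hf : ContDiffOn ℝ 1 f J) : ContDiffOn ℝ 1 (fun x => (f x).re) J :=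
    Complex.reCLM.contDiff.comp_contDiffOn hf
  have im {f : ℝ → ℂ} (hf : ContDiffOn ℝ 1 f J) : ContDiffOn ℝ 1 (fun x => (f x).im) J :=
    Complex.imCLM.contDiff.comp_contDiffOn hf
  have st {f : ℝ → ℂ} (hf : ContDiffOn ℝ 1 f J) : ContDiffOn ℝ 1 (fun x => star (f x)) J :=
    Complex.conjCLE.contDiff.comp_contDiffOn hf
  rw [contDiffOn_pi]
  intro i
  fin_cases i
  · exact contDiffOn_const.mul (im ((db.mul ha).sub (da.mul hb)))
  · exact contDiffOn_const.mul (re ((db.mul ha).sub (da.mul hb)))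
  · exact contDiffOn_const.mul (im ((da.mul (st ha)).add (db.mul (st hb))))

end Curve

/-! ### Changing the axial moment of inertia by a uniform rotation -/

theorem spin_mul_spin_neg (τ t : ℝ) : spin τ t * spin (-τ) t = 1 := by
  ext i j
  fin_cases i <;> fin_cases j <;> simp [spin, ← Complex.exp_add]

theorem spin_inv (τ t : ℝ) : (spin τ t)⁻¹ = spin (-τ) t :=
  Matrix.inv_eq_right_inv (spin_mul_spin_neg τ t)

theorem spin_mul_k (τ t : ℝ) : spin τ t * k = k * spin τ t := by
  ext i j
  fin_cases i <;> fin_cases j <;> simp [spin, k, mul_comm]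

theorem axis_mul_spin (Φ : Mat) (τ t : ℝ) : axis (Φ * spin τ t) = axis Φ := by
  rw [axis, Matrix.mul_inv_rev, mul_assoc Φ, spin_mul_k, spin_inv]
  calc Φ * (k * spin τ t) * (spin (-τ) t * Φ⁻¹)
      = Φ * k * (spin τ t * spin (-τ) t) * Φ⁻¹ := by simp only [mul_assoc]
    _ = axis Φ := by rw [spin_mul_spin_neg, mul_one, axis]

theorem spin_mem (τ t : ℝ) : spin τ t ∈ Matrix.specialUnitaryGroup (Fin 2) ℂ := by
  rw [Matrix.mem_specialUnitaryGroup_iff, Matrix.mem_unitaryGroup_iff]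
  have hs : star (spin τ t) = spin (-τ) t := by
    ext i j
    fin_cases i <;> fin_cases j <;>
      simp [spin, Matrix.star_apply, ← Complex.exp_conj, neg_div, Complex.conj_ofNat]
  refine ⟨by rw [hs, spin_mul_spin_neg], ?_⟩
  simp [spin, Matrix.det_fin_two, ← Complex.exp_add]

theorem contDiff_spin (τ : ℝ) (i j : Fin 2) : ContDiff ℝ 2 (fun t => spin τ t i j) := by
  have h : ContDiff ℝ 2 (fun t : ℝ => (t : ℂ)) := Complex.ofRealCLM.contDiff
  fin_cases i <;> fin_cases j <;> simp only [spin] <;>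
    first
    | exact contDiff_const
    | exact Complex.contDiff_exp.comp (contDiff_const.mul h)

theorem hasDerivAt_spin (τ t : ℝ) (i j : Fin 2) :
    HasDerivAt (fun x => spin τ x i j) ((τ • k * spin τ t) i j) t := by
  have h : HasDerivAt (fun x : ℝ => (x : ℂ)) 1 t := Complex.ofRealCLM.hasDerivAt
  have e (c : ℂ) : HasDerivAt (fun x : ℝ => Complex.exp (c * x)) (c * Complex.exp (c * t)) t := by
    refine (h.const_mul c).cexp.congr_deriv ?_
    ring
  fin_cases i <;> fin_cases j
  · refine (e (Complex.I / 2 * τ)).congr_deriv ?_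
    simp [spin, k]; ring
  · refine (hasDerivAt_const t (0 : ℂ)).congr_deriv ?_
    simp [spin, k]
  · refine (hasDerivAt_const t (0 : ℂ)).congr_deriv ?_
    simp [spin, k]
  · refine (e (-(Complex.I / 2) * τ)).congr_deriv ?_
    simp [spin, k]; ring

theorem angVel_mul_spin {Φ : ℝ → Mat} {t : ℝ} (τ : ℝ)
    (hΦ : ∀ i j, DifferentiableAt ℝ (fun x => Φ x i j) t) :
    angVel (fun x => Φ x * spin τ x) t = angVel Φ t + τ • axis (Φ t) := by
  have hd : mderiv (fun x => Φ x * spin τ x) t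
      = mderiv Φ t * spin τ t + Φ t * (τ • k * spin τ t) := by
    ext i j
    have h0 := (hΦ i 0).hasDerivAt.mul (hasDerivAt_spin τ t 0 j)
    have h1 := (hΦ i 1).hasDerivAt.mul (hasDerivAt_spin τ t 1 j)
    have e : (fun x => (Φ x * spin τ x) i j)
        = (fun x => Φ x i 0) * (fun x => spin τ x 0 j) +
          (fun x => Φ x i 1) * (fun x => spin τ x 1 j) := by
      funext x
      simp [Matrix.mul_apply, Fin.sum_univ_two]
    rw [mderiv, Matrix.of_apply, e, (h0.add h1).deriv, Matrix.add_apply,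
      Matrix.mul_apply (M := mderiv Φ t), Matrix.mul_apply (M := Φ t),
      Fin.sum_univ_two, Fin.sum_univ_two]
    simp only [mderiv, Matrix.of_apply]
    ring
  have hcancel (X : Mat) : X * spin τ t * (spin (-τ) t * (Φ t)⁻¹) = X * (Φ t)⁻¹ := by
    calc X * spin τ t * (spin (-τ) t * (Φ t)⁻¹)
        = X * (spin τ t * spin (-τ) t) * (Φ t)⁻¹ := by simp only [mul_assoc]
      _ = X * (Φ t)⁻¹ := by rw [spin_mul_spin_neg, mul_one]
  rw [angVel, hd, Matrix.mul_inv_rev, spin_inv, add_mul, ← mul_assoc (Φ t), hcancel, hcancel,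
    angVel, axis]
  simp

theorem bracket_swap (x y : Mat) : ⁅y, x⁆ = -⁅x, y⁆ := by
  simp [Ring.lie_def]

theorem bracket_self (x : Mat) : ⁅x, x⁆ = 0 := by
  simp [Ring.lie_def]

theorem bracket_add (x y z : Mat) : ⁅x, y + z⁆ = ⁅x, y⁆ + ⁅x, z⁆ := by
  simp only [Ring.lie_def]; noncomm_ring

theorem add_bracket (x y z : Mat) : ⁅x + y, z⁆ = ⁅x, z⁆ + ⁅y, z⁆ := by
  simp only [Ring.lie_def]; noncomm_ring

theorem bracket_smul (a : ℝ) (x y : Mat) : ⁅x, a • y⁆ = a • ⁅x, y⁆ := by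
  simp [Ring.lie_def, smul_sub]

theorem smul_bracket (a : ℝ) (x y : Mat) : ⁅a • x, y⁆ = a • ⁅x, y⁆ := by
  simp [Ring.lie_def, smul_sub]

theorem bracket_neg (x y : Mat) : ⁅x, -y⁆ = -⁅x, y⁆ := by
  simp only [Ring.lie_def]; noncomm_ring

theorem ip_self_bracket (x y : Mat) : ip ⁅x, y⁆ x = 0 := by
  have h1 : ip ⁅x, y⁆ x = ip x ⁅y, x⁆ := ip_bracket x y x
  have h3 : ⁅y, x⁆ = (-1 : ℝ) • ⁅x, y⁆ := by rw [neg_one_smul, bracket_swap]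
  rw [h3, ip_smul_right, ip_comm x] at h1
  linarith

/-- Passing from the axial moment of inertia `C` to `C'` and adding the spin `(1/C' - 1/C) n`
keeps the momentum, if the axial momentum is `n`. -/
theorem momentum_add_axis {A C C' p s n : ℝ} (hC : C ≠ 0) (hC' : C' ≠ 0) {Φ ω : Mat}
    (hr : ip (axis Φ) (axis Φ) = 1) (hn : C * ip ω (axis Φ) = n) :
    momentum A C' p s Φ (ω + ((1 / C' - 1 / C) * n) • axis Φ) = momentum A C p s Φ ω := by
  have hx : ip ω (axis Φ) = n / C := by field_simp; linarith
  simp only [momentum, ip_add_left, ip_smul_left, ip_add_right, ip_smul_right, hr, hx,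
    ip_self_bracket]
  have e : A * ((1 / C' - 1 / C) * n) + (C' - A) * (n / C + (1 / C' - 1 / C) * n * 1)
      = (C - A) * (n / C) := by
    field_simp; ring
  rw [← e]
  module

theorem ip_momentum_axis {A C p s : ℝ} {Φ ω : Mat} (hr : ip (axis Φ) (axis Φ) = 1) :
    ip (momentum A C p s Φ ω) (axis Φ) = C * ip ω (axis Φ) := by
  simp only [momentum, ip_add_left, ip_smul_left, hr, ip_self_bracket]
  ring

theorem kinetic_add_axis {A C C' p s n : ℝ} (hC : C ≠ 0) (hC' : C' ≠ 0) {Φ ω : Mat}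
    (hr : ip (axis Φ) (axis Φ) = 1) (hn : C * ip ω (axis Φ) = n) :
    kinetic A C' p s Φ (ω + ((1 / C' - 1 / C) * n) • axis Φ)
      = kinetic A C p s Φ ω - n ^ 2 / (2 * C) + n ^ 2 / (2 * C') := by
  have hx : ip ω (axis Φ) = n / C := by field_simp; linarith
  simp only [kinetic, ip_add_left, ip_smul_left, ip_add_right, ip_smul_right, hr, hx,
    ip_self_bracket, ip_comm (axis Φ) ω]
  field_simp
  ring

theorem bracket_add_DL_add_axis {A C C' p s n : ℝ} (hC : C ≠ 0) (hC' : C' ≠ 0) {Φ ω : Mat}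
    (hr : ip (axis Φ) (axis Φ) = 1) (hn : C * ip ω (axis Φ) = n) :
    ⁅ω + ((1 / C' - 1 / C) * n) • axis Φ, momentum A C p s Φ ω⁆
        + DL A C' p s Φ (ω + ((1 / C' - 1 / C) * n) • axis Φ)
      = ⁅ω, momentum A C p s Φ ω⁆ + DL A C p s Φ ω := by
  have hx : ip ω (axis Φ) = n / C := by field_simp; linarith
  have e : (C - A) * (n / C) = A * ((1 / C' - 1 / C) * n)
      + (C' - A) * (n / C + (1 / C' - 1 / C) * n * 1) := by
    field_simp; ring
  have hk : ⁅k, axis Φ⁆ = -⁅axis Φ, k⁆ := bracket_swap _ _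
  simp only [momentum, DL, ip_add_left, ip_smul_left, ip_add_right, ip_smul_right, hr, hx,
    ip_self_bracket, bracket_add, add_bracket, bracket_smul, smul_bracket, bracket_self, hk,
    bracket_neg, e, bracket_swap ω (axis Φ)]
  module

theorem ip_axis_self {Φ : Mat} (h : Φ ∈ Matrix.specialUnitaryGroup (Fin 2) ℂ) :
    ip (axis Φ) (axis Φ) = 1 := by
  obtain ⟨h1, h2⟩ := eq_of_mem_su_two h
  rw [h1, axis_su_two h2, ip_su, axisVec_dotProduct_self h2]

/-- Motions for the axial moments of inertia `C` and `C'` differ by a uniform rotation with rate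
`(1/C' - 1/C) n` about the symmetry axis. -/
theorem IsMotion.mul_spin {A C C' p s h l n : ℝ} (hC : C ≠ 0) (hC' : C' ≠ 0) {J : Set ℝ}
    (hJ : IsOpen J) {Φ : ℝ → Mat} (hΦ : IsMotion A C p s J (h + n ^ 2 / (2 * C)) l n Φ) :
    IsMotion A C' p s J (h + n ^ 2 / (2 * C')) l n
      (fun t => Φ t * spin ((1 / C' - 1 / C) * n) t) := by
  set τ := (1 / C' - 1 / C) * n with hτ
  have hr (t : ℝ) (ht : t ∈ J) := ip_axis_self (hΦ.curve.mem t ht)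
  have hn (t : ℝ) (ht : t ∈ J) : C * ip (angVel Φ t) (axis (Φ t)) = n := by
    rw [← ip_momentum_axis (hr t ht)]; exact hΦ.axial t ht
  have hω (t : ℝ) (ht : t ∈ J) :
      angVel (fun x => Φ x * spin τ x) t = angVel Φ t + τ • axis (Φ t) := by
    exact angVel_mul_spin τ (fun i j => (hΦ.curve.hasDerivAt_entry hJ ht i j).differentiableAt)
  have hax (t x : ℝ) : axis (Φ t * spin τ x) = axis (Φ t) := axis_mul_spin _ _ _
  have mom_congr (c x : ℝ) (t : ℝ) (ω : Mat) :
      momentum A c p s (Φ t * spin τ x) ω = momentum A c p s (Φ t) ω := by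
    simp only [momentum, hax]
  have hm (t : ℝ) (ht : t ∈ J) :
      momentum A C' p s (Φ t * spin τ t) (angVel (fun x => Φ x * spin τ x) t)
        = momentum A C p s (Φ t) (angVel Φ t) := by
    rw [hω t ht, mom_congr, momentum_add_axis hC hC' (hr t ht) (hn t ht)]
  refine ⟨⟨fun t ht => mul_mem (hΦ.curve.mem t ht) (spin_mem _ _), fun i j => ?_⟩, fun t ht => ?_,
    fun t ht => ?_, fun t ht => ?_, fun t ht => ?_⟩
  · simp only [Matrix.mul_apply, Fin.sum_univ_two]
    exact ((hΦ.curve.smooth i 0).mul (contDiff_spin τ 0 j).contDiffOn).add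
      ((hΦ.curve.smooth i 1).mul (contDiff_spin τ 1 j).contDiffOn)
  · have hd : mderiv (fun x => momentum A C' p s (Φ x * spin τ x)
        (angVel (fun x => Φ x * spin τ x) x)) t
          = mderiv (fun x => momentum A C p s (Φ x) (angVel Φ x)) t := by
      ext i j
      refine Filter.EventuallyEq.deriv_eq ?_
      filter_upwards [hJ.mem_nhds ht] with x hx
      simp only [hm x hx]
    rw [hd, hm t ht, hω t ht, hΦ.eqn t ht]
    have hDL : DL A C' p s (Φ t * spin τ t) (angVel Φ t + τ • axis (Φ t))
        = DL A C' p s (Φ t) (angVel Φ t + τ • axis (Φ t)) := by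
      simp only [DL, hax]
    rw [hDL, bracket_add_DL_add_axis hC hC' (hr t ht) (hn t ht)]
  · have hk : kinetic A C' p s (Φ t * spin τ t) (angVel Φ t + τ • axis (Φ t))
        = kinetic A C' p s (Φ t) (angVel Φ t + τ • axis (Φ t)) := by
      simp only [kinetic, hax]
    have hpot : potential p (Φ t * spin τ t) = potential p (Φ t) := by
      simp only [potential, hax]
    rw [hω t ht, hk, hpot, kinetic_add_axis hC hC' (hr t ht) (hn t ht)]
    linarith [hΦ.energy t ht]
  · rw [hm t ht]; exact hΦ.vertical t ht
  · rw [hm t ht, hax]; exact hΦ.axial t ht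

theorem isMotion_iff_exists_spin {A C p s h l n : ℝ} (hA : A ≠ 0) (hC : C ≠ 0) {J : Set ℝ}
    (hJ : IsOpen J) (Ψ : ℝ → Mat) :
    IsMotion A C p s J (h + n ^ 2 / (2 * C)) l n Ψ ↔
      ∃ Φ : ℝ → Mat, IsMotion A A p s J (h + n ^ 2 / (2 * A)) l n Φ ∧
        ∀ t, Ψ t = Φ t * spin ((1 / C - 1 / A) * n) t := by
  constructor
  · intro hΨ
    refine ⟨_, hΨ.mul_spin hC hA hJ, fun t => ?_⟩
    have e : (1 / C - 1 / A) * n = -((1 / A - 1 / C) * n) := by ring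
    rw [e, mul_assoc, spin_mul_spin_neg, mul_one]
  · rintro ⟨Φ, hΦ, e⟩
    rw [show Ψ = _ from funext e]
    exact hΦ.mul_spin hA hC hJ

theorem isDynConst_iff_spherical {A C p h l n e₁ e₂ e₃ : ℝ} :
    IsDynConst A C p (h + n ^ 2 / (2 * C)) l n e₁ e₂ e₃ ↔
      IsDynConst A A p (h + n ^ 2 / (2 * A)) l n e₁ e₂ e₃ := by
  have e (c : ℝ) : h + n ^ 2 / (2 * c) - 1 / (2 * c) * n ^ 2 = h := by ring
  constructor <;> rintro ⟨h1, h2, h3, h4, h5⟩ <;> refine ⟨h1, h2, h3, h4, fun x => ?_⟩ <;>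
    have := h5 x <;> rw [e] at this ⊢ <;> exact this

/-! ### Existence of the dynamical constants -/

/-- A monic quadratic polynomial which is nonnegative at `-1` and nonpositive at `1` has a zero in
`[-1, 1]` and one in `[1, ∞)`. -/
theorem exists_quadratic_factor {b c : ℝ} (h1 : 0 ≤ 1 - b + c) (h2 : 1 + b + c ≤ 0) :
    ∃ x y : ℝ, -1 ≤ x ∧ x ≤ 1 ∧ 1 ≤ y ∧ ∀ z, z ^ 2 + b * z + c = (z - x) * (z - y) := by
  have hd : (2 + b) ^ 2 ≤ b ^ 2 - 4 * c := by nlinarith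
  have hd' : b ^ 2 - 4 * c ≤ (b - 2) ^ 2 := by nlinarith
  have hb : b ≤ 0 := by nlinarith
  set D := Real.sqrt (b ^ 2 - 4 * c) with hD
  have hDs : D ^ 2 = b ^ 2 - 4 * c := Real.sq_sqrt (le_trans (sq_nonneg _) hd)
  have hD0 : 0 ≤ D := Real.sqrt_nonneg _
  have ha : |2 + b| ≤ D := Real.abs_le_sqrt hd
  have hb' : D ≤ |b - 2| := Real.sqrt_le_iff.2 ⟨abs_nonneg _, by rw [sq_abs]; exact hd'⟩
  rw [abs_of_nonpos (by linarith : b - 2 ≤ 0)] at hb'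
  obtain ⟨ha1, ha2⟩ := abs_le.1 ha
  refine ⟨(-b - D) / 2, (-b + D) / 2, by linarith, by linarith, by linarith, fun z => ?_⟩
  linear_combination (1 / 4) * hDs

/-- The three real zeros of a monic cubic polynomial `f` with `f(-1) ≤ 0`, `f(1) ≤ 0`, given that
`f` is nonnegative at an inner point of `[-1, 1]`. -/
theorem exists_cubic_factor {a b c u : ℝ} (h1 : -1 + a - b + c ≤ 0) (h2 : 1 + a + b + c ≤ 0)
    (hu1 : -1 < u) (hu2 : u < 1) (hu : 0 ≤ u ^ 3 + a * u ^ 2 + b * u + c) :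
    ∃ e₁ e₂ e₃ : ℝ, -1 ≤ e₁ ∧ e₁ ≤ e₂ ∧ e₂ ≤ 1 ∧ 1 ≤ e₃ ∧
      ∀ x, x ^ 3 + a * x ^ 2 + b * x + c = (x - e₁) * (x - e₂) * (x - e₃) := by
  have hcont : Continuous fun x : ℝ => x ^ 3 + a * x ^ 2 + b * x + c := by fun_prop
  obtain ⟨x, ⟨hx1, hx2⟩, hx⟩ : (0 : ℝ) ∈ (fun x : ℝ => x ^ 3 + a * x ^ 2 + b * x + c) ''
      Set.Icc (-1) u :=
    intermediate_value_Icc hu1.le hcont.continuousOn ⟨by norm_num; linarith, hu⟩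
  have hfac (z : ℝ) : z ^ 3 + a * z ^ 2 + b * z + c
      = (z - x) * (z ^ 2 + (a + x) * z + (b + x * (a + x))) := by
    simp only at hx
    linear_combination hx
  set β := a + x
  set γ := b + x * β
  have hq1 : 1 + β + γ ≤ 0 := by
    have := hfac 1
    by_contra! hc
    nlinarith [mul_pos (by linarith : 0 < 1 - x) hc]
  have hq2 : 0 ≤ 1 - β + γ := by
    by_contra! hc
    have h3 := hfac (-1)
    have h4 : (-1 - x) * (1 - β + γ) ≤ 0 := by linarith
    have h5 : x = -1 := by nlinarith
    -- the quadratic factor would be negative on `(-1, 1)` by convexity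
    have h6 : u ^ 2 + β * u + γ < 0 := by
      nlinarith [mul_pos (by linarith : 0 < 1 - u) (neg_pos.2 hc),
        mul_nonneg (by linarith : 0 ≤ 1 + u) (neg_nonneg.2 hq1),
        mul_pos (by linarith : 0 < 1 - u) (by linarith : 0 < 1 + u)]
    have h7 := hfac u
    nlinarith [mul_pos (by linarith : 0 < u - x) (neg_pos.2 h6)]
  obtain ⟨y, z, hy1, hy2, hz, hq⟩ := exists_quadratic_factor hq2 hq1
  rcases le_total x y with h | h
  · exact ⟨x, y, z, hx1, h, hy2, hz, fun w => by rw [hfac w, hq w]; ring⟩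
  · exact ⟨y, x, z, hy1, h, by linarith, hz, fun w => by rw [hfac w, hq w]; ring⟩

/-- The cubic polynomial of `IsDynConst` has zeros as required if it is nonnegative at some point
`u` of `(-1, 1)`; at `u = ± 1` nonnegativity is replaced by `l = ± n` and `0 ≤ h - n²/(2C) - p u`. -/
theorem exists_isDynConst {A C p h l n u : ℝ} (hA : 0 < A) (hp : 0 < p)
    (hu1 : -1 ≤ u) (hu2 : u ≤ 1) (hE : 0 ≤ h - 1 / (2 * C) * n ^ 2 - p * u)
    (hl : u ^ 2 = 1 → l = n * u)
    (hu : 0 ≤ 1 / p * (1 - u ^ 2) * (h - 1 / (2 * C) * n ^ 2 - p * u)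
      - 1 / (2 * A * p) * (l - n * u) ^ 2) :
    ∃ e₁ e₂ e₃ : ℝ, IsDynConst A C p h l n e₁ e₂ e₃ := by
  set H := h - 1 / (2 * C) * n ^ 2
  set N := 1 / (2 * A * p)
  have hN : 0 ≤ N := by positivity
  have hpp : 1 / p * p = 1 := by field_simp
  set P := 1 / p
  have hP : 0 ≤ P := by positivity
  have hPE : 0 ≤ P * H - u := by
    have := mul_nonneg hP hE
    nlinarith
  have hcubic (x : ℝ) : P * (1 - x ^ 2) * (H - p * x) - N * (l - n * x) ^ 2
      = x ^ 3 + (-P * H - N * n ^ 2) * x ^ 2 + (2 * N * l * n - 1) * x + (P * H - N * l ^ 2) := by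
    linear_combination (x ^ 3 - x) * hpp
  rcases hu1.eq_or_lt with rfl | hu1
  · have hl' : l = -n := by simpa using hl (by norm_num)
    obtain ⟨x, y, hx1, hx2, hy, hq⟩ := exists_quadratic_factor
      (b := -P * H - N * n ^ 2 - 1) (c := P * H - N * l ^ 2)
      (by rw [hl']; nlinarith) (by rw [hl']; nlinarith [mul_nonneg hN (sq_nonneg n)])
    refine ⟨-1, x, y, le_rfl, hx1, hx2, hy, fun z => ?_⟩
    rw [hcubic]
    have := hq z
    rw [hl'] at this ⊢
    linear_combination (z + 1) * this
  rcases hu2.eq_or_lt with rfl | hu2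
  · have hl' : l = n := by simpa using hl (by norm_num)
    obtain ⟨x, y, hx1, hx2, hy, hq⟩ := exists_quadratic_factor
      (b := -P * H - N * n ^ 2 + 1) (c := -(P * H - N * l ^ 2))
      (by rw [hl']; nlinarith [mul_nonneg hN (sq_nonneg n)]) (by rw [hl']; nlinarith)
    refine ⟨x, 1, y, hx1, hx2, le_rfl, hy, fun z => ?_⟩
    rw [hcubic]
    have := hq z
    rw [hl'] at this ⊢
    linear_combination (z - 1) * this
  obtain ⟨e₁, e₂, e₃, h1, h2, h3, h4, h5⟩ := exists_cubic_factor
    (a := -P * H - N * n ^ 2) (b := 2 * N * l * n - 1) (c := P * H - N * l ^ 2) (u := u)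
    (by nlinarith [mul_nonneg hN (sq_nonneg (l + n))])
    (by nlinarith [mul_nonneg hN (sq_nonneg (l - n))]) hu1 hu2 (by rw [← hcubic]; exact hu)
  exact ⟨e₁, e₂, e₃, h1, h2, h3, h4, fun x => by rw [← h5, ← hcubic]⟩

/-! ### The Lagrangian in coordinates -/

section Coordinates

variable {A C p s : ℝ} {Φ : Mat} {r o : Fin 3 → ℝ}

/-- The momentum in coordinates, for the axis `r` and the angular velocity `o`. -/
def momVec (A C p s : ℝ) (r o : Fin 3 → ℝ) : Fin 3 → ℝ :=
  A • o + ((C - A) * (o ⬝ᵥ r)) • r + (p * s * ((r ⨯₃ kvec) ⬝ᵥ o)) • (r ⨯₃ kvec)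

theorem momentum_su (hr : axis Φ = su r) :
    momentum A C p s Φ (su o) = su (momVec A C p s r o) := by
  simp only [momentum, momVec, hr, ← su_kvec, su_bracket, ip_su, su_add, su_smul]

theorem energy_su (hr : axis Φ = su r) :
    kinetic A C p s Φ (su o) + potential p Φ = 1 / 2 * A * (o ⬝ᵥ o)
      + 1 / 2 * (C - A) * (o ⬝ᵥ r) ^ 2 + 1 / 2 * (p * s) * ((r ⨯₃ kvec) ⬝ᵥ o) ^ 2
      + p * (r ⬝ᵥ kvec) := by
  simp only [kinetic, potential, hr, ← su_kvec, su_bracket, ip_su]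

/-- The derivative of the Lagrangian with respect to the position, in coordinates. -/
def dlVec (A C p s : ℝ) (r o : Fin 3 → ℝ) : Fin 3 → ℝ :=
  ((C - A) * (o ⬝ᵥ r)) • (r ⨯₃ o) + (p * s * ((r ⨯₃ kvec) ⬝ᵥ o)) • (r ⨯₃ (kvec ⨯₃ o))
    - p • (r ⨯₃ kvec)

theorem DL_su (hr : axis Φ = su r) : DL A C p s Φ (su o) = su (dlVec A C p s r o) := by
  simp only [DL, dlVec, hr, ← su_kvec, su_bracket, ip_su, su_add, su_sub, su_smul]

end Coordinates

section Coordinates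

variable {A C p s : ℝ} {r o : Fin 3 → ℝ}

theorem dotProduct_kvec (v : Fin 3 → ℝ) : v ⬝ᵥ kvec = v 2 := by
  rw [Matrix.vec3_dotProduct]; simp [kvec]

theorem cross_kvec_dotProduct (r o : Fin 3 → ℝ) : (r ⨯₃ kvec) ⬝ᵥ o = (o ⨯₃ r) 2 := by
  rw [Matrix.vec3_dotProduct]; simp [kvec, cross_apply]; ring

theorem momVec_dotProduct_kvec : momVec A C p s r o ⬝ᵥ kvec
    = A * o 2 + (C - A) * (o ⬝ᵥ r) * r 2 := by
  rw [dotProduct_kvec]; simp [momVec, kvec, cross_apply]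

theorem momVec_dotProduct_axis (hr : r ⬝ᵥ r = 1) : momVec A C p s r o ⬝ᵥ r = C * (o ⬝ᵥ r) := by
  have h : (r ⨯₃ kvec) ⬝ᵥ r = 0 := by rw [dotProduct_comm, dot_self_cross]
  simp only [momVec, add_dotProduct, smul_dotProduct, smul_eq_mul, hr, h]
  ring

/-- The angular velocity component perpendicular to the axis, in terms of `u'` and `⟨ω, k⟩`. -/
theorem angular_identity (hr : r ⬝ᵥ r = 1) :
    (1 - r 2 ^ 2) * (o ⬝ᵥ o - (o ⬝ᵥ r) ^ 2)
      = (o 2 - (o ⬝ᵥ r) * r 2) ^ 2 + (o ⨯₃ r) 2 ^ 2 := by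
  simp only [Matrix.vec3_dotProduct, cross_apply, Matrix.cons_val] at hr ⊢
  linear_combination (-(o 0 ^ 2 + o 1 ^ 2)) * hr

theorem dotProduct_sq_le (hr : r ⬝ᵥ r = 1) : (o ⬝ᵥ r) ^ 2 ≤ o ⬝ᵥ o := by
  have h : o ⬝ᵥ o - (o ⬝ᵥ r) ^ 2 = (o 0 * r 1 - o 1 * r 0) ^ 2 + (o 0 * r 2 - o 2 * r 0) ^ 2
      + (o 1 * r 2 - o 2 * r 1) ^ 2 := by
    simp only [Matrix.vec3_dotProduct] at hr ⊢
    linear_combination (-(o 0 ^ 2 + o 1 ^ 2 + o 2 ^ 2)) * hr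
  have : 0 ≤ o ⬝ᵥ o - (o ⬝ᵥ r) ^ 2 := by rw [h]; positivity
  linarith

theorem sq_le_one_of_unit (hr : r ⬝ᵥ r = 1) : r 2 ^ 2 ≤ 1 := by
  rw [Matrix.vec3_dotProduct] at hr
  nlinarith [sq_nonneg (r 0), sq_nonneg (r 1)]

/-- At the poles, the axis is `± k`. -/
theorem eq_zero_of_sq_eq_one (hr : r ⬝ᵥ r = 1) (h : r 2 ^ 2 = 1) : r 0 = 0 ∧ r 1 = 0 := by
  rw [Matrix.vec3_dotProduct] at hr
  constructor <;> nlinarith [sq_nonneg (r 0), sq_nonneg (r 1)]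

end Coordinates

/-- The dynamical constants exist for every motion. The reduced equation of motion
`p f(u) = (A/2 + (ps/2)(1 - u²)) u'²` shows that the cubic polynomial `f` is nonnegative at
`u(t)`. -/
theorem IsMotion.exists_isDynConst {A C p s h l n : ℝ} (hA : 0 < A) (hp : 0 < p)
    (hs : 0 < s) {J : Set ℝ} {Φ : ℝ → Mat} (hJ : IsOpen J) (hne : J.Nonempty)
    (hΦ : IsMotion A C p s J h l n Φ) : ∃ e₁ e₂ e₃ : ℝ, IsDynConst A C p h l n e₁ e₂ e₃ := by
  obtain ⟨t, ht⟩ := hne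
  have hr := hΦ.curve.axis_eq ht
  have ho := hΦ.curve.angVel_eq hJ ht
  have hrr := hΦ.curve.axisPath_dotProduct_self ht
  have hh := hΦ.energy t ht
  have hl := hΦ.vertical t ht
  have hn := hΦ.axial t ht
  rw [ho, energy_su hr] at hh
  rw [ho, momentum_su hr, ← su_kvec, ip_su] at hl
  rw [ho, momentum_su hr, hr, ip_su] at hn
  rw [dotProduct_kvec, cross_kvec_dotProduct] at hh
  rw [momVec_dotProduct_kvec] at hl
  rw [momVec_dotProduct_axis hrr] at hn
  have hX0 := dotProduct_sq_le (o := angPath Φ t) hrr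
  have hX1 := angular_identity (o := angPath Φ t) hrr
  have hu2 := sq_le_one_of_unit hrr
  have hend : axisPath Φ t 2 ^ 2 = 1 → angPath Φ t ⬝ᵥ axisPath Φ t
      = angPath Φ t 2 * axisPath Φ t 2 := by
    intro h
    obtain ⟨h0, h1⟩ := eq_zero_of_sq_eq_one hrr h
    rw [Matrix.vec3_dotProduct, h0, h1]; ring
  set u := axisPath Φ t 2
  set c := angPath Φ t 2
  set v := (angPath Φ t ⨯₃ axisPath Φ t) 2
  set q := angPath Φ t ⬝ᵥ axisPath Φ t
  set Y := angPath Φ t ⬝ᵥ angPath Φ t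
  have hE : h - 1 / (2 * C) * n ^ 2 - p * u
      = 1 / 2 * A * (Y - q ^ 2) + 1 / 2 * (p * s) * v ^ 2 := by
    rw [← hn, ← hh]
    field_simp
    ring
  refine ToyTop.exists_isDynConst (u := u) hA hp (by nlinarith) (by nlinarith) ?_ ?_ ?_
  · rw [hE]
    have : 0 ≤ Y - q ^ 2 := by linarith
    positivity
  · intro hu
    rw [← hl, ← hn, hend hu]
    linear_combination (-A * c) * hu
  · have hlu : l - n * u = A * (c - q * u) := by rw [← hl, ← hn]; ring
    have hred : 1 / p * (1 - u ^ 2) * (h - 1 / (2 * C) * n ^ 2 - p * u)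
        - 1 / (2 * A * p) * (l - n * u) ^ 2
        = A / (2 * p) * v ^ 2 + s / 2 * (1 - u ^ 2) * v ^ 2 := by
      rw [hE, hlu]
      field_simp
      linear_combination A * hX1
    rw [hred]
    have : 0 ≤ 1 - u ^ 2 := by linarith
    positivity

/-! ### Integrals along paths -/

open MeasureTheory in
/-- A solution of `y' = y g` is an exponential integral of `g`. -/
theorem eq_mul_exp_integral {y g : ℝ → ℂ} {O : Set ℝ} (hO : IsOpen O)
    (hy : ∀ t ∈ O, HasDerivAt y (y t * g t) t) (hg : ContinuousOn g O) {a b : ℝ}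
    (hab : Set.uIcc a b ⊆ O) : y b = y a * Complex.exp (∫ t in a..b, g t) := by
  have hint (t : ℝ) (ht : t ∈ Set.uIcc a b) :
      HasDerivAt (fun x => ∫ t in a..x, g t) (g t) t :=
    intervalIntegral.integral_hasDerivAt_right
      (hg.mono ((Set.uIcc_subset_uIcc_left ht).trans hab)).intervalIntegrable
      (hg.stronglyMeasurableAtFilter hO t (hab ht)) (hg.continuousAt (hO.mem_nhds (hab ht)))
  have hconst (t : ℝ) (ht : t ∈ Set.uIcc a b) :
      HasDerivAt (fun x => y x * Complex.exp (-∫ t in a..x, g t)) 0 t := by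
    refine ((hy t (hab ht)).mul (hint t ht).neg.cexp).congr_deriv ?_
    ring
  have h := intervalIntegral.integral_eq_sub_of_hasDerivAt hconst intervalIntegrable_const
  simp only [intervalIntegral.integral_zero, intervalIntegral.integral_same, neg_zero,
    Complex.exp_zero, mul_one] at h
  rw [← sub_eq_zero.1 h.symm, mul_assoc, ← Complex.exp_add]
  simp

/-- Conversely, exponential integrals of `g` solve `y' = y g`. -/
theorem hasDerivAt_of_eq_mul_exp_integral {y g : ℝ → ℂ} {O : Set ℝ} (hO : IsOpen O)
    (hg : ContinuousOn g O)
    (hy : ∀ a b, Set.uIcc a b ⊆ O → y b = y a * Complex.exp (∫ t in a..b, g t)) {t : ℝ}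
    (ht : t ∈ O) : HasDerivAt y (y t * g t) t := by
  obtain ⟨ε, hε, hball⟩ := Metric.isOpen_iff.1 hO t ht
  have hint : HasDerivAt (fun x => ∫ s in t..x, g s) (g t) t :=
    intervalIntegral.integral_hasDerivAt_right (by simp)
      (hg.stronglyMeasurableAtFilter hO t ht) (hg.continuousAt (hO.mem_nhds ht))
  have e : y =ᶠ[nhds t] fun x => y t * Complex.exp (∫ s in t..x, g s) := by
    filter_upwards [Metric.ball_mem_nhds t hε] with x hx
    refine hy t x (subset_trans ?_ hball)
    rw [← segment_eq_uIcc]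
    exact (convex_ball t ε).segment_subset (Metric.mem_ball_self hε) hx
  refine ((hint.cexp.const_mul (y t)).congr_of_eventuallyEq e).congr_deriv ?_
  simp

open MeasureTheory in
/-- If time is the integral of `F`, then `F = 1` almost everywhere. -/
theorem ae_eq_one_of_integral {F : ℝ → ℂ} {J : Set ℝ} (hJ : IsOpen J)
    (hF : ∀ a ∈ J, ∀ b ∈ J, IntervalIntegrable F volume a b ∧ (b : ℂ) - a = ∫ t in a..b, F t) :
    ∀ᵐ t, t ∈ J → F t = 1 := by
  simp only [ae_iff, Classical.not_imp]
  refine measure_null_of_locally_null _ fun x hx => ?_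
  obtain ⟨ε, hε, hball⟩ := Metric.isOpen_iff.1 hJ x hx.1
  have hsub : Set.uIcc (x - ε / 2) (x + ε / 2) ⊆ J := by
    rw [Set.uIcc_of_le (by linarith)]
    intro z hz
    apply hball
    rw [Metric.mem_ball, Real.dist_eq, abs_lt]
    constructor <;> linarith [hz.1, hz.2]
  refine ⟨_, inter_mem_nhdsWithin _ (Icc_mem_nhds (by linarith : x - ε / 2 < x)
    (by linarith : x < x + ε / 2)), ?_⟩
  have hae := (hF _ (hsub Set.left_mem_uIcc) _ (hsub Set.right_mem_uIcc)).1.ae_hasDerivAt_integral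
  rw [ae_iff] at hae
  refine measure_mono_null ?_ hae
  rintro t ⟨⟨ht, hFt⟩, htI⟩ hd
  have htI' : t ∈ Set.uIcc (x - ε / 2) (x + ε / 2) := Set.Icc_subset_uIcc htI
  have h1 := hd htI' (x - ε / 2) Set.left_mem_uIcc
  have h2 : HasDerivAt (fun z : ℝ => (z : ℂ) - ((x - ε / 2 : ℝ) : ℂ)) 1 t :=
    Complex.ofRealCLM.hasDerivAt.sub_const _
  refine hFt (h1.unique (h2.congr_of_eventuallyEq ?_))
  filter_upwards [hJ.mem_nhds ht] with z hz
  exact (hF _ (hsub Set.left_mem_uIcc) z hz).2.symm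

/-- A function with `|f'| ≤ K |f|` and a zero vanishes identically. -/
theorem eq_zero_of_abs_deriv_le {f f' : ℝ → ℝ} {K : ℝ} {J : Set ℝ} (hJ : J.OrdConnected)
    (hf : ∀ t ∈ J, HasDerivAt f (f' t) t) (hK : ∀ t ∈ J, |f' t| ≤ K * |f t|) {t₀ : ℝ}
    (ht₀ : t₀ ∈ J) (h0 : f t₀ = 0) {t : ℝ} (ht : t ∈ J) : f t = 0 := by
  rcases le_total t₀ t with h | h
  · have hsub : Set.Icc t₀ t ⊆ J := hJ.out ht₀ ht
    exact eq_zero_of_abs_deriv_le_mul_abs_self_of_eq_zero_right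
      (fun x hx => (hf x (hsub hx)).continuousAt.continuousWithinAt)
      (fun x hx => (hf x (hsub (Set.Ico_subset_Icc_self hx))).hasDerivWithinAt) h0
      (fun x hx => hK x (hsub (Set.Ico_subset_Icc_self hx))) t ⟨h, le_rfl⟩
  · -- reverse time
    have hsub : ∀ x ∈ Set.Icc (-t₀) (-t), -x ∈ J := fun x hx =>
      hJ.out ht ht₀ ⟨by linarith [hx.2], by linarith [hx.1]⟩
    have hd (x : ℝ) (hx : x ∈ Set.Icc (-t₀) (-t)) :
        HasDerivAt (fun x => f (-x)) (-f' (-x)) x := by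
      refine ((hf (-x) (hsub x hx)).comp x (hasDerivAt_neg x)).congr_deriv ?_
      ring
    have := eq_zero_of_abs_deriv_le_mul_abs_self_of_eq_zero_right (K := K)
      (fun x hx => (hd x hx).continuousAt.continuousWithinAt)
      (fun x hx => (hd x (Set.Ico_subset_Icc_self hx)).hasDerivWithinAt) (by simpa using h0)
      (fun x hx => by
        simpa using hK (-x) (hsub x (Set.Ico_subset_Icc_self hx))) (-t) ⟨by linarith, le_rfl⟩
    simpa using this

open MeasureTheory in
/-- A differentiable function with nonzero derivative at its zeros vanishes only on a null set. -/
theorem ae_ne_zero_of_deriv_ne_zero {f f' : ℝ → ℝ} {J : Set ℝ}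
    (hf : ∀ t ∈ J, HasDerivAt f (f' t) t) (h : ∀ t ∈ J, f t = 0 → f' t ≠ 0) :
    ∀ᵐ t, t ∈ J → f t ≠ 0 := by
  simp only [ae_iff, Classical.not_imp, not_not]
  refine measure_null_of_locally_null _ fun x hx => ?_
  have hne : ∀ᶠ z in nhdsWithin x {x}ᶜ, f z ≠ 0 := (hf x hx.1).eventually_ne (h x hx.1 hx.2)
  rw [eventually_nhdsWithin_iff] at hne
  refine ⟨_, inter_mem_nhdsWithin _ hne, measure_mono_null (t := {x}) ?_ (by simp)⟩
  rintro z ⟨hz1, hz2⟩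
  by_contra hzx
  exact hz2 hzx hz1.2

/-! ### The equations of motion in coordinates -/

theorem hasDerivAt_dotProduct {f g : ℝ → Fin 3 → ℝ} {f' g' : Fin 3 → ℝ} {t : ℝ}
    (hf : HasDerivAt f f' t) (hg : HasDerivAt g g' t) :
    HasDerivAt (fun x => f x ⬝ᵥ g x) (f' ⬝ᵥ g t + f t ⬝ᵥ g') t := by
  have hf := hasDerivAt_pi.1 hf
  have hg := hasDerivAt_pi.1 hg
  simp only [Matrix.vec3_dotProduct]
  refine ((((hf 0).mul (hg 0)).add ((hf 1).mul (hg 1))).add ((hf 2).mul (hg 2))).congr_deriv ?_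
  ring

theorem hasDerivAt_cross {f g : ℝ → Fin 3 → ℝ} {f' g' : Fin 3 → ℝ} {t : ℝ}
    (hf : HasDerivAt f f' t) (hg : HasDerivAt g g' t) :
    HasDerivAt (fun x => f x ⨯₃ g x) (f' ⨯₃ g t + f t ⨯₃ g') t := by
  have hf := hasDerivAt_pi.1 hf
  have hg := hasDerivAt_pi.1 hg
  simp only [cross_apply]
  rw [hasDerivAt_pi]
  intro i
  fin_cases i
  · refine (((hf 1).mul (hg 2)).sub ((hf 2).mul (hg 1))).congr_deriv ?_
    simp; ring
  · refine (((hf 2).mul (hg 0)).sub ((hf 0).mul (hg 2))).congr_deriv ?_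
    simp; ring
  · refine (((hf 0).mul (hg 1)).sub ((hf 1).mul (hg 0))).congr_deriv ?_
    simp; ring

section Curve

variable {A p s h l n : ℝ} {J : Set ℝ} {Φ : ℝ → Mat} {t : ℝ}

/-- The derivative `u'` of the height, in coordinates. -/
noncomputable def heightDeriv (Φ : ℝ → Mat) (t : ℝ) : ℝ := (angPath Φ t ⨯₃ axisPath Φ t) 2

theorem IsCurve.hasDerivAt_angPath (hJ : IsOpen J) (hΦ : IsCurve J Φ) (ht : t ∈ J) :
    HasDerivAt (angPath Φ) (deriv (angPath Φ) t) t :=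
  (((hΦ.contDiffOn_angPath hJ).contDiffAt (hJ.mem_nhds ht)).differentiableAt
    (by norm_num)).hasDerivAt

theorem IsCurve.hasDerivAt_axisPath_two (hJ : IsOpen J) (hΦ : IsCurve J Φ) (ht : t ∈ J) :
    HasDerivAt (fun x => axisPath Φ x 2) (heightDeriv Φ t) t :=
  hasDerivAt_pi.1 (hΦ.hasDerivAt_axisPath hJ ht) 2

theorem IsCurve.deriv_height (hJ : IsOpen J) (hΦ : IsCurve J Φ) (ht : t ∈ J) :
    deriv (fun x => height (Φ x)) t = heightDeriv Φ t := by
  refine ((hΦ.hasDerivAt_axisPath_two hJ ht).congr_of_eventuallyEq ?_).deriv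
  filter_upwards [hJ.mem_nhds ht] with x hx
  exact hΦ.height_eq hx

theorem IsCurve.continuousOn_axisPath (hΦ : IsCurve J Φ) : ContinuousOn (axisPath Φ) J :=
  hΦ.contDiffOn_axisPath.continuousOn

theorem IsCurve.continuousOn_angPath (hJ : IsOpen J) (hΦ : IsCurve J Φ) :
    ContinuousOn (angPath Φ) J :=
  (hΦ.contDiffOn_angPath hJ).continuousOn

theorem continuousOn_cross {f g : ℝ → Fin 3 → ℝ} (hf : ContinuousOn f J) (hg : ContinuousOn g J) :
    ContinuousOn (fun x => f x ⨯₃ g x) J := by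
  have hf := continuousOn_pi.1 hf
  have hg := continuousOn_pi.1 hg
  simp only [cross_apply]
  rw [continuousOn_pi]
  intro i
  fin_cases i
  · exact ((hf 1).mul (hg 2)).sub ((hf 2).mul (hg 1))
  · exact ((hf 2).mul (hg 0)).sub ((hf 0).mul (hg 2))
  · exact ((hf 0).mul (hg 1)).sub ((hf 1).mul (hg 0))

theorem continuousOn_dotProduct {f g : ℝ → Fin 3 → ℝ} (hf : ContinuousOn f J)
    (hg : ContinuousOn g J) : ContinuousOn (fun x => f x ⬝ᵥ g x) J := by
  have hf := continuousOn_pi.1 hf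
  have hg := continuousOn_pi.1 hg
  simp only [Matrix.vec3_dotProduct]
  exact (((hf 0).mul (hg 0)).add ((hf 1).mul (hg 1))).add ((hf 2).mul (hg 2))

theorem IsCurve.continuousOn_heightDeriv (hJ : IsOpen J) (hΦ : IsCurve J Φ) :
    ContinuousOn (heightDeriv Φ) J :=
  continuousOn_pi.1 (continuousOn_cross (hΦ.continuousOn_angPath hJ) hΦ.continuousOn_axisPath) 2

/-- The derivative of `r ⨯ k` along a curve. -/
theorem IsCurve.hasDerivAt_cross_kvec (hJ : IsOpen J) (hΦ : IsCurve J Φ) (ht : t ∈ J) :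
    HasDerivAt (fun x => axisPath Φ x ⨯₃ kvec) ((angPath Φ t ⨯₃ axisPath Φ t) ⨯₃ kvec) t := by
  refine (hasDerivAt_cross (hΦ.hasDerivAt_axisPath hJ ht) (hasDerivAt_const t kvec)).congr_deriv ?_
  simp

theorem IsCurve.hasDerivAt_heightDeriv (hJ : IsOpen J) (hΦ : IsCurve J Φ) (ht : t ∈ J) :
    HasDerivAt (heightDeriv Φ) (((angPath Φ t ⨯₃ axisPath Φ t) ⨯₃ kvec) ⬝ᵥ angPath Φ t
      + (axisPath Φ t ⨯₃ kvec) ⬝ᵥ deriv (angPath Φ) t) t := by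
  have := hasDerivAt_dotProduct (hΦ.hasDerivAt_cross_kvec hJ ht) (hΦ.hasDerivAt_angPath hJ ht)
  exact this.congr_of_eventuallyEq
    (Filter.Eventually.of_forall fun x => (cross_kvec_dotProduct _ _).symm)

/-- The momentum of the spherical top along a curve, in coordinates. -/
noncomputable def momPath (A p s : ℝ) (Φ : ℝ → Mat) (t : ℝ) : Fin 3 → ℝ :=
  A • angPath Φ t + (p * s * heightDeriv Φ t) • (axisPath Φ t ⨯₃ kvec)

/-- The derivative of the Lagrangian of the spherical top along a curve, in coordinates. -/
noncomputable def dlPath (p s : ℝ) (Φ : ℝ → Mat) (t : ℝ) : Fin 3 → ℝ :=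
  (p * s * heightDeriv Φ t) • (axisPath Φ t ⨯₃ (kvec ⨯₃ angPath Φ t))
    - p • (axisPath Φ t ⨯₃ kvec)

theorem IsCurve.hasDerivAt_momPath (hJ : IsOpen J) (hΦ : IsCurve J Φ) (ht : t ∈ J) :
    HasDerivAt (momPath A p s Φ) (A • deriv (angPath Φ) t
      + ((p * s * heightDeriv Φ t) • ((angPath Φ t ⨯₃ axisPath Φ t) ⨯₃ kvec)
        + (p * s * (((angPath Φ t ⨯₃ axisPath Φ t) ⨯₃ kvec) ⬝ᵥ angPath Φ t
          + (axisPath Φ t ⨯₃ kvec) ⬝ᵥ deriv (angPath Φ) t)) • (axisPath Φ t ⨯₃ kvec))) t :=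
  ((hΦ.hasDerivAt_angPath hJ ht).const_smul A).add
    (((hΦ.hasDerivAt_heightDeriv hJ ht).const_mul (p * s)).smul (hΦ.hasDerivAt_cross_kvec hJ ht))

theorem IsCurve.momentum_eq (hJ : IsOpen J) (hΦ : IsCurve J Φ) (ht : t ∈ J) :
    momentum A A p s (Φ t) (angVel Φ t) = su (momPath A p s Φ t) := by
  rw [hΦ.angVel_eq hJ ht, momentum_su (hΦ.axis_eq ht), momVec, momPath, cross_kvec_dotProduct,
    heightDeriv]
  simp

theorem IsCurve.DL_eq (hJ : IsOpen J) (hΦ : IsCurve J Φ) (ht : t ∈ J) :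
    DL A A p s (Φ t) (angVel Φ t) = su (dlPath p s Φ t) := by
  rw [hΦ.angVel_eq hJ ht, DL_su (hΦ.axis_eq ht), dlVec, dlPath, cross_kvec_dotProduct,
    heightDeriv]
  simp

theorem IsCurve.mderiv_momentum (hJ : IsOpen J) (hΦ : IsCurve J Φ) (ht : t ∈ J) :
    mderiv (fun x => momentum A A p s (Φ x) (angVel Φ x)) t = su (deriv (momPath A p s Φ) t) := by
  have hM := (hΦ.hasDerivAt_momPath (A := A) (p := p) (s := s) hJ ht).differentiableAt.hasDerivAt
  have hMi (i : Fin 3) : HasDerivAt (fun x => (momPath A p s Φ x i : ℂ))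
      (deriv (momPath A p s Φ) t i : ℂ) t := (hasDerivAt_pi.1 hM i).ofReal_comp
  have e (i j : Fin 2) : (fun x => momentum A A p s (Φ x) (angVel Φ x) i j) =ᶠ[nhds t]
      fun x => su (momPath A p s Φ x) i j := by
    filter_upwards [hJ.mem_nhds ht] with x hx
    rw [hΦ.momentum_eq hJ hx]
  ext i j
  refine (e i j).deriv_eq.trans ?_
  fin_cases i <;> fin_cases j
  · exact (((hMi 2).const_mul Complex.I).div_const 2).deriv
  · exact ((((hMi 0).const_mul Complex.I).sub (hMi 1)).div_const 2).deriv
  · exact ((((hMi 0).const_mul Complex.I).add (hMi 1)).div_const 2).deriv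
  · exact (((hMi 2).const_mul Complex.I).neg.div_const 2).deriv

/-- The motions of the spherical top, in coordinates. -/
theorem IsCurve.isMotion_iff (hJ : IsOpen J) (hΦ : IsCurve J Φ) :
    IsMotion A A p s J h l n Φ ↔ ∀ t ∈ J,
      deriv (momPath A p s Φ) t = angPath Φ t ⨯₃ momPath A p s Φ t + dlPath p s Φ t ∧
      1 / 2 * A * (angPath Φ t ⬝ᵥ angPath Φ t) + 1 / 2 * (p * s) * heightDeriv Φ t ^ 2
        + p * axisPath Φ t 2 = h ∧
      A * angPath Φ t 2 = l ∧ A * (angPath Φ t ⬝ᵥ axisPath Φ t) = n := by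
  have heq (t : ℝ) (ht : t ∈ J) : mderiv (fun x => momentum A A p s (Φ x) (angVel Φ x)) t
      = ⁅angVel Φ t, momentum A A p s (Φ t) (angVel Φ t)⁆ + DL A A p s (Φ t) (angVel Φ t) ↔
      deriv (momPath A p s Φ) t = angPath Φ t ⨯₃ momPath A p s Φ t + dlPath p s Φ t := by
    rw [hΦ.mderiv_momentum hJ ht, hΦ.momentum_eq hJ ht, hΦ.DL_eq hJ ht, hΦ.angVel_eq hJ ht,
      su_bracket, ← su_add, su_inj]
  have hen (t : ℝ) (ht : t ∈ J) : kinetic A A p s (Φ t) (angVel Φ t) + potential p (Φ t)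
      = 1 / 2 * A * (angPath Φ t ⬝ᵥ angPath Φ t) + 1 / 2 * (p * s) * heightDeriv Φ t ^ 2
        + p * axisPath Φ t 2 := by
    rw [hΦ.angVel_eq hJ ht, energy_su (hΦ.axis_eq ht), cross_kvec_dotProduct, dotProduct_kvec,
      heightDeriv]
    ring
  have hv (t : ℝ) (ht : t ∈ J) : ip (momentum A A p s (Φ t) (angVel Φ t)) k
      = A * angPath Φ t 2 := by
    rw [hΦ.angVel_eq hJ ht, momentum_su (hΦ.axis_eq ht), ← su_kvec, ip_su, momVec_dotProduct_kvec]
    ring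
  have hax (t : ℝ) (ht : t ∈ J) : ip (momentum A A p s (Φ t) (angVel Φ t)) (axis (Φ t))
      = A * (angPath Φ t ⬝ᵥ axisPath Φ t) := by
    rw [hΦ.angVel_eq hJ ht, momentum_su (hΦ.axis_eq ht), hΦ.axis_eq ht, ip_su,
      momVec_dotProduct_axis (hΦ.axisPath_dotProduct_self ht)]
  constructor
  · intro hM t ht
    exact ⟨(heq t ht).1 (hM.eqn t ht), (hen t ht).symm.trans (hM.energy t ht),
      (hv t ht).symm.trans (hM.vertical t ht), (hax t ht).symm.trans (hM.axial t ht)⟩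
  · intro H
    exact ⟨hΦ, fun t ht => (heq t ht).2 (H t ht).1, fun t ht => (hen t ht).trans (H t ht).2.1,
      fun t ht => (hv t ht).trans (H t ht).2.2.1, fun t ht => (hax t ht).trans (H t ht).2.2.2⟩

/-! ### From motions to integrals -/

/-- The right hand side of the reduced equation of motion of the spherical top. -/
noncomputable def redPoly (A p h l n x : ℝ) : ℝ :=
  1 / p * (1 - x ^ 2) * (h - 1 / (2 * A) * n ^ 2 - p * x) - 1 / (2 * A * p) * (l - n * x) ^ 2

theorem e₄_sq (hA : 0 < A) (hp : 0 < p) (hs : 0 < s) : e₄ A p s ^ 2 = 1 + A / (p * s) :=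
  Real.sq_sqrt (by positivity)

theorem one_lt_e₄_sq (hA : 0 < A) (hp : 0 < p) (hs : 0 < s) : 1 < e₄ A p s ^ 2 := by
  rw [e₄_sq hA hp hs]
  have : 0 < A / (p * s) := by positivity
  linarith

/-- The first integrals determine `u'`: the reduced equation of motion. -/
theorem reduced_equation (hA : 0 < A) (hp : 0 < p) (hs : 0 < s) {r o : Fin 3 → ℝ}
    (hr : r ⬝ᵥ r = 1) :
    redPoly A p (1 / 2 * A * (o ⬝ᵥ o) + 1 / 2 * (p * s) * (o ⨯₃ r) 2 ^ 2 + p * r 2)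
      (A * o 2) (A * (o ⬝ᵥ r)) (r 2) = s / 2 * (e₄ A p s ^ 2 - r 2 ^ 2) * (o ⨯₃ r) 2 ^ 2 := by
  have h1 := angular_identity (o := o) hr
  rw [e₄_sq hA hp hs, redPoly]
  field_simp
  linear_combination A * h1

theorem IsMotion.reduced_equation (hA : 0 < A) (hp : 0 < p) (hs : 0 < s) (hJ : IsOpen J)
    (hΦ : IsMotion A A p s J h l n Φ) (ht : t ∈ J) :
    redPoly A p h l n (axisPath Φ t 2)
      = s / 2 * (e₄ A p s ^ 2 - axisPath Φ t 2 ^ 2) * heightDeriv Φ t ^ 2 := by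
  obtain ⟨-, h1, h2, h3⟩ := (hΦ.curve.isMotion_iff hJ).1 hΦ t ht
  rw [← h1, ← h2, ← h3]
  exact ToyTop.reduced_equation hA hp hs (hΦ.curve.axisPath_dotProduct_self ht)

/-- Where `u' = u'' = 0`, the equation of motion shows that the derivative of `redPoly`
vanishes. -/
theorem IsMotion.deriv_redPoly_eq_zero (hp : 0 < p) (hJ : IsOpen J)
    (hΦ : IsMotion A A p s J h l n Φ) (ht : t ∈ J) (hv : heightDeriv Φ t = 0)
    (hv' : ((angPath Φ t ⨯₃ axisPath Φ t) ⨯₃ kvec) ⬝ᵥ angPath Φ t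
      + (axisPath Φ t ⨯₃ kvec) ⬝ᵥ deriv (angPath Φ) t = 0) :
    1 / p * (-2 * axisPath Φ t 2 * (h - 1 / (2 * A) * n ^ 2 - p * axisPath Φ t 2)
      - p * (1 - axisPath Φ t 2 ^ 2)) + 1 / (A * p) * n * (l - n * axisPath Φ t 2) = 0 := by
  obtain ⟨h0, h1, h2, h3⟩ := (hΦ.curve.isMotion_iff hJ).1 hΦ t ht
  have hd := hΦ.curve.hasDerivAt_momPath (A := A) (p := p) (s := s) hJ ht
  rw [hd.deriv, hv', momPath, dlPath, hv] at h0
  rw [hv] at h1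
  have hrr := hΦ.curve.axisPath_dotProduct_self ht
  generalize deriv (angPath Φ) t = o' at *
  have e : A • o' = -p • (axisPath Φ t ⨯₃ kvec) := by simpa using h0
  have e' : A * ((axisPath Φ t ⨯₃ kvec) ⬝ᵥ o')
      = -p * ((axisPath Φ t ⨯₃ kvec) ⬝ᵥ (axisPath Φ t ⨯₃ kvec)) := by
    rw [← smul_eq_mul, ← dotProduct_smul, e, dotProduct_smul, smul_eq_mul]
  have hK : A * (angPath Φ t 2 * (angPath Φ t ⬝ᵥ axisPath Φ t)
      - axisPath Φ t 2 * (angPath Φ t ⬝ᵥ angPath Φ t)) = p * (1 - axisPath Φ t 2 ^ 2) := by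
    generalize axisPath Φ t = r at *
    generalize angPath Φ t = o at *
    have h4 : ((o ⨯₃ r) ⨯₃ kvec) ⬝ᵥ o = o 2 * (o ⬝ᵥ r) - r 2 * (o ⬝ᵥ o) := by
      simp only [Matrix.vec3_dotProduct, cross_apply, kvec, Matrix.cons_val]
      ring
    have h5 : (r ⨯₃ kvec) ⬝ᵥ (r ⨯₃ kvec) = 1 - r 2 ^ 2 := by
      simp only [Matrix.vec3_dotProduct, cross_apply, kvec, Matrix.cons_val] at hrr ⊢
      linear_combination hrr
    rw [h4] at hv'
    rw [h5] at e'
    linear_combination A * hv' - e'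
  rw [← h1, ← h2, ← h3]
  field_simp
  linear_combination hK

/-- For a motion with non-constant `u`, the zeros of `u'` are negligible: where `u' = u'' = 0`, the
cubic polynomial has a double zero, and then `u` is constant. -/
theorem IsMotion.ae_heightDeriv_ne_zero (hA : 0 < A) (hp : 0 < p) (hs : 0 < s) (hJ : IsOpen J)
    (hJ' : J.OrdConnected) (hΦ : IsMotion A A p s J h l n Φ)
    (hu : ¬ ∃ c : ℝ, ∀ t ∈ J, height (Φ t) = c) :
    ∀ᵐ t, t ∈ J → heightDeriv Φ t ≠ 0 := by
  refine ae_ne_zero_of_deriv_ne_zero (fun t ht => hΦ.curve.hasDerivAt_heightDeriv hJ ht) ?_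
  intro t₀ ht₀ hv hv'
  refine hu ⟨axisPath Φ t₀ 2, fun t ht => ?_⟩
  have hf := hΦ.reduced_equation hA hp hs hJ ht₀
  have hf' := hΦ.deriv_redPoly_eq_zero hp hJ ht₀ hv hv'
  rw [hv] at hf
  set u₀ := axisPath Φ t₀ 2
  obtain ⟨e, he⟩ : ∃ e : ℝ, ∀ x, redPoly A p h l n x = (x - u₀) ^ 2 * (x - e) := by
    refine ⟨1 / p * (h - 1 / (2 * A) * n ^ 2) + 1 / (2 * A * p) * n ^ 2 - 2 * u₀, fun x => ?_⟩
    have hf0 : redPoly A p h l n u₀ = 0 := by rw [hf]; ring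
    have : redPoly A p h l n x = redPoly A p h l n u₀ + (x - u₀) *
        (1 / p * (-2 * u₀ * (h - 1 / (2 * A) * n ^ 2 - p * u₀) - p * (1 - u₀ ^ 2))
          + 1 / (A * p) * n * (l - n * u₀)) + (x - u₀) ^ 2 * (x -
        (1 / p * (h - 1 / (2 * A) * n ^ 2) + 1 / (2 * A * p) * n ^ 2 - 2 * u₀)) := by
      simp only [redPoly]
      field_simp
      ring
    rw [this, hf0, hf']
    ring
  have hK (x : ℝ) (hx : x ∈ J) : |heightDeriv Φ x|
      ≤ Real.sqrt (2 * p / A * (1 + |e|)) * |axisPath Φ x 2 - u₀| := by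
    have h1 := hΦ.reduced_equation hA hp hs hJ hx
    have hle := sq_le_one_of_unit (hΦ.curve.axisPath_dotProduct_self hx)
    rw [he, e₄_sq hA hp hs] at h1
    rw [← Real.sqrt_sq_eq_abs (axisPath Φ x 2 - u₀), ← Real.sqrt_mul (by positivity)]
    refine Real.abs_le_sqrt ?_
    set u := axisPath Φ x 2
    have h2 : u - e ≤ 1 + |e| := by
      have := neg_abs_le e
      nlinarith
    have h3 : A / (2 * p) * heightDeriv Φ x ^ 2 ≤ (u - u₀) ^ 2 * (1 + |e|) := by
      calc A / (2 * p) * heightDeriv Φ x ^ 2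
          ≤ A / (2 * p) * heightDeriv Φ x ^ 2 + s / 2 * (1 - u ^ 2) * heightDeriv Φ x ^ 2 := by
            have : 0 ≤ 1 - u ^ 2 := by linarith
            have : 0 ≤ s / 2 * (1 - u ^ 2) * heightDeriv Φ x ^ 2 := by positivity
            linarith
        _ = (u - u₀) ^ 2 * (u - e) := by rw [h1]; field_simp; ring
        _ ≤ _ := by gcongr
    calc heightDeriv Φ x ^ 2 = 2 * p / A * (A / (2 * p) * heightDeriv Φ x ^ 2) := by field_simp
      _ ≤ 2 * p / A * ((u - u₀) ^ 2 * (1 + |e|)) := by gcongr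
      _ = _ := by ring
  have := eq_zero_of_abs_deriv_le hJ' (f := fun x => axisPath Φ x 2 - u₀)
    (fun x hx => (hΦ.curve.hasDerivAt_axisPath_two hJ hx).sub_const u₀) hK ht₀ (sub_self _) ht
  rw [hΦ.curve.height_eq ht]
  linarith

end Curve

section Curve

variable {A p s h l n : ℝ} {J : Set ℝ} {Φ : ℝ → Mat} {t : ℝ}

/-! ### Logarithmic derivatives of the entries -/

theorem neg_wConst (A p s x : ℝ) : -wConst A p s x = wConst A p s (-x) := by
  simp [wConst]

/-- The square root of `R(u)` that corresponds to the motion, in terms of `u` and `u'`. -/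
noncomputable def liftVal (A p s u v : ℝ) : ℂ :=
  -Complex.I * Real.sqrt (s / 2) * ((u : ℂ) ^ 2 - (e₄ A p s : ℂ) ^ 2) * v

theorem sq_sub_e₄_sq_ne_zero (hA : 0 < A) (hp : 0 < p) (hs : 0 < s) {u : ℝ} (hu : u ^ 2 ≤ 1) :
    (u : ℂ) ^ 2 - (e₄ A p s : ℂ) ^ 2 ≠ 0 := by
  have := one_lt_e₄_sq hA hp hs
  have h : u ^ 2 - e₄ A p s ^ 2 ≠ 0 := by linarith
  exact_mod_cast h

theorem sqrt_ne_zero (hs : 0 < s) : (Real.sqrt (s / 2) : ℂ) ≠ 0 := by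
  have : Real.sqrt (s / 2) ≠ 0 := by positivity
  exact_mod_cast this

theorem liftVal_sq (hs : 0 < s) (u v : ℝ) : liftVal A p s u v ^ 2
    = -(s / 2) * ((u : ℂ) ^ 2 - (e₄ A p s : ℂ) ^ 2) ^ 2 * (v : ℂ) ^ 2 := by
  have h : (Real.sqrt (s / 2) : ℂ) ^ 2 = s / 2 := by
    rw [← Complex.ofReal_pow, Real.sq_sqrt (by positivity)]
    simp
  rw [liftVal]
  linear_combination (Complex.I ^ 2 * ((u : ℂ) ^ 2 - (e₄ A p s : ℂ) ^ 2) ^ 2 * (v : ℂ) ^ 2) * h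
    + ((s : ℂ) / 2 * ((u : ℂ) ^ 2 - (e₄ A p s : ℂ) ^ 2) ^ 2 * (v : ℂ) ^ 2) * Complex.I_sq

theorem timeDiff_liftVal (hA : 0 < A) (hp : 0 < p) (hs : 0 < s) {u v : ℝ} (hu : u ^ 2 ≤ 1)
    (hv : v ≠ 0) : timeDiff s (e₄ A p s) u (liftVal A p s u v) * v = 1 := by
  have h1 := sq_sub_e₄_sq_ne_zero hA hp hs hu
  have h2 := sqrt_ne_zero hs
  have h3 : (v : ℂ) ≠ 0 := by exact_mod_cast hv
  rw [timeDiff, liftVal]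
  field_simp [Complex.I_ne_zero]

theorem logDiff_liftVal (hA : 0 < A) (hp : 0 < p) (hs : 0 < s) {u v : ℝ} (hu : u ^ 2 ≤ 1)
    (hv : v ≠ 0) (ε : ℂ) (x : ℝ) :
    logDiff (e₄ A p s) ε (wConst A p s x) u (liftVal A p s u v) * v
      = (v + Complex.I * (x / A)) / (2 * (u - ε)) := by
  have h1 := sq_sub_e₄_sq_ne_zero hA hp hs hu
  have h2 := sqrt_ne_zero hs
  have h3 : (v : ℂ) ≠ 0 := by exact_mod_cast hv
  have h4 : (A : ℂ) ≠ 0 := by exact_mod_cast hA.ne'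
  have h5 : 1 - (e₄ A p s : ℂ) ^ 2 ≠ 0 := by
    simpa using sq_sub_e₄_sq_ne_zero hA hp hs (u := 1) (by norm_num)
  have hw : liftVal A p s u v ≠ 0 := by
    rw [liftVal]
    exact mul_ne_zero (mul_ne_zero (mul_ne_zero (neg_ne_zero.2 Complex.I_ne_zero) h2) h1) h3
  have h6 : ((u : ℂ) ^ 2 - (e₄ A p s : ℂ) ^ 2) / (1 - (e₄ A p s : ℂ) ^ 2) * wConst A p s x * v
      = Complex.I * (x / A) * liftVal A p s u v := by
    rw [wConst, liftVal]
    field_simp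
    linear_combination (x : ℂ) * Complex.I_sq
  rw [logDiff]
  calc 1 / (2 * ((u : ℂ) - ε)) * (liftVal A p s u v
        + ((u : ℂ) ^ 2 - (e₄ A p s : ℂ) ^ 2) / (1 - (e₄ A p s : ℂ) ^ 2) * wConst A p s x)
        / liftVal A p s u v * v
      = (liftVal A p s u v * v
        + ((u : ℂ) ^ 2 - (e₄ A p s : ℂ) ^ 2) / (1 - (e₄ A p s : ℂ) ^ 2) * wConst A p s x * v)
        / liftVal A p s u v / (2 * (u - ε)) := by ring
    _ = _ := by
      rw [h6, ← mul_comm (v : ℂ), ← add_mul, mul_div_assoc, div_self hw, mul_one]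

/-- The logarithmic derivative of an entry of `Φ`; `ε = ∓ 1` is the height where it vanishes. -/
noncomputable def logDer (A : ℝ) (Φ : ℝ → Mat) (ε : ℂ) (x t : ℝ) : ℂ :=
  (heightDeriv Φ t + Complex.I * (x / A)) / (2 * (axisPath Φ t 2 - ε))

open MeasureTheory in
/-- If the path of `u` is lifted by `liftVal`, then logarithmic integrals are solutions of linear
differential equations. -/
theorem IsCurve.isLogIntegral_iff (hA : 0 < A) (hp : 0 < p) (hs : 0 < s) (hJ : IsOpen J)
    (hJ' : J.OrdConnected) (hΦ : IsCurve J Φ) {w y : ℝ → ℂ}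
    (hw : ∀ t ∈ J, w t = liftVal A p s (axisPath Φ t 2) (heightDeriv Φ t))
    (hv : ∀ᵐ t, t ∈ J → heightDeriv Φ t ≠ 0) (hy : ContinuousOn y J) {ε : ℂ}
    (hε : ∀ t ∈ J, y t ≠ 0 → (axisPath Φ t 2 : ℂ) ≠ ε) (x : ℝ) :
    IsLogIntegral J (logDiff (e₄ A p s) ε (wConst A p s x)) (fun t => height (Φ t)) w y ↔
      ∀ t ∈ J, y t ≠ 0 → HasDerivAt y (y t * logDer A Φ ε x t) t := by
  set O := J ∩ y ⁻¹' {0}ᶜ with hOdef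
  have hO : IsOpen O := hy.isOpen_inter_preimage hJ isOpen_compl_singleton
  have hcast {f : ℝ → ℝ} (hf : ContinuousOn f J) : ContinuousOn (fun t => (f t : ℂ)) O :=
    Complex.continuous_ofReal.comp_continuousOn (hf.mono Set.inter_subset_left)
  have hg : ContinuousOn (logDer A Φ ε x) O := by
    refine ContinuousOn.div ((hcast (hΦ.continuousOn_heightDeriv hJ)).add continuousOn_const)
      (continuousOn_const.mul ((hcast (continuousOn_pi.1 hΦ.continuousOn_axisPath 2)).sub
        continuousOn_const)) fun t ht => ?_
    exact mul_ne_zero two_ne_zero (sub_ne_zero.2 (hε t ht.1 ht.2))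
  have hae : ∀ᵐ t, t ∈ J → logDiff (e₄ A p s) ε (wConst A p s x) (height (Φ t)) (w t)
      * deriv (fun t => height (Φ t)) t = logDer A Φ ε x t := by
    filter_upwards [hv] with t ht htJ
    rw [hw t htJ, hΦ.deriv_height hJ htJ, hΦ.height_eq htJ,
      logDiff_liftVal hA hp hs (sq_le_one_of_unit (hΦ.axisPath_dotProduct_self htJ)) (ht htJ)]
    rfl
  have hint (a b : ℝ) (hab : Set.uIcc a b ⊆ O) :
      ∫ t in a..b, logDiff (e₄ A p s) ε (wConst A p s x) (height (Φ t)) (w t)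
        * deriv (fun t => height (Φ t)) t = ∫ t in a..b, logDer A Φ ε x t := by
    refine intervalIntegral.integral_congr_ae ?_
    filter_upwards [hae] with t ht htI
    exact ht (hab (Set.uIoc_subset_uIcc htI)).1
  constructor
  · intro H t ht hyt
    refine hasDerivAt_of_eq_mul_exp_integral hO hg (fun a b hab => ?_) ⟨ht, hyt⟩
    rw [← hint a b hab]
    exact (H a (hab Set.left_mem_uIcc).1 b (hab Set.right_mem_uIcc).1
      fun t ht => (hab ht).2).2
  · intro H a ha b hb hab
    have hsub : Set.uIcc a b ⊆ O := fun t ht => ⟨hJ'.uIcc_subset ha hb ht, hab t ht⟩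
    refine ⟨?_, ?_⟩
    · refine (hg.mono hsub).intervalIntegrable.congr_ae ?_
      rw [Filter.EventuallyEq, ae_restrict_iff' measurableSet_uIoc]
      filter_upwards [hae] with t ht htI
      exact (ht (hsub (Set.uIoc_subset_uIcc htI)).1).symm
    · rw [hint a b hsub]
      exact eq_mul_exp_integral hO (fun t ht => H t ht.1 ht.2) hg hsub

theorem IsCurve.axisPath_ne_of_entry_ne_zero (hΦ : IsCurve J Φ) (ht : t ∈ J) :
    (Φ t 0 0 ≠ 0 ↔ (axisPath Φ t 2 : ℂ) ≠ -1) ∧ (Φ t 0 1 ≠ 0 ↔ (axisPath Φ t 2 : ℂ) ≠ 1) := by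
  obtain ⟨h0, h1⟩ := hΦ.normSq_eq ht
  have e : (-1 : ℂ) = ((-1 : ℝ) : ℂ) := by simp
  have e' : (1 : ℂ) = ((1 : ℝ) : ℂ) := by simp
  constructor
  · rw [e, Ne, Ne, Complex.ofReal_inj, ← Complex.normSq_eq_zero, h0, not_iff_not]
    constructor <;> intro h <;> linarith
  · rw [e', Ne, Ne, Complex.ofReal_inj, ← Complex.normSq_eq_zero, h1, not_iff_not]
    constructor <;> intro h <;> linarith

theorem mul_star_self_ofReal (z : ℂ) : z * star z = Complex.normSq z := by
  rw [RCLike.star_def, Complex.mul_conj]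

/-- The differential equation of `α` expresses `⟨ω, k + r⟩`. -/
theorem IsCurve.hasDerivAt_alpha_iff (hA : 0 < A) (hJ : IsOpen J) (hΦ : IsCurve J Φ) (ht : t ∈ J)
    (h0 : Φ t 0 0 ≠ 0) (x : ℝ) :
    HasDerivAt (fun t => Φ t 0 0) (Φ t 0 0 * logDer A Φ (-1) x t) t ↔
      A * (angPath Φ t 2 + angPath Φ t ⬝ᵥ axisPath Φ t) = x := by
  have hd := hΦ.hasDerivAt_entry hJ ht 0 0
  have hu : (axisPath Φ t 2 : ℂ) - -1 ≠ 0 :=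
    sub_ne_zero.2 ((hΦ.axisPath_ne_of_entry_ne_zero ht).1.1 h0)
  have hA' : (A : ℂ) ≠ 0 := by exact_mod_cast hA.ne'
  have e1 := (hΦ.deriv_mul_star hJ ht).1
  have e2 := mul_star_self_ofReal (Φ t 0 0)
  rw [(hΦ.normSq_eq ht).1] at e2
  have e3 : Φ t 0 0 * logDer A Φ (-1) x t * star (Φ t 0 0)
      = (heightDeriv Φ t + Complex.I * (x / A)) / 4 := by
    rw [mul_right_comm, e2, logDer]
    push_cast
    field_simp
    ring
  have hst : star (Φ t 0 0) ≠ 0 := star_ne_zero.2 h0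
  have h1 : HasDerivAt (fun t => Φ t 0 0) (Φ t 0 0 * logDer A Φ (-1) x t) t ↔
      deriv (fun t => Φ t 0 0) t = Φ t 0 0 * logDer A Φ (-1) x t :=
    ⟨fun h => hd.unique h, fun h => h ▸ hd⟩
  rw [h1, ← mul_left_inj' hst, e3, e1, heightDeriv]
  constructor
  · intro h
    have := mul_left_cancel₀ Complex.I_ne_zero (add_left_cancel ((div_left_inj' (by norm_num)).1 h))
    rw [eq_div_iff hA', mul_comm] at this
    exact_mod_cast this
  · rintro rfl
    push_cast
    field_simp

/-- The differential equation of `β` expresses `⟨ω, k - r⟩`. -/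
theorem IsCurve.hasDerivAt_beta_iff (hA : 0 < A) (hJ : IsOpen J) (hΦ : IsCurve J Φ) (ht : t ∈ J)
    (h0 : Φ t 0 1 ≠ 0) (x : ℝ) :
    HasDerivAt (fun t => Φ t 0 1) (Φ t 0 1 * logDer A Φ 1 (-x) t) t ↔
      A * (angPath Φ t 2 - angPath Φ t ⬝ᵥ axisPath Φ t) = x := by
  have hd := hΦ.hasDerivAt_entry hJ ht 0 1
  have hu : (axisPath Φ t 2 : ℂ) - 1 ≠ 0 :=
    sub_ne_zero.2 ((hΦ.axisPath_ne_of_entry_ne_zero ht).2.1 h0)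
  have hA' : (A : ℂ) ≠ 0 := by exact_mod_cast hA.ne'
  have e1 := (hΦ.deriv_mul_star hJ ht).2
  have e2 := mul_star_self_ofReal (Φ t 0 1)
  rw [(hΦ.normSq_eq ht).2] at e2
  have e3 : Φ t 0 1 * logDer A Φ 1 (-x) t * star (Φ t 0 1)
      = (-heightDeriv Φ t + Complex.I * (x / A)) / 4 := by
    rw [mul_right_comm, e2, logDer]
    push_cast
    field_simp
    ring
  have hst : star (Φ t 0 1) ≠ 0 := star_ne_zero.2 h0
  have h1 : HasDerivAt (fun t => Φ t 0 1) (Φ t 0 1 * logDer A Φ 1 (-x) t) t ↔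
      deriv (fun t => Φ t 0 1) t = Φ t 0 1 * logDer A Φ 1 (-x) t :=
    ⟨fun h => hd.unique h, fun h => h ▸ hd⟩
  rw [h1, ← mul_left_inj' hst, e3, e1, heightDeriv]
  constructor
  · intro h
    have := mul_left_cancel₀ Complex.I_ne_zero (add_left_cancel ((div_left_inj' (by norm_num)).1 h))
    rw [eq_div_iff hA', mul_comm] at this
    exact_mod_cast this
  · rintro rfl
    push_cast
    field_simp

theorem star_logDer (A : ℝ) (Φ : ℝ → Mat) {ε : ℂ} (hε : star ε = ε) (x t : ℝ) :
    star (logDer A Φ ε x t) = logDer A Φ ε (-x) t := by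
  rw [RCLike.star_def] at hε
  simp [logDer, hε, neg_div]

theorem IsCurve.second_row_eq (hΦ : IsCurve J Φ) (ht : t ∈ J) :
    Φ t 1 0 = -star (Φ t 0 1) ∧ Φ t 1 1 = star (Φ t 0 0) :=
  ⟨congrFun (congrFun (eq_of_mem_su_two (hΦ.mem t ht)).1 1) 0,
    congrFun (congrFun (eq_of_mem_su_two (hΦ.mem t ht)).1 1) 1⟩

/-- The second row of `Φ` is the conjugate of the first one, so its differential equations are the
conjugate ones. -/
theorem IsCurve.hasDerivAt_second_row (hJ : IsOpen J) (hΦ : IsCurve J Φ) (ht : t ∈ J)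
    {ε : ℂ} (hε : star ε = ε) {x : ℝ} :
    (HasDerivAt (fun t => Φ t 0 0) (Φ t 0 0 * logDer A Φ ε x t) t →
      HasDerivAt (fun t => Φ t 1 1) (Φ t 1 1 * logDer A Φ ε (-x) t) t) ∧
    (HasDerivAt (fun t => Φ t 0 1) (Φ t 0 1 * logDer A Φ ε x t) t →
      HasDerivAt (fun t => Φ t 1 0) (Φ t 1 0 * logDer A Φ ε (-x) t) t) := by
  have e10 (x : ℝ) (hx : x ∈ J) := (hΦ.second_row_eq hx).1
  have e11 (x : ℝ) (hx : x ∈ J) := (hΦ.second_row_eq hx).2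
  constructor
  · intro H
    refine (H.star.congr_of_eventuallyEq ?_).congr_deriv ?_
    · filter_upwards [hJ.mem_nhds ht] with x hx using e11 x hx
    · rw [star_mul', star_logDer A Φ hε, e11 t ht]
  · intro H
    refine (H.star.neg.congr_of_eventuallyEq ?_).congr_deriv ?_
    · filter_upwards [hJ.mem_nhds ht] with x hx using e10 x hx
    · rw [star_mul', star_logDer A Φ hε, e10 t ht, neg_mul]

end Curve

section Curve

variable {A p s h l n : ℝ} {J : Set ℝ} {Φ : ℝ → Mat} {t : ℝ}

/-- For a lift of the path of `u` by `liftVal`, the logarithmic integrals of the entries of `Φ`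
amount to the conservation of the vertical and the axial momentum. -/
theorem IsCurve.isLogIntegral_entries_iff (hA : 0 < A) (hp : 0 < p) (hs : 0 < s) (hJ : IsOpen J)
    (hJ' : J.OrdConnected) (hΦ : IsCurve J Φ) {w : ℝ → ℂ}
    (hw : ∀ t ∈ J, w t = liftVal A p s (axisPath Φ t 2) (heightDeriv Φ t))
    (hv : ∀ᵐ t, t ∈ J → heightDeriv Φ t ≠ 0) :
    (IsLogIntegral J (dlogα (e₄ A p s) (wConst A p s (l + n))) (fun t => height (Φ t)) w
        (fun t => Φ t 0 0) ∧
      IsLogIntegral J (dlogβ (e₄ A p s) (wConst A p s (l - n))) (fun t => height (Φ t)) w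
        (fun t => Φ t 0 1) ∧
      IsLogIntegral J (dlogγ (e₄ A p s) (wConst A p s (l - n))) (fun t => height (Φ t)) w
        (fun t => Φ t 1 0) ∧
      IsLogIntegral J (dlogδ (e₄ A p s) (wConst A p s (l + n))) (fun t => height (Φ t)) w
        (fun t => Φ t 1 1)) ↔
    ∀ t ∈ J, A * angPath Φ t 2 = l ∧ A * (angPath Φ t ⬝ᵥ axisPath Φ t) = n := by
  have hcont (i j : Fin 2) : ContinuousOn (fun t => Φ t i j) J := (hΦ.smooth i j).continuousOn
  have hα := hΦ.isLogIntegral_iff hA hp hs hJ hJ' hw hv (hcont 0 0)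
    (fun t ht => (hΦ.axisPath_ne_of_entry_ne_zero ht).1.1) (l + n)
  have hβ := hΦ.isLogIntegral_iff hA hp hs hJ hJ' hw hv (hcont 0 1)
    (fun t ht => (hΦ.axisPath_ne_of_entry_ne_zero ht).2.1) (-(l - n))
  have hγ := hΦ.isLogIntegral_iff hA hp hs hJ hJ' hw hv (hcont 1 0)
    (fun t ht h => (hΦ.axisPath_ne_of_entry_ne_zero ht).2.1
      fun h0 => h (by rw [(hΦ.second_row_eq ht).1, h0]; simp)) (l - n)
  have hδ := hΦ.isLogIntegral_iff hA hp hs hJ hJ' hw hv (hcont 1 1)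
    (fun t ht h => (hΦ.axisPath_ne_of_entry_ne_zero ht).1.1
      fun h0 => h (by rw [(hΦ.second_row_eq ht).2, h0]; simp)) (-(l + n))
  rw [← neg_wConst] at hβ hδ
  simp only [dlogα, dlogβ, dlogγ, dlogδ]
  rw [hα, hβ, hγ, hδ]
  constructor
  · rintro ⟨H0, H1, -, -⟩
    have hae : ∀ᵐ t, t ∈ J → A * angPath Φ t 2 = l ∧ A * (angPath Φ t ⬝ᵥ axisPath Φ t) = n := by
      filter_upwards [hv] with t ht htJ
      have hne : axisPath Φ t 2 ^ 2 ≠ 1 := by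
        intro h
        obtain ⟨h0, h1⟩ := eq_zero_of_sq_eq_one (hΦ.axisPath_dotProduct_self htJ) h
        refine ht htJ ?_
        simp [heightDeriv, cross_apply, h0, h1]
      obtain ⟨i0, i1⟩ := hΦ.axisPath_ne_of_entry_ne_zero htJ
      have a0 : Φ t 0 0 ≠ 0 := i0.2 fun h => hne (by
        have : axisPath Φ t 2 = -1 := by exact_mod_cast h
        rw [this]; norm_num)
      have b0 : Φ t 0 1 ≠ 0 := i1.2 fun h => hne (by
        have : axisPath Φ t 2 = 1 := by exact_mod_cast h
        rw [this]; norm_num)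
      have e0 := (hΦ.hasDerivAt_alpha_iff hA hJ htJ a0 (l + n)).1 (H0 t htJ a0)
      have e1 := (hΦ.hasDerivAt_beta_iff hA hJ htJ b0 (l - n)).1 (H1 t htJ b0)
      constructor <;> linarith
    have hom := hΦ.continuousOn_angPath hJ
    have h1 := MeasureTheory.Measure.eqOn_open_of_ae_eq (μ := MeasureTheory.volume) (U := J)
      (f := fun t => A * angPath Φ t 2) (g := fun _ => l) (by
        rw [Filter.EventuallyEq, MeasureTheory.ae_restrict_iff' hJ.measurableSet]
        filter_upwards [hae] with t ht htJ using (ht htJ).1) hJ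
      (continuousOn_const.mul (continuousOn_pi.1 hom 2)) continuousOn_const
    have h2 := MeasureTheory.Measure.eqOn_open_of_ae_eq (μ := MeasureTheory.volume) (U := J)
      (f := fun t => A * (angPath Φ t ⬝ᵥ axisPath Φ t)) (g := fun _ => n) (by
        rw [Filter.EventuallyEq, MeasureTheory.ae_restrict_iff' hJ.measurableSet]
        filter_upwards [hae] with t ht htJ using (ht htJ).2) hJ
      (continuousOn_const.mul (continuousOn_dotProduct hom hΦ.continuousOn_axisPath))
      continuousOn_const
    exact fun t ht => ⟨h1 ht, h2 ht⟩
  · intro H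
    have Ha (t : ℝ) (ht : t ∈ J) (h0 : Φ t 0 0 ≠ 0) :=
      (hΦ.hasDerivAt_alpha_iff hA hJ ht h0 (l + n)).2 (by linarith [(H t ht).1, (H t ht).2])
    have Hb (t : ℝ) (ht : t ∈ J) (h0 : Φ t 0 1 ≠ 0) :=
      (hΦ.hasDerivAt_beta_iff hA hJ ht h0 (l - n)).2 (by linarith [(H t ht).1, (H t ht).2])
    refine ⟨Ha, Hb, fun t ht h0 => ?_, fun t ht h0 => ?_⟩
    · have := (hΦ.hasDerivAt_second_row hJ ht (by simp)).2 (Hb t ht fun h => h0 (by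
        rw [(hΦ.second_row_eq ht).1, h]; simp))
      rwa [neg_neg] at this
    · exact (hΦ.hasDerivAt_second_row hJ ht (by simp)).1 (Ha t ht fun h => h0 (by
        rw [(hΦ.second_row_eq ht).2, h]; simp))

/-- Motions with non-constant `u` are given by the integrals. -/
theorem IsMotion.givenByIntegrals {e₁ e₂ e₃ : ℝ} (hA : 0 < A) (hp : 0 < p) (hs : 0 < s)
    (hJ : IsOpen J) (hJ' : J.OrdConnected) (hd : IsDynConst A A p h l n e₁ e₂ e₃)
    (hΦ : IsMotion A A p s J h l n Φ) (hu : ¬ ∃ c : ℝ, ∀ t ∈ J, height (Φ t) = c) :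
    GivenByIntegrals s e₁ e₂ e₃ (e₄ A p s) (wConst A p s (l - n)) (wConst A p s (l + n)) J Φ := by
  have hv := hΦ.ae_heightDeriv_ne_zero hA hp hs hJ hJ' hu
  have hc := hΦ.curve
  have hcast {f : ℝ → ℝ} (hf : ContinuousOn f J) : ContinuousOn (fun t => (f t : ℂ)) J :=
    Complex.continuous_ofReal.comp_continuousOn hf
  have hlog := (hc.isLogIntegral_entries_iff hA hp hs hJ hJ' (l := l) (n := n)
    (w := fun t => liftVal A p s (axisPath Φ t 2) (heightDeriv Φ t)) (fun _ _ => rfl) hv).2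
    fun t ht => ((hc.isMotion_iff hJ).1 hΦ t ht).2.2
  refine ⟨fun t => liftVal A p s (axisPath Φ t 2) (heightDeriv Φ t), ?_, fun t ht => ?_, ?_, hlog⟩
  · exact (continuousOn_const.mul (((hcast (continuousOn_pi.1 hc.continuousOn_axisPath 2)).pow
      2).sub continuousOn_const)).mul (hcast (hc.continuousOn_heightDeriv hJ))
  · have h1 := hΦ.reduced_equation hA hp hs hJ ht
    rw [redPoly, hd.factor] at h1
    have h2 := congrArg (fun x : ℝ => (x : ℂ)) h1
    push_cast at h2
    rw [liftVal_sq hs, R, hc.height_eq ht]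
    linear_combination (-((axisPath Φ t 2 : ℂ) ^ 2 - (e₄ A p s : ℂ) ^ 2)) * h2
  · intro a ha b hb
    have hae : ∀ᵐ t, t ∈ Set.uIoc a b → (1 : ℂ) = timeDiff s (e₄ A p s) (height (Φ t))
        (liftVal A p s (axisPath Φ t 2) (heightDeriv Φ t))
        * deriv (fun t => height (Φ t)) t := by
      filter_upwards [hv] with t ht htI
      have htJ : t ∈ J := hJ'.uIcc_subset ha hb (Set.uIoc_subset_uIcc htI)
      rw [hc.deriv_height hJ htJ, hc.height_eq htJ, timeDiff_liftVal hA hp hs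
        (sq_le_one_of_unit (hc.axisPath_dotProduct_self htJ)) (ht htJ)]
    refine ⟨(intervalIntegrable_const (c := (1 : ℂ))).congr_ae ?_, ?_⟩
    · rw [Filter.EventuallyEq, MeasureTheory.ae_restrict_iff' measurableSet_uIoc]
      exact hae
    · rw [← intervalIntegral.integral_congr_ae hae]
      simp

/-! ### From integrals to motions -/

/-- By the Jacobi identity, the equation of motion of the spherical top reads
`A ω' + p (s u'' + 1) [r, k] = 0`. -/
theorem IsCurve.equation_iff (hJ : IsOpen J) (hΦ : IsCurve J Φ) (ht : t ∈ J) :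
    deriv (momPath A p s Φ) t = angPath Φ t ⨯₃ momPath A p s Φ t + dlPath p s Φ t ↔
      A • deriv (angPath Φ) t
        + (p * (s * deriv (heightDeriv Φ) t + 1)) • (axisPath Φ t ⨯₃ kvec) = 0 := by
  rw [(hΦ.hasDerivAt_momPath hJ ht).deriv, ← (hΦ.hasDerivAt_heightDeriv hJ ht).deriv, ← sub_eq_zero,
    momPath, dlPath]
  generalize deriv (heightDeriv Φ) t = v'
  generalize deriv (angPath Φ) t = o'
  generalize angPath Φ t = o
  generalize axisPath Φ t = r
  generalize heightDeriv Φ t = v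
  refine iff_of_eq (congrArg (· = 0) ?_)
  ext i
  fin_cases i <;>
    simp only [cross_apply, Pi.add_apply, Pi.sub_apply, Pi.smul_apply, smul_eq_mul] <;>
    simp [kvec] <;> ring

/-- If the first integrals are constant, then the equation of motion holds where `u' ≠ 0`. -/
theorem IsCurve.equation_of_integrals (hJ : IsOpen J) (hΦ : IsCurve J Φ)
    (H : ∀ t ∈ J, 1 / 2 * A * (angPath Φ t ⬝ᵥ angPath Φ t)
        + 1 / 2 * (p * s) * heightDeriv Φ t ^ 2 + p * axisPath Φ t 2 = h ∧
      A * angPath Φ t 2 = l ∧ A * (angPath Φ t ⬝ᵥ axisPath Φ t) = n)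
    (ht : t ∈ J) (hv : heightDeriv Φ t ≠ 0) :
    A • deriv (angPath Φ) t
      + (p * (s * deriv (heightDeriv Φ) t + 1)) • (axisPath Φ t ⨯₃ kvec) = 0 := by
  have ho := hΦ.hasDerivAt_angPath hJ ht
  have hr := hΦ.hasDerivAt_axisPath hJ ht
  have hu := hΦ.hasDerivAt_axisPath_two hJ ht
  have hvd := (hΦ.hasDerivAt_heightDeriv hJ ht).differentiableAt.hasDerivAt
  have const {f : ℝ → ℝ} {f' c : ℝ} (hf : HasDerivAt f f' t) (hc : ∀ x ∈ J, f x = c) : f' = 0 :=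
    hf.unique ((hasDerivAt_const t c).congr_of_eventuallyEq
      (by filter_upwards [hJ.mem_nhds ht] with x hx using hc x hx))
  have e1 := const ((((hasDerivAt_dotProduct ho ho).const_mul (1 / 2 * A)).add
    ((hvd.pow 2).const_mul (1 / 2 * (p * s)))).add (hu.const_mul p)) fun x hx => (H x hx).1
  have e2 := const ((hasDerivAt_pi.1 ho 2).const_mul A) fun x hx => (H x hx).2.1
  have e3 := const ((hasDerivAt_dotProduct ho hr).const_mul A) fun x hx => (H x hx).2.2
  have e4 : heightDeriv Φ t = (angPath Φ t ⨯₃ axisPath Φ t) 2 := rfl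
  generalize deriv (heightDeriv Φ) t = v' at *
  generalize deriv (angPath Φ) t = o' at *
  generalize heightDeriv Φ t = v at *
  generalize angPath Φ t = o at *
  generalize axisPath Φ t = r at *
  simp only [Matrix.vec3_dotProduct, cross_apply, Matrix.cons_val] at e1 e3 e4
  -- the left hand side is orthogonal to `k`, `r` and `ω`, whose triple product is `± u'`
  set E : Fin 3 → ℝ := A • o' + (p * (s * v' + 1)) • (r ⨯₃ kvec) with hE
  have E0 : E 0 = A * o' 0 + p * (s * v' + 1) * r 1 := by
    simp only [hE, Pi.add_apply, Pi.smul_apply, smul_eq_mul]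
    simp [cross_apply, kvec]
  have E1 : E 1 = A * o' 1 - p * (s * v' + 1) * r 0 := by
    simp only [hE, Pi.add_apply, Pi.smul_apply, smul_eq_mul]
    simp [cross_apply, kvec]
    ring
  have E2 : E 2 = 0 := by
    rw [← e2]
    simp only [hE, Pi.add_apply, Pi.smul_apply, smul_eq_mul]
    simp [cross_apply, kvec]
  have f1 : E 0 * r 0 + E 1 * r 1 = 0 := by
    rw [E0, E1]
    linear_combination e3 - r 2 * e2
  have f2 : E 0 * o 0 + E 1 * o 1 = 0 := by
    rw [E0, E1]
    simp at e1
    linear_combination e1 - o 2 * e2 - p * (s * v' + 1) * e4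
  have g0 : v * E 0 = 0 := by
    rw [e4]; linear_combination r 1 * f2 - o 1 * f1
  have g1 : v * E 1 = 0 := by
    rw [e4]; linear_combination -r 0 * f2 + o 0 * f1
  ext i
  fin_cases i
  · exact (mul_eq_zero.1 g0).resolve_left hv
  · exact (mul_eq_zero.1 g1).resolve_left hv
  · exact E2

open MeasureTheory in
/-- A curve given by the integrals is a motion with non-constant `u`. -/
theorem IsCurve.isMotion_of_givenByIntegrals {e₁ e₂ e₃ : ℝ} (hA : 0 < A) (hp : 0 < p) (hs : 0 < s)
    (hJ : IsOpen J) (hJ' : J.OrdConnected) (hne : J.Nonempty) (hΦ : IsCurve J Φ)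
    (hd : IsDynConst A A p h l n e₁ e₂ e₃)
    (hG : GivenByIntegrals s e₁ e₂ e₃ (e₄ A p s) (wConst A p s (l - n)) (wConst A p s (l + n))
      J Φ) :
    IsMotion A A p s J h l n Φ ∧ ¬ ∃ c : ℝ, ∀ t ∈ J, height (Φ t) = c := by
  obtain ⟨w, hwc, hwR, htime, hlog⟩ := hG
  have hcast {f : ℝ → ℝ} (hf : ContinuousOn f J) : ContinuousOn (fun t => (f t : ℂ)) J :=
    Complex.continuous_ofReal.comp_continuousOn hf
  have hle (t : ℝ) (ht : t ∈ J) := sq_le_one_of_unit (hΦ.axisPath_dotProduct_self ht)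
  have hae1 := ae_eq_one_of_integral hJ htime
  have hae : ∀ᵐ t, t ∈ J → heightDeriv Φ t ≠ 0 ∧
      w t = liftVal A p s (axisPath Φ t 2) (heightDeriv Φ t) := by
    filter_upwards [hae1] with t ht htJ
    have h1 := ht htJ
    rw [hΦ.deriv_height hJ htJ, hΦ.height_eq htJ, timeDiff] at h1
    have hv0 : heightDeriv Φ t ≠ 0 := by
      intro h0; rw [h0] at h1; simp at h1
    have hw0 : w t ≠ 0 := by
      intro h0; rw [h0] at h1; simp at h1
    refine ⟨hv0, ?_⟩
    rw [div_mul_eq_mul_div, div_eq_iff hw0, one_mul] at h1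
    exact h1.symm
  have hv : ∀ᵐ t, t ∈ J → heightDeriv Φ t ≠ 0 := hae.mono fun t ht htJ => (ht htJ).1
  have extend {X : Type} [TopologicalSpace X] [T2Space X] {f g : ℝ → X}
      (hf : ContinuousOn f J) (hg : ContinuousOn g J)
      (hfg : ∀ᵐ t, t ∈ J → f t = g t) : ∀ t ∈ J, f t = g t :=
    Measure.eqOn_open_of_ae_eq (μ := volume)
      (by rwa [Filter.EventuallyEq, ae_restrict_iff' hJ.measurableSet]) hJ hf hg
  have hoc := hΦ.continuousOn_angPath hJ
  have hrc := hΦ.continuousOn_axisPath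
  have hr2c := continuousOn_pi.1 hrc 2
  have hvc := hΦ.continuousOn_heightDeriv hJ
  have hw : ∀ t ∈ J, w t = liftVal A p s (axisPath Φ t 2) (heightDeriv Φ t) :=
    extend hwc ((continuousOn_const.mul (((hcast hr2c).pow 2).sub continuousOn_const)).mul
      (hcast hvc)) (hae.mono fun t ht htJ => (ht htJ).2)
  have hln := (hΦ.isLogIntegral_entries_iff hA hp hs hJ hJ' hw hv).1 hlog
  have hen : ∀ t ∈ J, 1 / 2 * A * (angPath Φ t ⬝ᵥ angPath Φ t)
      + 1 / 2 * (p * s) * heightDeriv Φ t ^ 2 + p * axisPath Φ t 2 = h := by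
    refine extend (((continuousOn_const.mul (continuousOn_dotProduct hoc hoc)).add
      (continuousOn_const.mul (hvc.pow 2))).add (continuousOn_const.mul hr2c))
      continuousOn_const ?_
    filter_upwards [hv] with t ht htJ
    have h1 := hwR t htJ
    rw [hw t htJ, liftVal_sq hs, R, hΦ.height_eq htJ] at h1
    have hX := sq_sub_e₄_sq_ne_zero hA hp hs (hle t htJ)
    have h2 : ((axisPath Φ t 2 - e₁) * (axisPath Φ t 2 - e₂) * (axisPath Φ t 2 - e₃) : ℂ)
        = s / 2 * ((e₄ A p s : ℂ) ^ 2 - (axisPath Φ t 2 : ℂ) ^ 2) * (heightDeriv Φ t : ℂ) ^ 2 := by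
      refine mul_right_cancel₀ hX ?_
      rw [← h1]; ring
    have h3 : (axisPath Φ t 2 - e₁) * (axisPath Φ t 2 - e₂) * (axisPath Φ t 2 - e₃)
        = s / 2 * (e₄ A p s ^ 2 - axisPath Φ t 2 ^ 2) * heightDeriv Φ t ^ 2 := by
      exact_mod_cast h2
    have h4 := ToyTop.reduced_equation hA hp hs (o := angPath Φ t)
      (hΦ.axisPath_dotProduct_self htJ)
    rw [(hln t htJ).1, (hln t htJ).2] at h4
    have h5 := h4.trans (h3.symm.trans (hd.factor _).symm)
    have hne : 1 - axisPath Φ t 2 ^ 2 ≠ 0 := by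
      intro h
      obtain ⟨h0, h1⟩ := eq_zero_of_sq_eq_one (hΦ.axisPath_dotProduct_self htJ)
        (by linarith)
      refine ht htJ ?_
      simp [heightDeriv, cross_apply, h0, h1]
    rw [redPoly, sub_left_inj] at h5
    have h6 := mul_left_cancel₀ (mul_ne_zero (one_div_ne_zero hp.ne') hne) h5
    rw [heightDeriv]
    linarith
  have H (t : ℝ) (ht : t ∈ J) := And.intro (hen t ht) (hln t ht)
  refine ⟨(hΦ.isMotion_iff hJ).2 fun t ht => ⟨?_, H t ht⟩, ?_⟩
  · refine (hΦ.equation_iff hJ ht).2 ?_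
    have hdo : ContinuousOn (deriv (angPath Φ)) J :=
      (hΦ.contDiffOn_angPath hJ).continuousOn_deriv_of_isOpen hJ le_rfl
    have hqc : ContinuousOn (fun t => axisPath Φ t ⨯₃ kvec) J :=
      continuousOn_cross hrc continuousOn_const
    have hdv : ContinuousOn (deriv (heightDeriv Φ)) J := by
      refine ((continuousOn_dotProduct (continuousOn_cross (g := fun _ => kvec)
        (continuousOn_cross hoc hrc) continuousOn_const) hoc).add (continuousOn_dotProduct hqc hdo)).congr fun t ht => ?_
      exact (hΦ.hasDerivAt_heightDeriv hJ ht).deriv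
    refine extend (f := fun t => A • deriv (angPath Φ) t
        + (p * (s * deriv (heightDeriv Φ) t + 1)) • (axisPath Φ t ⨯₃ kvec)) (g := fun _ => 0)
      ((hdo.const_smul A).add ((continuousOn_const.mul
        ((continuousOn_const.mul hdv).add continuousOn_const)).smul hqc)) continuousOn_const ?_ t ht
    filter_upwards [hv] with t ht htJ using hΦ.equation_of_integrals hJ H htJ (ht htJ)
  · rintro ⟨c, hc⟩
    obtain ⟨t₀, ht₀⟩ := hne
    have h0 : ∀ t ∈ J, heightDeriv Φ t = 0 := fun t ht => by
      rw [← hΦ.deriv_height hJ ht]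
      refine ((hasDerivAt_const t c).congr_of_eventuallyEq ?_).deriv
      filter_upwards [hJ.mem_nhds ht] with x hx using hc x hx
    have : ∀ᵐ t, t ∉ J := by
      filter_upwards [hv] with t ht htJ using ht htJ (h0 t htJ)
    have hnull : volume J = 0 := by simpa [ae_iff] using this
    rw [hJ.measure_zero_iff_eq_empty] at hnull
    rw [hnull] at ht₀
    exact ht₀

end Curve

/-! ### The values of `w` over `u = ± 1` -/

theorem wConst_eq {A p s : ℝ} (x : ℝ) :
    wConst A p s x = ((Real.sqrt (s / 2) * (1 - e₄ A p s ^ 2) * (1 / A) * x : ℝ) : ℂ) := by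
  simp [wConst]

/-- The triples of first integrals with given dynamical constants correspond to the pairs of values
of `w` over `u = ± 1`: both determine `(l - n)²` and `(l + n)²` by evaluation of the cubic
polynomial at `± 1`, and `h` is then determined by one more coefficient. -/
theorem bijOn_wConst {A p s e₁ e₂ e₃ : ℝ} (hA : 0 < A) (hp : 0 < p) (hs : 0 < s)
    (h₁ : -1 ≤ e₁) (h₁₂ : e₁ ≤ e₂) (h₂ : e₂ ≤ 1) (h₃ : 1 ≤ e₃) :
    Set.BijOn
      (fun q : ℝ × ℝ × ℝ => (wConst A p s (q.2.1 - q.2.2), wConst A p s (q.2.1 + q.2.2)))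
      {q : ℝ × ℝ × ℝ | IsDynConst A A p q.1 q.2.1 q.2.2 e₁ e₂ e₃}
      {v : ℂ × ℂ | v.1 ^ 2 = R e₁ e₂ e₃ (e₄ A p s) 1 ∧ v.2 ^ 2 = R e₁ e₂ e₃ (e₄ A p s) (-1)} := by
  have hσ : Real.sqrt (s / 2) ^ 2 = s / 2 := Real.sq_sqrt (by positivity)
  have hσ0 : Real.sqrt (s / 2) ≠ 0 := by positivity
  set c := Real.sqrt (s / 2) * (1 - e₄ A p s ^ 2) * (1 / A) with hc
  have hc1 : c ≠ 0 := by
    have : 1 - e₄ A p s ^ 2 ≠ 0 := by linarith [one_lt_e₄_sq hA hp hs]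
    rw [hc]
    positivity
  have hc2 : c ^ 2 = -(1 - e₄ A p s ^ 2) * (1 / (2 * A * p)) := by
    rw [hc, mul_pow, mul_pow, hσ, e₄_sq hA hp hs]
    field_simp
    ring
  have hw (x : ℝ) : wConst A p s x = ((c * x : ℝ) : ℂ) := wConst_eq x
  have hR (x : ℝ) : R e₁ e₂ e₃ (e₄ A p s) x
      = (((x - e₁) * (x - e₂) * (x - e₃) * (x ^ 2 - e₄ A p s ^ 2) : ℝ) : ℂ) := by
    simp [R]
  have hR1 := hR 1
  have hR2 := hR (-1)
  push_cast at hR1 hR2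
  refine ⟨?_, ?_, ?_⟩
  · rintro ⟨h, l, n⟩ hd
    simp only [Set.mem_ofPred_eq] at hd
    have f1 := hd.factor 1
    have f2 := hd.factor (-1)
    constructor
    · simp only [hw]
      have := hR 1
      rw [Complex.ofReal_one] at this
      rw [this, ← Complex.ofReal_pow, mul_pow, hc2]
      congr 1
      linear_combination (1 - e₄ A p s ^ 2) * f1
    · simp only [hw]
      have := hR (-1)
      rw [Complex.ofReal_neg, Complex.ofReal_one] at this
      rw [this, ← Complex.ofReal_pow, mul_pow, hc2]
      congr 1
      linear_combination (1 - e₄ A p s ^ 2) * f2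
  · rintro ⟨h, l, n⟩ hd ⟨h', l', n'⟩ hd' heq
    simp only [Set.mem_ofPred_eq] at hd hd'
    simp only [hw, Prod.mk.injEq, Complex.ofReal_inj] at heq
    have i1 := mul_left_cancel₀ hc1 heq.1
    have i2 := mul_left_cancel₀ hc1 heq.2
    obtain rfl : l = l' := by linarith
    obtain rfl : n = n' := by linarith
    have f := (hd.factor 0).trans (hd'.factor 0).symm
    rw [sub_left_inj] at f
    have := mul_left_cancel₀ (by positivity : 1 / p * (1 - (0 : ℝ) ^ 2) ≠ 0) f
    obtain rfl : h = h' := by linarith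
    rfl
  · rintro ⟨wp, wm⟩ ⟨hwp, hwm⟩
    simp only at hwp hwm
    -- the values `R(± 1)` are nonnegative real numbers
    have real_sqrt {z : ℂ} {x : ℝ} (hx : 0 ≤ x) (hz : z ^ 2 = x) : ∃ y : ℝ, z = y := by
      have hx' : z ^ 2 = ((Real.sqrt x : ℝ) : ℂ) ^ 2 := by
        rw [hz, ← Complex.ofReal_pow, Real.sq_sqrt hx]
      rcases sq_eq_sq_iff_eq_or_eq_neg.1 hx' with h | h
      · exact ⟨_, h⟩
      · exact ⟨-Real.sqrt x, by rw [h]; simp⟩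
    have hneg : 1 - e₄ A p s ^ 2 ≤ 0 := by linarith [one_lt_e₄_sq hA hp hs]
    have hpos1 : 0 ≤ (1 - e₁) * (1 - e₂) * (1 - e₃) * (1 ^ 2 - e₄ A p s ^ 2) := by
      rw [one_pow]
      refine mul_nonneg_of_nonpos_of_nonpos (mul_nonpos_of_nonneg_of_nonpos
        (mul_nonneg ?_ ?_) ?_) hneg <;> linarith
    have hpos2 : 0 ≤ (-1 - e₁) * (-1 - e₂) * (-1 - e₃) * ((-1) ^ 2 - e₄ A p s ^ 2) := by
      rw [neg_one_sq]
      refine mul_nonneg_of_nonpos_of_nonpos (mul_nonpos_of_nonneg_of_nonpos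
        (mul_nonneg_of_nonpos_of_nonpos ?_ ?_) ?_) hneg <;> linarith
    obtain ⟨yp, rfl⟩ := real_sqrt hpos1 (by rw [hwp]; simpa using hR 1)
    obtain ⟨ym, rfl⟩ := real_sqrt hpos2 (by rw [hwm]; simpa using hR (-1))
    have hyp : yp ^ 2 = (1 - e₁) * (1 - e₂) * (1 - e₃) * (1 - e₄ A p s ^ 2) := by
      have := hwp.trans (by simpa using hR 1)
      exact_mod_cast this
    have hym : ym ^ 2 = (-1 - e₁) * (-1 - e₂) * (-1 - e₃) * (1 - e₄ A p s ^ 2) := by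
      have := hwm.trans (by simpa using hR (-1))
      have h2 : ((ym ^ 2 : ℝ) : ℂ)
          = (((-1 - e₁) * (-1 - e₂) * (-1 - e₃) * (1 - e₄ A p s ^ 2) : ℝ) : ℂ) := by
        push_cast; exact this
      exact_mod_cast h2
    set d := 1 - e₄ A p s ^ 2
    have hd0 : d ≠ 0 := by
      intro h0; apply hc1; rw [hc, h0]; ring
    -- `l - n = a` and `l + n = b`
    set a := yp / c with ha
    set b := ym / c with hb
    have ha2 : 1 / (2 * A * p) * a ^ 2 = -((1 - e₁) * (1 - e₂) * (1 - e₃)) := by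
      have : c ^ 2 * a ^ 2 = yp ^ 2 := by rw [ha]; field_simp
      rw [hc2, hyp] at this
      refine mul_left_cancel₀ hd0 ?_
      linear_combination -this
    have hb2 : 1 / (2 * A * p) * b ^ 2 = -((-1 - e₁) * (-1 - e₂) * (-1 - e₃)) := by
      have : c ^ 2 * b ^ 2 = ym ^ 2 := by rw [hb]; field_simp
      rw [hc2, hym] at this
      refine mul_left_cancel₀ hd0 ?_
      linear_combination -this
    set N := 1 / (2 * A * p)
    -- `h` is chosen so that the constant coefficients agree
    refine ⟨(1 / (2 * A) * ((b - a) / 2) ^ 2 + p * (N * ((a + b) / 2) ^ 2 - e₁ * e₂ * e₃),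
      (a + b) / 2, (b - a) / 2), ?_, ?_⟩
    · refine ⟨h₁, h₁₂, h₂, h₃, fun x => ?_⟩
      have hx : 1 / p * (1 - x ^ 2) * (1 / (2 * A) * ((b - a) / 2) ^ 2
          + p * (N * ((a + b) / 2) ^ 2 - e₁ * e₂ * e₃) - 1 / (2 * A) * ((b - a) / 2) ^ 2 - p * x)
          = (1 - x ^ 2) * (N * ((a + b) / 2) ^ 2 - e₁ * e₂ * e₃ - x) := by
        generalize N * ((a + b) / 2) ^ 2 - e₁ * e₂ * e₃ = M
        field_simp
        ring
      simp only
      rw [hx]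
      linear_combination (-(x ^ 2 + x) / 2) * ha2 - (x ^ 2 - x) / 2 * hb2
    · simp only [hw]
      have i1 : c * ((a + b) / 2 - (b - a) / 2) = yp := by rw [ha]; field_simp; ring
      have i2 : c * ((a + b) / 2 + (b - a) / 2) = ym := by rw [hb]; field_simp; ring
      rw [i1, i2]

/-! ### Singularities of the logarithmic differentials -/

open Filter Topology

/-- An analytic square root with prescribed nonzero value. -/
theorem exists_analyticAt_sqrt {g : ℂ → ℂ} (hg : AnalyticAt ℂ g 0) {a : ℂ} (ha : a ≠ 0)
    (h : g 0 = a ^ 2) : ∃ f : ℂ → ℂ, AnalyticAt ℂ f 0 ∧ f 0 = a ∧ ∀ᶠ z in 𝓝 0, f z ^ 2 = g z := by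
  have ha2 : a ^ 2 ≠ 0 := pow_ne_zero 2 ha
  have h1 : g 0 / a ^ 2 = 1 := by rw [h, div_self ha2]
  refine ⟨fun z => a * Complex.exp (Complex.log (g z / a ^ 2) / 2), ?_, ?_, ?_⟩
  · have hl : AnalyticAt ℂ (fun z => Complex.log (g z / a ^ 2)) 0 :=
      (hg.div analyticAt_const ha2).clog (by
        rw [Pi.div_apply, h1]; exact Complex.one_mem_slitPlane)
    exact analyticAt_const.mul (hl.div analyticAt_const two_ne_zero).cexp
  · simp only [h1]; simp
  · have hne : ∀ᶠ z in 𝓝 0, g z ≠ 0 := hg.continuousAt.eventually_ne (by rw [h]; exact ha2)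
    filter_upwards [hne] with z hz
    rw [mul_pow, ← Complex.exp_nat_mul]
    push_cast
    rw [mul_div_cancel₀ _ (two_ne_zero' ℂ), Complex.exp_log (div_ne_zero hz ha2)]
    field_simp

/-- `F` has only simple zeros; the cofactor of each linear factor is required to be entire. -/
def SimpleZeros (F : ℂ → ℂ) : Prop :=
  ∀ u, F u = 0 → ∃ S : ℂ → ℂ, Differentiable ℂ S ∧ S u ≠ 0 ∧ ∀ x, F x = (x - u) * S x

section Affine

variable {F : ℂ → ℂ}

theorem exists_isLocalParam_affine (hF : Differentiable ℂ F) (hS : SimpleZeros F) (u w : ℂ)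
    (hw : w ^ 2 = F u) : ∃ U W, IsLocalParam (.affine u w hw) U W := by
  by_cases hw0 : w = 0
  · -- at a branch point, `u + z²` and `z √S(u + z²)`
    obtain ⟨S, hSd, hS0, hSF⟩ := hS u (by rw [← hw, hw0]; simp)
    obtain ⟨a, ha⟩ := IsAlgClosed.exists_pow_nat_eq (S u) two_pos
    have ha0 : a ≠ 0 := by rintro rfl; exact hS0 (by rw [← ha]; simp)
    have hin : AnalyticAt ℂ (fun z : ℂ => u + z ^ 2) 0 := by fun_prop
    obtain ⟨f, hf, hf0, hf2⟩ := exists_analyticAt_sqrt (g := fun z => S (u + z ^ 2))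
      ((hSd.analyticAt _).comp hin) ha0 (by simp [ha])
    refine ⟨fun z => u + z ^ 2, fun z => z * f z, hin, analyticAt_id.mul hf, by simp,
      by simp [hw0], Or.inr ?_, ?_⟩
    · have := (hasDerivAt_id (0 : ℂ)).mul hf.differentiableAt.hasDerivAt
      rw [show (fun z => z * f z) = id * f from rfl, this.deriv]
      simpa [hf0] using ha0
    · filter_upwards [hf2] with z hz
      rw [hSF, mul_pow, hz]
      ring
  · have hin : AnalyticAt ℂ (fun z : ℂ => u + z) 0 := by fun_prop
    obtain ⟨f, hf, hf0, hf2⟩ := exists_analyticAt_sqrt (g := fun z => F (u + z))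
      ((hF.analyticAt _).comp hin) hw0 (by simp [hw])
    refine ⟨fun z => u + z, f, hin, hf, by simp, hf0, Or.inl ?_, hf2⟩
    simp

variable {U W : ℂ → ℂ} {u w : ℂ} {hw : w ^ 2 = F u}

/-- The differentiated equation of the curve. -/
theorem IsLocalParam.deriv_eq (hF : Differentiable ℂ F)
    (h : IsLocalParam (.affine u w hw) U W) :
    ∀ᶠ z in 𝓝 0, 2 * W z * deriv W z = deriv F (U z) * deriv U z := by
  obtain ⟨hU, hW, -, -, -, he⟩ := h
  filter_upwards [he.eventually_nhds, hU.eventually_analyticAt, hW.eventually_analyticAt]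
    with z hz hUz hWz
  have h1 := hWz.differentiableAt.hasDerivAt.pow 2
  have h2 : HasDerivAt (fun z => F (U z)) (deriv F (U z) * deriv U z) z :=
    (hF _).hasDerivAt.comp z hUz.differentiableAt.hasDerivAt
  have := (h1.congr_of_eventuallyEq (EventuallyEq.symm hz)).unique h2
  simpa using this

/-- Away from branch points, `u` is a local parameter. -/
theorem IsLocalParam.deriv_fst_ne_zero (hF : Differentiable ℂ F)
    (h : IsLocalParam (.affine u w hw) U W) (hw0 : w ≠ 0) : deriv U 0 ≠ 0 := by
  have h1 := (h.deriv_eq hF).self_of_nhds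
  obtain ⟨-, -, -, hW0, hne, -⟩ := h
  intro h0
  rw [h0, hW0, mul_zero] at h1
  have : deriv W 0 = 0 := by simpa [hw0] using h1
  exact hne.elim (fun h => h h0) (fun h => h this)

theorem deriv_eq_of_factor {S : ℂ → ℂ} (hSd : Differentiable ℂ S)
    (hSF : ∀ x, F x = (x - u) * S x) : deriv F u = S u := by
  have h := ((hasDerivAt_id u).sub_const u).mul (hSd u).hasDerivAt
  have e : F = (fun x => id x - u) * S := funext hSF
  rw [e, h.deriv]
  simp

/-- At branch points, `w` is a local parameter. -/
theorem IsLocalParam.deriv_snd_ne_zero (hF : Differentiable ℂ F) (hF0 : deriv F u ≠ 0)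
    (h : IsLocalParam (.affine u w hw) U W) (hw0 : w = 0) : deriv W 0 ≠ 0 := by
  have h1 := (h.deriv_eq hF).self_of_nhds
  obtain ⟨-, -, hU0, hW0, hne, -⟩ := h
  rw [hU0, hW0, hw0, mul_zero, zero_mul] at h1
  have : deriv U 0 = 0 := by simpa [hF0] using h1.symm
  exact hne.resolve_left (fun h => h this)

theorem tendsto_sub_div {f : ℂ → ℂ} (hf : AnalyticAt ℂ f 0) :
    Tendsto (fun z => (f z - f 0) / z) (𝓝[≠] 0) (𝓝 (deriv f 0)) := by
  have := hf.differentiableAt.hasDerivAt.tendsto_slope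
  refine this.congr fun z => ?_
  simp [slope_def_field]

theorem meromorphicAt_pullback_logDiff (hU : MeromorphicAt U 0) (hW : MeromorphicAt W 0)
    (e ε c : ℂ) :
    MeromorphicAt (pullback (fun u w => 1 / (2 * (u - ε)) * (w + (u ^ 2 - e ^ 2) / (1 - e ^ 2) * c)
      / w) U W) 0 := by
  unfold pullback
  have hU' := hU.deriv
  fun_prop

/-- A meromorphic function with a finite limit has nonnegative order. -/
theorem order_nonneg_of_tendsto {f : ℂ → ℂ} {a : ℂ} (hf : MeromorphicAt f 0)
    (h : Tendsto f (𝓝[≠] 0) (𝓝 a)) : 0 ≤ meromorphicOrderAt f 0 :=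
  (tendsto_nhds_iff_meromorphicOrderAt_nonneg hf).1 ⟨a, h⟩

/-- A nonzero limit of `z f(z)` means that the order is `-1`. -/
theorem order_eq_neg_one_of_tendsto {f : ℂ → ℂ} {a : ℂ} (hf : MeromorphicAt f 0) (ha : a ≠ 0)
    (h : Tendsto (fun z => z * f z) (𝓝[≠] 0) (𝓝 a)) : meromorphicOrderAt f 0 = -1 := by
  have hid : MeromorphicAt (fun z : ℂ => z) 0 := MeromorphicAt.id 0
  have hord : meromorphicOrderAt (fun z : ℂ => z) 0 = 1 := by
    refine (meromorphicOrderAt_eq_int_iff hid (n := 1)).2 ⟨fun _ => 1, analyticAt_const, by simp, ?_⟩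
    filter_upwards with z
    simp
  have h0 : meromorphicOrderAt ((fun z : ℂ => z) * f) 0 = 0 :=
    (tendsto_ne_zero_iff_meromorphicOrderAt_eq_zero (hid.mul hf)).1 ⟨a, ha, h⟩
  rw [meromorphicOrderAt_mul hid hf, hord] at h0
  cases hm : meromorphicOrderAt f 0 with
  | top => rw [hm] at h0; simp at h0
  | coe m =>
    rw [hm] at h0
    have h1 : (1 : ℤ) + m = 0 := by exact_mod_cast h0
    have h2 : m = -1 := by omega
    rw [h2]; rfl

variable {e : ℝ} {ε c : ℂ}

/-- `logDiff e ε c` is regular over `u ≠ ε`. At a branch point this holds since `du / w` is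
regular. -/
theorem isRegularAt_of_ne (hF : Differentiable ℂ F) (hS : SimpleZeros F) (hu : u ≠ ε) :
    IsRegularAt (logDiff e ε c) (.affine u w hw) := by
  refine ⟨exists_isLocalParam_affine hF hS u w hw, fun U W h => ?_⟩
  have hd := h.deriv_eq hF
  have hUne := h.deriv_fst_ne_zero hF
  have hWne (h0 : deriv F u ≠ 0) := h.deriv_snd_ne_zero hF h0
  obtain ⟨hU, hW, hU0, hW0, -, -⟩ := h
  have hm := meromorphicAt_pullback_logDiff hU.meromorphicAt hW.meromorphicAt e ε c
  refine ⟨hm, ?_⟩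
  have cU := hU.continuousAt
  have cW := hW.continuousAt
  have cU' := hU.deriv.continuousAt
  have cW' := hW.deriv.continuousAt
  have hden : 2 * (U 0 - ε) ≠ 0 := mul_ne_zero two_ne_zero (sub_ne_zero.2 (hU0 ▸ hu))
  by_cases hw0 : w = 0
  · obtain ⟨S, hSd, hS0, hSF⟩ := hS u (by rw [← hw, hw0]; simp)
    have hFu : deriv F u ≠ 0 := by rw [deriv_eq_of_factor hSd hSF]; exact hS0
    have hcF : ContinuousAt (fun z => deriv F (U z)) 0 :=
      ((hF.contDiff (n := 1)).continuous_deriv le_rfl).continuousAt.comp cU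
    have hFU : deriv F (U 0) ≠ 0 := by rwa [hU0]
    have hcont : ContinuousAt (fun z => 1 / (2 * (U z - ε)) * (deriv U z
        + (U z ^ 2 - e ^ 2) / (1 - e ^ 2) * c * (2 * deriv W z / deriv F (U z)))) 0 := by
      refine (continuousAt_const.div (continuousAt_const.mul (cU.sub continuousAt_const)) hden).mul
        (cU'.add (((((cU.pow 2).sub continuousAt_const).div_const _).mul continuousAt_const).mul
          ((continuousAt_const.mul cW').div hcF hFU)))
    refine order_nonneg_of_tendsto hm ((hcont.tendsto.mono_left nhdsWithin_le_nhds).congr' ?_)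
    have hWz : ∀ᶠ z in 𝓝[≠] 0, W z ≠ 0 :=
      hW.differentiableAt.hasDerivAt.eventually_ne (hWne hFu hw0)
    filter_upwards [hWz, nhdsWithin_le_nhds hd, nhdsWithin_le_nhds (hcF.eventually_ne hFU)]
      with z hz hdz hFz
    have : 2 * deriv W z / deriv F (U z) = deriv U z / W z := by
      rw [div_eq_div_iff hFz hz]
      linear_combination hdz
    rw [this, pullback, logDiff]
    generalize U z - ε = D
    field_simp
  · have hcont : ContinuousAt (pullback (logDiff e ε c) U W) 0 := by
      refine (((continuousAt_const.div (continuousAt_const.mul (cU.sub continuousAt_const))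
        hden).mul (cW.add ((((cU.pow 2).sub continuousAt_const).div_const _).mul
          continuousAt_const))).div cW (by rwa [hW0])).mul cU'
    exact order_nonneg_of_tendsto hm (hcont.tendsto.mono_left nhdsWithin_le_nhds)

/-- Over `u = ε`, the differential `logDiff e ε c` is regular at `w = -c ≠ 0`. -/
theorem isRegularAt_neg (he : 1 - (e : ℂ) ^ 2 ≠ 0) (hε : ε ^ 2 = 1)
    (hF : Differentiable ℂ F) (hS : SimpleZeros F) (hc : c ≠ 0)
    {hw : (-c) ^ 2 = F ε} : IsRegularAt (logDiff e ε c) (.affine ε (-c) hw) := by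
  refine ⟨exists_isLocalParam_affine hF hS ε (-c) hw, fun U W h => ?_⟩
  have hUne := h.deriv_fst_ne_zero hF (neg_ne_zero.2 hc)
  obtain ⟨hU, hW, hU0, hW0, -, -⟩ := h
  have hm := meromorphicAt_pullback_logDiff hU.meromorphicAt hW.meromorphicAt e ε c
  refine ⟨hm, ?_⟩
  have cW := hW.continuousAt.tendsto.mono_left (nhdsWithin_le_nhds (s := {0}ᶜ))
  have cU' := hU.deriv.continuousAt.tendsto.mono_left (nhdsWithin_le_nhds (s := {0}ᶜ))
  have hG : AnalyticAt ℂ (fun z => W z + (U z ^ 2 - e ^ 2) / (1 - e ^ 2) * c) 0 :=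
    hW.add ((((hU.pow 2).sub analyticAt_const).div analyticAt_const he).mul analyticAt_const)
  have hlim := ((((tendsto_sub_div hG).div (tendsto_sub_div hU) hUne).div_const 2).div cW
    (by rw [hW0]; exact neg_ne_zero.2 hc)).mul cU'
  refine order_nonneg_of_tendsto hm (hlim.congr' ?_)
  filter_upwards [self_mem_nhdsWithin] with z hz
  have hz : z ≠ 0 := hz
  have h0 : W 0 + (U 0 ^ 2 - e ^ 2) / (1 - e ^ 2) * c = 0 := by
    rw [hU0, hW0, hε]
    field_simp
    ring
  simp only [Pi.div_apply, h0, sub_zero, pullback, logDiff]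
  rw [div_div_div_cancel_right₀ hz, hU0]
  generalize U z - ε = D
  ring

/-- Over `u = ε`, the differential `logDiff e ε c` has residue `1` at `w = c`. -/
theorem hasSimplePoleAt_affine (he : 1 - (e : ℂ) ^ 2 ≠ 0) (hε : ε ^ 2 = 1)
    (hF : Differentiable ℂ F) (hS : SimpleZeros F)
    {hw : c ^ 2 = F ε} : HasSimplePoleAt (logDiff e ε c) (.affine ε c hw) 1 := by
  refine ⟨exists_isLocalParam_affine hF hS ε c hw, fun U W h => ?_⟩
  have hd := h.deriv_eq hF
  have hUne := h.deriv_fst_ne_zero hF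
  have hWne (h0 : deriv F ε ≠ 0) := h.deriv_snd_ne_zero hF h0
  obtain ⟨hU, hW, hU0, hW0, -, hcurve⟩ := h
  have hm := meromorphicAt_pullback_logDiff hU.meromorphicAt hW.meromorphicAt e ε c
  suffices hlim : Tendsto (fun z => z * pullback (logDiff e ε c) U W z) (𝓝[≠] 0) (𝓝 1) from
    ⟨hm, order_eq_neg_one_of_tendsto hm one_ne_zero hlim, hlim⟩
  have hle : 𝓝[≠] (0 : ℂ) ≤ 𝓝 0 := nhdsWithin_le_nhds
  have cU := hU.continuousAt.tendsto.mono_left hle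
  have cW := hW.continuousAt.tendsto.mono_left hle
  have cU' := hU.deriv.continuousAt.tendsto.mono_left hle
  have cW' := hW.deriv.continuousAt.tendsto.mono_left hle
  by_cases hc : c = 0
  · -- at a branch point, express `du` and `u - ε` by `w`
    obtain ⟨S, hSd, hS0, hSF⟩ := hS ε (by rw [← hw, hc]; simp)
    have hFS := deriv_eq_of_factor hSd hSF
    have hFε : deriv F ε ≠ 0 := by rw [hFS]; exact hS0
    have hcF : ContinuousAt (fun z => deriv F (U z)) 0 :=
      ((hF.contDiff (n := 1)).continuous_deriv le_rfl).continuousAt.comp hU.continuousAt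
    have hcS : ContinuousAt (fun z => S (U z)) 0 :=
      hSd.continuous.continuousAt.comp hU.continuousAt
    have hFU : deriv F (U 0) ≠ 0 := by rwa [hU0]
    have hSU : S (U 0) ≠ 0 := by rwa [hU0]
    have hW' := hWne hFε hc
    have hlim := ((cW'.div (tendsto_sub_div hW) hW').mul
      ((hcS.tendsto.mono_left hle).div (hcF.tendsto.mono_left hle) hFU))
    have hval : deriv W 0 / deriv W 0 * (S (U 0) / deriv F (U 0)) = 1 := by
      rw [hU0, hFS, div_self hW', div_self hS0, one_mul]
    rw [hval] at hlim
    refine hlim.congr' ?_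
    have hWz : ∀ᶠ z in 𝓝[≠] 0, W z ≠ 0 := by
      have := hW.differentiableAt.hasDerivAt.eventually_ne hW' (c := 0)
      exact this
    filter_upwards [hWz, hle hd, hle (hcF.eventually_ne hFU), hle (hcS.eventually_ne hSU),
      hle hcurve, self_mem_nhdsWithin] with z hz hdz hFz hSz hcz hz0
    have hz0 : z ≠ 0 := hz0
    have hUε : U z - ε ≠ 0 := by
      intro h0
      rw [hSF, h0, zero_mul] at hcz
      exact hz (by simpa using hcz)
    rw [hSF] at hcz
    simp only [Pi.div_apply, hW0, hc, sub_zero, pullback, logDiff, mul_zero, add_zero]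
    have hSz' : S (U z) = W z ^ 2 / (U z - ε) := by
      rw [eq_div_iff hUε, hcz, mul_comm]
    have hUz' : deriv U z = 2 * W z * deriv W z / deriv F (U z) := by
      rw [eq_div_iff hFz, hdz, mul_comm]
    rw [hSz', hUz']
    field_simp
  · have hUne := hUne hc
    have hQ : Tendsto (fun z => W z + (U z ^ 2 - e ^ 2) / (1 - e ^ 2) * c) (𝓝[≠] 0)
        (𝓝 (W 0 + (U 0 ^ 2 - e ^ 2) / (1 - e ^ 2) * c)) :=
      cW.add ((((cU.pow 2).sub_const _).div_const _).mul_const _)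
    have hlim := ((hQ.div (cW.const_mul 2) (by rw [hW0]; exact mul_ne_zero two_ne_zero hc)).mul
      (cU'.div (tendsto_sub_div hU) hUne))
    have hval : (W 0 + (U 0 ^ 2 - e ^ 2) / (1 - e ^ 2) * c) / (2 * W 0)
        * (deriv U 0 / deriv U 0) = 1 := by
      rw [hU0, hW0, hε, div_self he, div_self hUne]
      field_simp
      ring
    rw [hval] at hlim
    refine hlim.congr' ?_
    filter_upwards [self_mem_nhdsWithin] with z hz
    have hz : z ≠ 0 := hz
    simp only [Pi.div_apply, hU0, pullback, logDiff]
    rw [div_div_eq_mul_div]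
    generalize U z - ε = D
    ring

end Affine

open Filter Topology

section Infinity

variable {e₁ e₂ e₃ e : ℝ}

theorem differentiable_R : Differentiable ℂ (R e₁ e₂ e₃ e) := by
  unfold R
  fun_prop

theorem simpleZeros_R (h₁₂ : e₁ ≠ e₂) (h₁₃ : e₁ ≠ e₃) (h₂₃ : e₂ ≠ e₃) (h₁ : e₁ ^ 2 ≠ e ^ 2)
    (h₂ : e₂ ^ 2 ≠ e ^ 2) (h₃ : e₃ ^ 2 ≠ e ^ 2) (he : e ≠ 0) : SimpleZeros (R e₁ e₂ e₃ e) := by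
  have cast {a b : ℝ} (h : a ≠ b) : (a : ℂ) - b ≠ 0 := sub_ne_zero.2 (by exact_mod_cast h)
  have cast' {a : ℝ} (h : a ^ 2 ≠ e ^ 2) : (a : ℂ) ^ 2 - e ^ 2 ≠ 0 :=
    sub_ne_zero.2 (by exact_mod_cast h)
  have he' : (e : ℂ) ≠ 0 := by exact_mod_cast he
  have hpm {a : ℝ} (h : a ^ 2 ≠ e ^ 2) : (e : ℂ) - a ≠ 0 ∧ -(e : ℂ) - a ≠ 0 := by
    constructor <;> intro h0 <;> refine cast' h ?_
    · linear_combination (-(e : ℂ) - a) * h0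
    · linear_combination (e - a : ℂ) * h0
  intro u hu
  have hu' : (u - e₁) * (u - e₂) * (u - e₃) * ((u - e) * (u + e)) = 0 := by
    rw [← hu, R]; ring
  rcases mul_eq_zero.1 hu' with h | h
  · rcases mul_eq_zero.1 h with h | h
    · rcases mul_eq_zero.1 h with h | h
      · obtain rfl := sub_eq_zero.1 h
        exact ⟨fun x => (x - e₂) * (x - e₃) * (x ^ 2 - e ^ 2), by fun_prop,
          mul_ne_zero (mul_ne_zero (cast h₁₂) (cast h₁₃)) (cast' h₁), fun x => by rw [R]; ring⟩
      · obtain rfl := sub_eq_zero.1 h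
        exact ⟨fun x => (x - e₁) * (x - e₃) * (x ^ 2 - e ^ 2), by fun_prop,
          mul_ne_zero (mul_ne_zero (cast h₁₂.symm) (cast h₂₃)) (cast' h₂),
          fun x => by rw [R]; ring⟩
    · obtain rfl := sub_eq_zero.1 h
      exact ⟨fun x => (x - e₁) * (x - e₂) * (x ^ 2 - e ^ 2), by fun_prop,
        mul_ne_zero (mul_ne_zero (cast h₁₃.symm) (cast h₂₃.symm)) (cast' h₃),
        fun x => by rw [R]; ring⟩
  · rcases mul_eq_zero.1 h with h | h
    · obtain rfl := sub_eq_zero.1 h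
      refine ⟨fun x => (x - e₁) * (x - e₂) * (x - e₃) * (x + e), by fun_prop,
        mul_ne_zero (mul_ne_zero (mul_ne_zero (hpm h₁).1 (hpm h₂).1) (hpm h₃).1) ?_,
        fun x => by rw [R]; ring⟩
      rw [← two_mul]
      exact mul_ne_zero two_ne_zero he'
    · obtain rfl := eq_neg_of_add_eq_zero_left h
      refine ⟨fun x => (x - e₁) * (x - e₂) * (x - e₃) * (x - e), by fun_prop,
        mul_ne_zero (mul_ne_zero (mul_ne_zero (hpm h₁).2 (hpm h₂).2) (hpm h₃).2) ?_,
        fun x => by rw [R]; ring⟩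
      rw [show -(e : ℂ) - e = -(2 * e) by ring]
      exact neg_ne_zero.2 (mul_ne_zero two_ne_zero he')

/-- The parameter `z` at infinity with `u = z⁻²`. -/
theorem exists_isLocalParam_infinity :
    ∃ U W, IsLocalParam (.infinity : Place (R e₁ e₂ e₃ e)) U W := by
  obtain ⟨f, hf, hf0, hf2⟩ := exists_analyticAt_sqrt
    (g := fun z => (1 - e₁ * z ^ 2) * (1 - e₂ * z ^ 2) * (1 - e₃ * z ^ 2) * (1 - e ^ 2 * z ^ 4))
    (by fun_prop) (one_ne_zero) (by simp)
  have hid (n : ℤ) : MeromorphicAt (fun z : ℂ => z ^ n) 0 := (MeromorphicAt.id 0).zpow n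
  refine ⟨fun z => z ^ (-2 : ℤ), fun z => z ^ (-5 : ℤ) * f z, hid _,
    (hid _).mul hf.meromorphicAt, ?_, ?_⟩
  · refine (meromorphicOrderAt_eq_int_iff (hid _) (n := -2)).2
      ⟨fun _ => 1, analyticAt_const, one_ne_zero, ?_⟩
    filter_upwards with z
    simp
  · filter_upwards [nhdsWithin_le_nhds hf2, self_mem_nhdsWithin] with z hz hz0
    have hz0 : z ≠ 0 := hz0
    rw [mul_pow, hz, R]
    simp only [zpow_neg]
    norm_cast
    field_simp

/-- Since `u` has a double pole at infinity, its logarithmic derivative has residue `-2` there. -/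
theorem tendsto_logDeriv_of_order {U : ℂ → ℂ} (hU : MeromorphicAt U 0)
    (ho : meromorphicOrderAt U 0 = -2) :
    Tendsto (fun z => z * (deriv U z / U z)) (𝓝[≠] 0) (𝓝 (-2)) := by
  obtain ⟨g, hg, hg0, he⟩ := (meromorphicOrderAt_eq_int_iff hU (n := -2)).1 ho
  have hlim : Tendsto (fun z => -2 + z * (deriv g z / g z)) (𝓝[≠] 0)
      (𝓝 (-2 + 0 * (deriv g 0 / g 0))) := by
    have : ContinuousAt (fun z => -2 + z * (deriv g z / g z)) 0 :=
      continuousAt_const.add (continuousAt_id.mul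
        (hg.deriv.continuousAt.div hg.continuousAt hg0))
    exact this.tendsto.mono_left nhdsWithin_le_nhds
  rw [zero_mul, add_zero] at hlim
  refine hlim.congr' ?_
  have he' : ∀ᶠ z in 𝓝[≠] (0 : ℂ), U =ᶠ[𝓝 z] fun z => (z - 0) ^ (-2 : ℤ) • g z := by
    have := eventually_eventually_nhdsWithin.2 he
    filter_upwards [this, self_mem_nhdsWithin] with z hz hz0
    rwa [IsOpen.nhdsWithin_eq isOpen_compl_singleton hz0] at hz
  filter_upwards [he', nhdsWithin_le_nhds hg.eventually_analyticAt,
    nhdsWithin_le_nhds (hg.continuousAt.eventually_ne hg0), self_mem_nhdsWithin]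
    with z hz hgz hgz0 hz0
  have hz0 : z ≠ 0 := hz0
  have hd : HasDerivAt (fun z => (z - 0) ^ (-2 : ℤ) • g z)
      (((-2 : ℤ) : ℂ) * z ^ (-2 - 1 : ℤ) * g z + z ^ (-2 : ℤ) * deriv g z) z := by
    simp only [sub_zero, smul_eq_mul]
    exact (hasDerivAt_zpow (-2) z (Or.inl hz0)).mul hgz.differentiableAt.hasDerivAt
  rw [hz.deriv_eq, hd.deriv, hz.self_of_nhds]
  have e3 : z ^ (-2 - 1 : ℤ) = z ^ (-2 : ℤ) / z := by
    rw [zpow_sub_one₀ hz0]; rfl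
  have hzz : z ^ (-2 : ℤ) ≠ 0 := zpow_ne_zero _ hz0
  simp only [sub_zero, smul_eq_mul]
  rw [e3]
  generalize z ^ (-2 : ℤ) = y at *
  push_cast
  field_simp

/-- `(u² - e²)² / R(u)` vanishes at infinity; so `(u² - e²) / w` does, too. -/
theorem tendsto_ratio {U W : ℂ → ℂ} (hU : Tendsto (fun z => (U z)⁻¹) (𝓝[≠] 0) (𝓝 0))
    (hU0 : ∀ a : ℂ, ∀ᶠ z in 𝓝[≠] 0, U z ≠ a)
    (hW : ∀ᶠ z in 𝓝[≠] 0, W z ^ 2 = R e₁ e₂ e₃ e (U z)) :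
    (∀ᶠ z in 𝓝[≠] 0, W z ≠ 0) ∧
      Tendsto (fun z => (U z ^ 2 - e ^ 2) / W z) (𝓝[≠] 0) (𝓝 0) := by
  have hfac : ∀ᶠ z in 𝓝[≠] 0, U z ≠ 0 ∧ U z - e₁ ≠ 0 ∧ U z - e₂ ≠ 0 ∧ U z - e₃ ≠ 0 ∧
      U z ^ 2 - e ^ 2 ≠ 0 := by
    filter_upwards [hU0 0, hU0 e₁, hU0 e₂, hU0 e₃, hU0 e, hU0 (-e)] with z h0 h1 h2 h3 h4 h5
    refine ⟨h0, sub_ne_zero.2 h1, sub_ne_zero.2 h2, sub_ne_zero.2 h3, ?_⟩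
    rw [sq_sub_sq]
    exact mul_ne_zero (fun h => h5 (eq_neg_of_add_eq_zero_left h)) (sub_ne_zero.2 h4)
  have hW0 : ∀ᶠ z in 𝓝[≠] 0, W z ≠ 0 := by
    filter_upwards [hfac, hW] with z hz hWz h0
    rw [h0, R] at hWz
    exact mul_ne_zero (mul_ne_zero (mul_ne_zero hz.2.1 hz.2.2.1) hz.2.2.2.1) hz.2.2.2.2
      (by rw [← hWz]; simp)
  refine ⟨hW0, ?_⟩
  have hsq : Tendsto (fun z => ((U z ^ 2 - e ^ 2) / W z) ^ 2) (𝓝[≠] 0) (𝓝 0) := by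
    -- in terms of `y = 1/u`, the square is `y` times a continuous function
    have hc : ContinuousAt (fun y : ℂ => y * ((1 - e ^ 2 * y ^ 2)
        / ((1 - e₁ * y) * (1 - e₂ * y) * (1 - e₃ * y)))) 0 := by
      refine continuousAt_id.mul (ContinuousAt.div (by fun_prop) (by fun_prop) (by simp))
    have hlim := hc.tendsto.comp hU
    rw [zero_mul] at hlim
    refine hlim.congr' ?_
    filter_upwards [hfac, hW, hW0] with z hz hWz hWz0
    obtain ⟨h0, h1, h2, h3, h4⟩ := hz
    have c (a : ℂ) : 1 - a * (U z)⁻¹ = (U z - a) / U z := by field_simp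
    rw [div_pow, hWz, R, Function.comp_apply, c, c, c]
    field_simp
  rw [tendsto_zero_iff_norm_tendsto_zero] at hsq ⊢
  have := (Real.continuous_sqrt.tendsto 0).comp hsq
  rw [Real.sqrt_zero] at this
  refine this.congr fun z => ?_
  rw [Function.comp_apply, norm_pow, Real.sqrt_sq (norm_nonneg _)]

/-- The residue of `logDiff e ε c` at infinity is `-1`: the differential is `du / (2(u - ε))` up to
a term regular at infinity. -/
theorem hasSimplePoleAt_infinity (ε c : ℂ) :
    HasSimplePoleAt (logDiff e ε c) (.infinity : Place (R e₁ e₂ e₃ e)) (-1) := by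
  refine ⟨exists_isLocalParam_infinity, fun U W h => ?_⟩
  obtain ⟨hU, hW, ho, hcurve⟩ := h
  have hm := meromorphicAt_pullback_logDiff hU hW e ε c
  suffices hlim : Tendsto (fun z => z * pullback (logDiff e ε c) U W z) (𝓝[≠] 0) (𝓝 (-1)) from
    ⟨hm, order_eq_neg_one_of_tendsto hm (neg_ne_zero.2 one_ne_zero) hlim, hlim⟩
  have hcob : Tendsto U (𝓝[≠] 0) (Bornology.cobounded ℂ) :=
    (tendsto_cobounded_iff_meromorphicOrderAt_neg hU).2 (by rw [ho]; decide)
  have hinv : Tendsto (fun z => (U z)⁻¹) (𝓝[≠] 0) (𝓝 0) :=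
    Filter.tendsto_inv₀_cobounded.comp hcob
  have hne (a : ℂ) : ∀ᶠ z in 𝓝[≠] 0, U z ≠ a := hcob.eventually_ne_cobounded a
  obtain ⟨hW0, hratio⟩ := tendsto_ratio hinv hne hcurve
  have hlog := tendsto_logDeriv_of_order hU ho
  have h1 : Tendsto (fun z => 1 / (2 * (1 - ε * (U z)⁻¹))) (𝓝[≠] 0)
      (𝓝 (1 / (2 * (1 - ε * 0)))) :=
    tendsto_const_nhds.div (((hinv.const_mul ε).const_sub 1).const_mul 2) (by simp)
  have h2 := (hlog.mul h1).mul ((hratio.mul_const (c / (1 - e ^ 2))).const_add 1)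
  have hval : -2 * (1 / (2 * (1 - ε * 0))) * (1 + 0 * (c / (1 - (e : ℂ) ^ 2))) = -1 := by
    simp
  rw [hval] at h2
  refine h2.congr' ?_
  filter_upwards [hne 0, hne ε, hW0] with z hz hzε hWz
  have hzε' : U z - ε ≠ 0 := sub_ne_zero.2 hzε
  have e1 : 1 - ε * (U z)⁻¹ = (U z - ε) / U z := by field_simp
  rw [e1, pullback, logDiff]
  generalize U z - ε = D at *
  generalize (1 - (e : ℂ) ^ 2) = d
  have e2 : 1 + (U z ^ 2 - e ^ 2) / W z * (c / d) = (W z + (U z ^ 2 - e ^ 2) / d * c) / W z := by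
    rw [add_div, div_self hWz]; ring
  rw [e2]
  field_simp

theorem isThirdKind_logDiff (hS : SimpleZeros (R e₁ e₂ e₃ e)) (he : 1 - (e : ℂ) ^ 2 ≠ 0) {ε c : ℂ}
    (hε : ε ^ 2 = 1) (hw : c ^ 2 = R e₁ e₂ e₃ e ε) :
    IsThirdKind (logDiff e ε c) (.affine ε c hw : Place (R e₁ e₂ e₃ e)) .infinity := by
  refine ⟨by simp, hasSimplePoleAt_affine he hε differentiable_R hS,
    hasSimplePoleAt_infinity ε c, fun X hX1 hX2 => ?_⟩
  cases X with
  | infinity => exact absurd rfl hX2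
  | affine u w hw' =>
    by_cases hu : u = ε
    · subst hu
      rcases sq_eq_sq_iff_eq_or_eq_neg.1 (hw'.trans hw.symm) with rfl | rfl
      · exact absurd rfl hX1
      · refine isRegularAt_neg he hε differentiable_R hS ?_
        rintro rfl
        exact hX1 (by simp)
    · exact isRegularAt_of_ne differentiable_R hS hu

end Infinity

end ToyTop

open ToyTop

theorem mainTheorem1 (A C p s : ℝ) (hA : 0 < A) (hC : 0 < C) (hp : 0 < p) (hs : 0 < s) :
    -- every motion has dynamical constants
    (∀ (J : Set ℝ) (Φ : ℝ → Mat) (h l n : ℝ), J.Nonempty → IsOpen J →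
      IsMotion A C p s J h l n Φ → ∃ e₁ e₂ e₃ : ℝ, IsDynConst A C p h l n e₁ e₂ e₃) ∧
    (∀ e₁ e₂ e₃ : ℝ, -1 ≤ e₁ → e₁ ≤ e₂ → e₂ ≤ 1 → 1 ≤ e₃ →
      -- spherical top: the choices of the values of `w` over `u = 1` and `u = -1` correspond to
      -- the possible values of `(l, n)` (which determine `h`)
      Set.BijOn
        (fun q : ℝ × ℝ × ℝ => (wConst A p s (q.2.1 - q.2.2), wConst A p s (q.2.1 + q.2.2)))
        {q : ℝ × ℝ × ℝ | IsDynConst A A p q.1 q.2.1 q.2.2 e₁ e₂ e₃}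
        {v : ℂ × ℂ | v.1 ^ 2 = R e₁ e₂ e₃ (e₄ A p s) 1 ∧
          v.2 ^ 2 = R e₁ e₂ e₃ (e₄ A p s) (-1)} ∧
      -- spherical top: the solutions are given by the hyperelliptic integrals
      (∀ (J : Set ℝ) (Φ : ℝ → Mat) (h l n : ℝ), J.Nonempty → IsOpen J → J.OrdConnected →
        IsCurve J Φ → IsDynConst A A p h l n e₁ e₂ e₃ →
        ((IsMotion A A p s J h l n Φ ∧ ¬ ∃ c : ℝ, ∀ t ∈ J, height (Φ t) = c) ↔
          GivenByIntegrals s e₁ e₂ e₃ (e₄ A p s) (wConst A p s (l - n)) (wConst A p s (l + n))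
            J Φ)) ∧
      -- the poles of the logarithmic differentials
      (e₁ < e₂ → e₂ < e₃ → e₃ ≠ e₄ A p s →
        ∀ (wp wm : ℂ) (hwp : wp ^ 2 = R e₁ e₂ e₃ (e₄ A p s) 1)
          (hwm : wm ^ 2 = R e₁ e₂ e₃ (e₄ A p s) (-1)),
          IsThirdKind (dlogα (e₄ A p s) wm) (.affine (-1) wm hwm) .infinity ∧
          IsThirdKind (dlogβ (e₄ A p s) wp) (.affine 1 (-wp) ((neg_sq wp).trans hwp)) .infinity ∧
          IsThirdKind (dlogγ (e₄ A p s) wp) (.affine 1 wp hwp) .infinity ∧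
          IsThirdKind (dlogδ (e₄ A p s) wm) (.affine (-1) (-wm) ((neg_sq wm).trans hwm)) .infinity)) ∧
    -- general top: the solutions are the spherical ones times a uniform rotation
    (∀ (J : Set ℝ) (Ψ : ℝ → Mat) (h l n : ℝ), IsOpen J →
      (IsMotion A C p s J (h + n ^ 2 / (2 * C)) l n Ψ ↔
        ∃ Φ : ℝ → Mat, IsMotion A A p s J (h + n ^ 2 / (2 * A)) l n Φ ∧
          ∀ t, Ψ t = Φ t * spin ((1 / C - 1 / A) * n) t)) ∧
    (∀ h l n e₁ e₂ e₃ : ℝ, IsDynConst A C p (h + n ^ 2 / (2 * C)) l n e₁ e₂ e₃ ↔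
      IsDynConst A A p (h + n ^ 2 / (2 * A)) l n e₁ e₂ e₃) := by
  refine ⟨fun J Φ h l n hne hJ hΦ => hΦ.exists_isDynConst hA hp hs hJ hne,
    fun e₁ e₂ e₃ h₁ h₁₂ h₂ h₃ => ⟨bijOn_wConst hA hp hs h₁ h₁₂ h₂ h₃, ?_, ?_⟩,
    fun J Ψ h l n hJ => isMotion_iff_exists_spin hA.ne' hC.ne' hJ Ψ,
    fun h l n e₁ e₂ e₃ => isDynConst_iff_spherical⟩
  · intro J Φ h l n hne hJ hJ' hΦ hd
    exact ⟨fun hM => hM.1.givenByIntegrals hA hp hs hJ hJ' hd hM.2,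
      hΦ.isMotion_of_givenByIntegrals hA hp hs hJ hJ' hne hd⟩
  · intro hlt₁₂ hlt₂₃ hne₃ wp wm hwp hwm
    have h4 := one_lt_e₄_sq hA hp hs
    have h40 : 0 ≤ e₄ A p s := Real.sqrt_nonneg _
    have he : 1 - (e₄ A p s : ℂ) ^ 2 ≠ 0 := by
      have : 1 - e₄ A p s ^ 2 ≠ 0 := by linarith
      exact_mod_cast this
    have hS : SimpleZeros (R e₁ e₂ e₃ (e₄ A p s)) := by
      refine simpleZeros_R hlt₁₂.ne (hlt₁₂.trans hlt₂₃).ne hlt₂₃.ne ?_ ?_ ?_ ?_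
      · nlinarith
      · nlinarith
      · intro h
        exact hne₃ ((sq_eq_sq₀ (by linarith) h40).1 h)
      · intro h
        rw [h] at h4
        norm_num at h4
    exact ⟨isThirdKind_logDiff hS he (by norm_num) hwm,
      isThirdKind_logDiff hS he (by norm_num) _, isThirdKind_logDiff hS he (by norm_num) hwp,
      isThirdKind_logDiff hS he (by norm_num) _⟩
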